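/- Let $N\ge 2$, let $q=e^{\ell}$ with $0<|q|<1$ for a fixed logarithm $\ell$, and put $q^x=e^{\ell x}$ and $[x]=\frac{q^x-q^{-x}}{q-q^{-1}}$ for $x\in\mathbb C$. Let $(a_{ij})$ be the Cartan matrix of $sl_N$, and let the level $k\in\mathbb C$ satisfy $[(k+N)n]\ne0$ for all integers $n\ge1$ (for real $\ell$ and $k$ this means $k\neq -N$). Consider the Heisenberg algebra with generators $a^i_n,p_a^i,q_a^i$ ($1\le i\le N-1$) and $b^{ij}_n,p_b^{ij},q_b^{ij}$, $c^{ij}_n,p_c^{ij},q_c^{ij}$ ($1\le i<j\le N$), $n\in\mathbb Z\setminus\{0\}$, whose nonzero commutators are $$[a^i_n,a^j_m]=\tfrac{[(k+N)n][a_{ij}n]}{n}\delta_{n+m,0},\quad [b^{ij}_n,b^{ij}_m]=-\tfrac{[n]^2}{n}\delta_{n+m,0},\quad [c^{ij}_n,c^{ij}_m]=\tfrac{[n]^2}{n}\delta_{n+m,0},$$ $$[p_a^i,q_a^j]=a_{ij}(k+N),\quad [p_b^{ij},q_b^{ij}]=-1,\quad [p_c^{ij},q_c^{ij}]=1,$$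 acting on the direct sum of its Fock spaces over all momenta (eigenvalues of the $p$'s), the modes with $n>0$ being annihilation operators. For a boson $x$ (one of $a^i,b^{ij},c^{ij}$) let $$x(z)=-\sum_{n\ne0}\tfrac{x_n}{[n]}z^{-n}+q_x+p_x\ln z,\qquad x_\pm(z)=\pm\Big((q-q^{-1})\sum_{n>0}x_{\pm n}z^{\mp n}+p_x\ln q\Big),$$ with the convention $b^{ii}=c^{ii}=0$, and let $:\;:$ denote normal ordering (creation modes and $q_x$ to the left, annihilation modes and $p_x$ to the right). Write $(b+c)^{ij}(z)=b^{ij}(z)+c^{ij}(z)$. For $1\le i\le N-1$ the Wakimoto currents of $U_q(\widehat{sl_N})$ are $$\psi_\pm^i(z)=:\exp\Big(\sum_{j=1}^{i}\big(b_\pm^{j,i+1}(q^{\pm(\frac k2+j-1)}z)-b_\pm^{j,i}(q^{\pm(\frac k2+j)}z)\big)+a^i_\pm(q^{\pm\frac N2}z)+\sum_{j=i+1}^N\big(b_\pm^{i,j}(q^{\pm(\frac k2+j)}z)-b_\pm^{i+1,j}(q^{\pm(\frac k2+j-1)}z)\big)\Big):,$$ $$e^{+,i}(z)=\tfrac{-1}{(q-q^{-1})z}\sum_{j=1}^i:e^{(b+c)^{j,i}(q^{j-1}z)}\Big(e^{b_+^{j,i+1}(q^{j-1}z)-(b+c)^{j,i+1}(q^jz)}-e^{b_-^{j,i+1}(q^{j-1}z)-(b+c)^{j,i+1}(q^{j-2}z)}\Big)e^{\sum_{m=1}^{j-1}(b_+^{m,i+1}(q^{m-1}z)-b_+^{m,i}(q^mz))}:,$$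 and, with $T_-(z)=a_-^i(q^{-\frac{k+N}2}z)+\sum_{m=i+1}^N\big(b_-^{i,m}(q^{-(k+m)}z)-b_-^{i+1,m}(q^{-(k+m-1)}z)\big)$ and $T_{+,j}(z)=a_+^i(q^{\frac{k+N}2}z)+\sum_{m=j}^N\big(b_+^{i,m}(q^{k+m}z)-b_+^{i+1,m}(q^{k+m-1}z)\big)$, $$\begin{aligned}e^{-,i}(z)=\tfrac{-1}{(q-q^{-1})z}\Big\{&\sum_{j=1}^{i-1}:e^{(b+c)^{j,i+1}(q^{-(k+j)}z)}\Big(e^{-b_-^{j,i}(q^{-(k+j)}z)-(b+c)^{j,i}(q^{-(k+j-1)}z)}-e^{-b_+^{j,i}(q^{-(k+j)}z)-(b+c)^{j,i}(q^{-(k+j+1)}z)}\Big)\\&\qquad\times e^{\sum_{m=j+1}^{i}(b_-^{m,i+1}(q^{-(k+m-1)}z)-b_-^{m,i}(q^{-(k+m)}z))+T_-(z)}:\\&+:e^{(b+c)^{i,i+1}(q^{-(k+i)}z)+T_-(z)}:-:e^{(b+c)^{i,i+1}(q^{k+i}z)+T_{+,i+1}(z)}:\\&-\sum_{j=i+2}^N:e^{(b+c)^{i,j}(q^{k+j-1}z)}\Big(e^{b_+^{i+1,j}(q^{k+j-1}z)-(b+c)^{i+1,j}(q^{k+j}z)}-e^{b_-^{i+1,j}(q^{k+j-1}z)-(b+c)^{i+1,j}(q^{k+j-2}z)}\Big)e^{T_{+,j}(z)}:\Big\}.\end{aligned}$$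 Let $\Lambda=(\lambda^1,\dots,\lambda^{N-1})\in\mathbb C^{N-1}$. With the dual bosons $\check a^i_n=\sum_{j=1}^{N-1}n\frac{[\min(i,j)n][(N-\max(i,j))n]}{[(k+N)n][Nn][n]^2}a^j_n$, $\check p_a^i=\sum_{j=1}^{N-1}\frac{\min(i,j)(N-\max(i,j))}{(k+N)N}p_a^j$, $\check q_a^i=\sum_{j=1}^{N-1}\frac{\min(i,j)(N-\max(i,j))}{(k+N)N}q_a^j$, define $\psi_\Lambda(z)=:\prod_{i=1}^{N-1}\psi_{\lambda^i}(z):$, where $$\begin{aligned}\psi_{\lambda^i}(z)=:\exp\Big\{&-\sum_{n>0}\tfrac{[\lambda^{N-i}n]}{n}q^{-\frac{k+N}2n}\big(\check a^i_{-n}z^n+\check a^i_nz^{-n}\big)+\lambda^{N-i}(\check q_a^i+\check p_a^i\ln z)\\&+\sum_{j=i+1}^N\Big(\sum_{n>0}\tfrac{[\lambda^{j-i}n]}{[n]^2}\big((b^{ij}_{-n}+c^{ij}_{-n})z^n-(b^{ij}_n+c^{ij}_n)z^{-n}\big)+\lambda^{j-i}\big(q_b^{ij}+q_c^{ij}+(p_b^{ij}+p_c^{ij})\ln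 z\big)\Big)\Big\}:.\end{aligned}$$ Then for every $1\le i\le N-1$ $$\psi_\pm^i(z)\psi_\Lambda(w)=q^{\lambda^i}\frac{w-q^{-\lambda^i\pm\frac k2}z}{w-q^{\lambda^i\pm\frac k2}z}\,\psi_\Lambda(w)\psi_\pm^i(z),$$ $$e^{+,i}(z)\psi_\Lambda(w)=q^{\lambda^i}\frac{w-q^{-\lambda^i}z}{w-q^{\lambda^i}z}\,\psi_\Lambda(w)e^{+,i}(z),\qquad e^{-,i}(z)\psi_\Lambda(w)=\psi_\Lambda(w)e^{-,i}(z).$$ These exchange relations $A(z)B(w)=\rho(z,w)B(w)A(z)$ are meant in the sense of analytic continuation: the matrix elements of $A(z)B(w)$ between basis states (momentum eigenstates given by monomials in the creation modes) converge absolutely for $|z|\gg|w|$, those of $B(w)A(z)$ for $|w|\gg|z|$, and the matrix elements of $A(z)B(w)$ and of $\rho(z,w)B(w)A(z)$ are the restrictions to these regions of one and the same meromorphic function of $(\ln z,\ln w)$, which is an entire function divided by a nonzero polynomial in $w/z$; the regions and the polynomial do not depend on the states. -/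

import Mathlib

open scoped Nat

namespace QWakimoto

noncomputable section

/-! ## q-numbers

Throughout `l : ℂ` is a chosen logarithm of `q`, that is `q = exp l`, so that `q ^ x` makes sense for
all complex `x`. In the same way points of `ℂ \ {0}` are given by their logarithms `s`, `z = exp s`,
so that `ln z = s` and `ln (q ^ x * z) = s + x * l`. -/

/-- `q ^ x` for `q = exp l`. -/
def qpow (l x : ℂ) : ℂ := Complex.exp (l * x)

/-- The q-number `[x] = (q ^ x - q ^ (-x)) / (q - q⁻¹)`. -/
def qnum (l x : ℂ) : ℂ := (qpow l x - qpow l (-x)) / (qpow l 1 - qpow l (-1))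

/-! ## The bosons and their Fock space -/

/-- The pairs `i < j` (an element `m` of `Fin N` stands for the index `m + 1`). -/
abbrev Root (N : ℕ) : Type := {r : Fin N × Fin N // r.1 < r.2}

/-- The `N ^ 2 - 1` bosons: `a^i` for `1 ≤ i ≤ N - 1`, then `b^{ij}`, then `c^{ij}`, for
`1 ≤ i < j ≤ N`. -/
abbrev Boson (N : ℕ) : Type := Fin (N - 1) ⊕ (Root N ⊕ Root N)

/-- The coordinate vector of the boson `a^i` (zero unless `1 ≤ i ≤ N - 1`). -/
def vecA (N i : ℕ) : Boson N → ℂ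
  | .inl r => if (r : ℕ) + 1 = i then 1 else 0
  | .inr _ => 0

/-- The coordinate vector of the boson `b^{ij}` (zero unless `1 ≤ i < j ≤ N`; in particular
`b^{ii} = 0`). -/
def vecB (N i j : ℕ) : Boson N → ℂ
  | .inr (.inl r) => if (r.1.1 : ℕ) + 1 = i ∧ (r.1.2 : ℕ) + 1 = j then 1 else 0
  | _ => 0

/-- The coordinate vector of the boson `c^{ij}` (zero unless `1 ≤ i < j ≤ N`; in particular
`c^{ii} = 0`). -/
def vecC (N i j : ℕ) : Boson N → ℂ
  | .inr (.inr r) => if (r.1.1 : ℕ) + 1 = i ∧ (r.1.2 : ℕ) + 1 = j then 1 else 0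
  | _ => 0

/-- The structure constants of the oscillators: `[x_n, y_m] = gram n x y * δ_{n+m,0}`. -/
def gram (N : ℕ) (l k : ℂ) (n : ℤ) : Boson N → Boson N → ℂ
  | .inl i, .inl j => qnum l ((k + N) * n) * qnum l ((CartanMatrix.A (N - 1) i j : ℂ) * n) / n
  | .inr (.inl r), .inr (.inl r') => if r = r' then -(qnum l n ^ 2 / n) else 0
  | .inr (.inr r), .inr (.inr r') => if r = r' then qnum l n ^ 2 / n else 0
  | _, _ => 0

/-- The structure constants of the zero modes: `[p_x, q_y] = gramZero x y`. -/
def gramZero (N : ℕ) (k : ℂ) : Boson N → Boson N → ℂ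
  | .inl i, .inl j => (CartanMatrix.A (N - 1) i j : ℂ) * (k + N)
  | .inr (.inl r), .inr (.inl r') => if r = r' then -1 else 0
  | .inr (.inr r), .inr (.inr r') => if r = r' then 1 else 0
  | _, _ => 0

/-- A (possibly infinite) formal linear combination
`∑ osc x n • x_n + ∑ mom x • p_x + ∑ pos x • q_x` of the generators of the Heisenberg algebra,
recorded as the triple `(osc, mom, pos)`. The value `osc x 0` is not used. -/
abbrev LinComb (N : ℕ) : Type := (Boson N → ℤ → ℂ) × (Boson N → ℂ) × (Boson N → ℂ)

/-- A creation operator `x_{-n}`, `n > 0`. -/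
abbrev Mode (N : ℕ) : Type := Boson N × ℕ+

/-- The oscillator Fock space: polynomials in the creation operators `x_{-n} = X (x, n)`. -/
abbrev OscFock (N : ℕ) : Type := MvPolynomial (Mode N) ℂ

/-- The commutator of the annihilation part `∑_{x, n > 0} c x n • x_n` of a linear combination with
the creation operator `y_{-n}`, `(y, n) = m`. -/
def contraction (N : ℕ) (l k : ℂ) (c : Boson N → ℤ → ℂ) (m : Mode N) : ℂ :=
  ∑ x, c x (m.2 : ℕ) * gram N l k (m.2 : ℕ) x m.1

/-- The annihilation part `∑_{x, n > 0} c x n • x_n` acts as the derivation that sends each creation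
operator to its commutator with it. -/
def annih (N : ℕ) (l k : ℂ) (c : Boson N → ℤ → ℂ) : Derivation ℂ (OscFock N) (OscFock N) :=
  MvPolynomial.mkDerivation ℂ fun m => MvPolynomial.C (contraction N l k c m)

/-- The oscillator `x_n`, `n ≠ 0`. -/
def osc (N : ℕ) (l k : ℂ) (x : Boson N) (n : ℤ) : OscFock N →ₗ[ℂ] OscFock N :=
  if 0 < n then (annih N l k (Pi.single x (Pi.single n 1)) : OscFock N →ₗ[ℂ] OscFock N)
  else if n < 0 then LinearMap.mulLeft ℂ (MvPolynomial.X (x, n.natAbs.toPNat'))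
  else 0

theorem contraction_single (N : ℕ) (l k : ℂ) (x : Boson N) (n : ℤ) (m : Mode N) :
    contraction N l k (Pi.single x (Pi.single n 1)) m
      = if ((m.2 : ℕ) : ℤ) = n then gram N l k n x m.1 else 0 := by
  classical
  unfold contraction
  rw [Finset.sum_eq_single x]
  · simp only [Pi.single_apply]
    by_cases h : ((m.2 : ℕ) : ℤ) = n
    · simp [h]
    · simp [h]
  · intro y _ hy
    simp [hy]
  · simp

theorem gram_symm (N : ℕ) (l k : ℂ) (n : ℤ) (x y : Boson N) : gram N l k (-n) x y = - gram N l k n y x := by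
  have hn : ∀ a : ℂ, qnum l (-a) = - qnum l a := by
    intro a; unfold qnum; rw [neg_neg]; ring
  have hs : ∀ i j, CartanMatrix.A (N-1) i j = CartanMatrix.A (N-1) j i := by
    intro i j
    have := CartanMatrix.A_isSymm (N-1)
    exact (this.apply i j).symm
  rcases x with i | r | r <;> rcases y with j | r' | r' <;> simp [gram, hn, div_neg]
  · rw [hs]
  · by_cases h : r = r'
    · simp [h]
    · simp [h, Ne.symm h]
  · by_cases h : r = r'
    · simp [h]
    · simp [h, Ne.symm h]

/-- The oscillators satisfy the relations of the Heisenberg algebra. -/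
theorem osc_comm (N : ℕ) (l k : ℂ) (x y : Boson N) {n m : ℤ} (hn : n ≠ 0) (hm : m ≠ 0)
    (f : OscFock N) :
    osc N l k x n (osc N l k y m f) - osc N l k y m (osc N l k x n f)
      = (if n + m = 0 then gram N l k n x y else 0) • f := by
  have key : ∀ (x y : Boson N) (n m : ℤ), 0 < n → m < 0 → ∀ f : OscFock N,
      osc N l k x n (osc N l k y m f) - osc N l k y m (osc N l k x n f)
        = (if n + m = 0 then gram N l k n x y else 0) • f := by
    intro x y n m hn hm f
    have h0 : (((m.natAbs.toPNat' : ℕ+) : ℕ) : ℤ) = -m := by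
      rw [Nat.toPNat'_coe, if_pos (by omega)]; omega
    simp only [osc, if_pos hn, if_neg (not_lt.mpr hm.le), if_pos hm, LinearMap.mulLeft_apply,
      Derivation.coeFn_coe, Derivation.leibniz, smul_eq_mul]
    rw [annih, MvPolynomial.mkDerivation_X, contraction_single]
    simp only [h0]
    by_cases h : n + m = 0
    · rw [if_pos h, if_pos (by omega), MvPolynomial.smul_eq_C_mul]; ring
    · rw [if_neg h, if_neg (by omega)]; simp
  have pp : ∀ (x y : Boson N) (n m : ℤ), 0 < n → 0 < m → ∀ f : OscFock N,
      osc N l k x n (osc N l k y m f) = osc N l k y m (osc N l k x n f) := by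
    intro x y n m hn hm f
    simp only [osc, if_pos hn, if_pos hm, Derivation.coeFn_coe]
    have : ⁅annih N l k (Pi.single x (Pi.single n 1)), annih N l k (Pi.single y (Pi.single m 1))⁆ = 0 := by
      apply MvPolynomial.derivation_ext
      intro z
      simp [Derivation.commutator_apply, annih, MvPolynomial.mkDerivation_X]
    have := congrArg (fun D => D f) this
    simp only [Derivation.commutator_apply, Derivation.coe_zero, Pi.zero_apply] at this
    exact sub_eq_zero.mp this
  rcases lt_or_gt_of_ne hn with hn | hn <;> rcases lt_or_gt_of_ne hm with hm | hm
  · rw [if_neg (by omega)]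
    simp only [osc, if_neg (not_lt.mpr hn.le), if_pos hn, if_neg (not_lt.mpr hm.le), if_pos hm,
      LinearMap.mulLeft_apply]
    rw [zero_smul]; ring
  · rw [← neg_sub, key y x m n hm hn f]
    by_cases h : n + m = 0
    · rw [if_pos h, if_pos (by omega), show m = -n by omega, gram_symm, neg_smul, neg_neg]
    · rw [if_neg h, if_neg (by omega)]; simp
  · exact key x y n m hn hm f
  · rw [pp x y n m hn hm f, sub_self, if_neg (by omega), zero_smul]

/-- The exponential of the annihilation part `∑_{x, n > 0} c x n • x_n`. By Taylor's formula it
translates the variables. -/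
def annihExp (N : ℕ) (l k : ℂ) (c : Boson N → ℤ → ℂ) : OscFock N →ₐ[ℂ] OscFock N :=
  MvPolynomial.aeval fun m => MvPolynomial.X m + MvPolynomial.C (contraction N l k c m)

/-- `annihExp` is the exponential series of `annih`, a finite sum on each polynomial. -/
theorem annihExp_eq_sum (N : ℕ) (l k : ℂ) (c : Boson N → ℤ → ℂ) (f : OscFock N) :
    ∃ K₀ : ℕ, ∀ K, K₀ ≤ K → annihExp N l k c f
      = ∑ j ∈ Finset.range K, ((j ! : ℂ)⁻¹) • ((annih N l k c : OscFock N →ₗ[ℂ] OscFock N) ^ j) f := by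
  set D : OscFock N →ₗ[ℂ] OscFock N := (annih N l k c : OscFock N →ₗ[ℂ] OscFock N) with hD
  induction f using MvPolynomial.induction_on with
  | C a =>
    refine ⟨1, fun K hK => ?_⟩
    obtain ⟨K, rfl⟩ : ∃ K', K = K' + 1 := ⟨K - 1, by omega⟩
    rw [Finset.sum_range_succ']
    have : ∀ j, (D ^ (j+1)) (MvPolynomial.C a) = 0 := by
      intro j
      rw [pow_succ, Module.End.mul_apply]
      simp [hD, annih]
    simp [this, annihExp]
  | add p q hp hq =>
    obtain ⟨K1, h1⟩ := hp
    obtain ⟨K2, h2⟩ := hq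
    refine ⟨max K1 K2, fun K hK => ?_⟩
    rw [map_add, h1 K (le_trans (le_max_left _ _) hK), h2 K (le_trans (le_max_right _ _) hK),
      ← Finset.sum_add_distrib]
    simp
  | mul_X p m hp =>
    obtain ⟨K1, h1⟩ := hp
    refine ⟨K1 + 1, fun K hK => ?_⟩
    obtain ⟨K, rfl⟩ : ∃ K', K = K' + 1 := ⟨K - 1, by omega⟩
    set g := MvPolynomial.C (σ := Mode N) (contraction N l k c m) with hg
    have hDX : ∀ p, D (p * MvPolynomial.X m) = D p * MvPolynomial.X m + g * p := by
      intro p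
      simp [hD, annih, MvPolynomial.mkDerivation_X, hg]; ring
    have hDg : ∀ p, D (g * p) = g * D p := by
      intro p; rw [hg, ← MvPolynomial.smul_eq_C_mul, map_smul, MvPolynomial.smul_eq_C_mul]
    have hpow : ∀ (j : ℕ) (p : OscFock N), (D ^ (j+1)) (p * MvPolynomial.X m)
        = (D ^ (j+1)) p * MvPolynomial.X m + ((j:ℂ)+1) • (g * (D ^ j) p) := by
      intro j
      induction j with
      | zero => intro p; simp [hDX]
      | succ j ih =>
        intro p
        have e : ∀ n, (D ^ (n + 1)) p = D ((D ^ n) p) := fun n => by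
          rw [pow_succ', Module.End.mul_apply]
        rw [e (j + 1), pow_succ', Module.End.mul_apply, ih, map_add, map_smul, hDX, hDg]
        simp only [e]
        push_cast
        rw [add_smul ((j : ℂ) + 1), one_smul, add_assoc, add_comm (g * D ((D ^ j) p))]
    rw [map_mul, h1 (K+1) (by omega), Finset.sum_range_succ' (fun j => _ • (D ^ j) (p * _)) K]
    simp only [hpow]
    have hX : annihExp N l k c (MvPolynomial.X m) = MvPolynomial.X m + g := by simp [annihExp, hg]
    rw [hX, mul_add]
    nth_rewrite 2 [← h1 (K+1) (by omega)]
    rw [h1 K (by omega), Finset.sum_range_succ', add_mul, Finset.sum_mul, Finset.sum_mul]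
    simp only [smul_add, Finset.sum_add_distrib, pow_zero, Nat.factorial_zero, Nat.cast_one, inv_one, one_smul, Module.End.one_apply, smul_mul_assoc]
    have : ∀ j : ℕ, (((j+1)! : ℕ) : ℂ)⁻¹ • ((j:ℂ)+1) • (g * (D^j) p) = ((j ! : ℕ):ℂ)⁻¹ • ((D^j) p * g) := by
      intro j
      rw [smul_smul, mul_comm g, Nat.factorial_succ]
      congr 1
      push_cast
      have : (j:ℂ)+1 ≠ 0 := by exact_mod_cast Nat.succ_ne_zero j
      field_simp
    simp only [this]
    abel

/-- The exponential `exp (∑_{x, n > 0} c x (-n) • x_{-n})` of the creation part, a power series in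
the commuting creation operators. -/
def creationExp (N : ℕ) (c : Boson N → ℤ → ℂ) : MvPowerSeries (Mode N) ℂ :=
  fun d => d.prod fun m e => c m.1 (-(m.2 : ℕ)) ^ e / (e ! : ℂ)

/-- The Fock space: the direct sum, over all momenta `μ` (the eigenvalues of the `p_x`), of the Fock
space with momentum `μ`. -/
abbrev Fock (N : ℕ) : Type := (Boson N → ℂ) →₀ OscFock N

/-- The completed Fock space, in which infinite sums of basis states are allowed. -/
abbrev FockHat (N : ℕ) : Type := (Boson N → ℂ) → MvPowerSeries (Mode N) ℂ

/-- `exp (∑ pos y • q_y)` shifts the momentum by this vector. -/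
def momentumShift (N : ℕ) (k : ℂ) (pos : Boson N → ℂ) : Boson N → ℂ :=
  fun x => ∑ y, pos y * gramZero N k x y

open Classical in
/-- The normal ordered exponential
`:exp L: = exp (creation part) exp (q part) exp (p part) exp (annihilation part)`. -/
def normExp (N : ℕ) (l k : ℂ) (L : LinComb N) : Fock N →ₗ[ℂ] FockHat N :=
  Finsupp.lsum ℂ fun μ =>
    Complex.exp (∑ x, L.2.1 x * μ x) •
      ((LinearMap.single ℂ (fun _ : Boson N → ℂ => MvPowerSeries (Mode N) ℂ)
          (μ + momentumShift N k L.2.2)) ∘ₗ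
        LinearMap.mulLeft ℂ (creationExp N L.1) ∘ₗ
        (MvPolynomial.coeToMvPowerSeries.algHom (R := ℂ) (σ := Mode N) ℂ).toLinearMap ∘ₗ
        (annihExp N l k L.1).toLinearMap)

/-! ## The bosonic fields

For a vector `v` of coefficients of bosons and a point with logarithm `s`. -/

/-- `v(z) = -∑_{n ≠ 0} v_n / [n] z^{-n} + q_v + p_v ln z`. -/
def field (N : ℕ) (l : ℂ) (v : Boson N → ℂ) (s : ℂ) : LinComb N :=
  (fun x n => -(v x / qnum l n) * Complex.exp (-n * s), fun x => v x * s, v)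

/-- `v_+(z) = (q - q⁻¹) ∑_{n > 0} v_n z^{-n} + p_v ln q`. -/
def fieldPlus (N : ℕ) (l : ℂ) (v : Boson N → ℂ) (s : ℂ) : LinComb N :=
  (fun x n => if 0 < n then (qpow l 1 - qpow l (-1)) * v x * Complex.exp (-n * s) else 0,
    fun x => v x * l, 0)

/-- `v_-(z) = -((q - q⁻¹) ∑_{n > 0} v_{-n} z^n + p_v ln q)`. -/
def fieldMinus (N : ℕ) (l : ℂ) (v : Boson N → ℂ) (s : ℂ) : LinComb N :=
  (fun x n => if n < 0 then -((qpow l 1 - qpow l (-1)) * v x * Complex.exp (-n * s)) else 0,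
    fun x => -(v x * l), 0)

/-- `a^i_+(z)`. -/
def aP (N : ℕ) (l : ℂ) (i : ℕ) (s : ℂ) : LinComb N := fieldPlus N l (vecA N i) s

/-- `a^i_-(z)`. -/
def aM (N : ℕ) (l : ℂ) (i : ℕ) (s : ℂ) : LinComb N := fieldMinus N l (vecA N i) s

/-- `b^{ij}_+(z)`. -/
def bP (N : ℕ) (l : ℂ) (i j : ℕ) (s : ℂ) : LinComb N := fieldPlus N l (vecB N i j) s

/-- `b^{ij}_-(z)`. -/
def bM (N : ℕ) (l : ℂ) (i j : ℕ) (s : ℂ) : LinComb N := fieldMinus N l (vecB N i j) s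

/-- `(b + c)^{ij}(z)`. -/
def bc (N : ℕ) (l : ℂ) (i j : ℕ) (s : ℂ) : LinComb N := field N l (vecB N i j + vecC N i j) s

/-! ## The Wakimoto currents -/

/-- The current `ψ_+^i(z)`, `z = exp s`. -/
def psiPlus (N : ℕ) (l k : ℂ) (i : ℕ) (s : ℂ) : Fock N →ₗ[ℂ] FockHat N :=
  normExp N l k
    (∑ j ∈ Finset.Icc 1 i,
        (bP N l j (i + 1) (s + (k / 2 + j - 1) * l) - bP N l j i (s + (k / 2 + j) * l))
      + aP N l i (s + N / 2 * l)
      + ∑ j ∈ Finset.Icc (i + 1) N,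
        (bP N l i j (s + (k / 2 + j) * l) - bP N l (i + 1) j (s + (k / 2 + j - 1) * l)))

/-- The current `ψ_-^i(z)`, `z = exp s`. -/
def psiMinus (N : ℕ) (l k : ℂ) (i : ℕ) (s : ℂ) : Fock N →ₗ[ℂ] FockHat N :=
  normExp N l k
    (∑ j ∈ Finset.Icc 1 i,
        (bM N l j (i + 1) (s - (k / 2 + j - 1) * l) - bM N l j i (s - (k / 2 + j) * l))
      + aM N l i (s - N / 2 * l)
      + ∑ j ∈ Finset.Icc (i + 1) N,
        (bM N l i j (s - (k / 2 + j) * l) - bM N l (i + 1) j (s - (k / 2 + j - 1) * l)))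

/-- The current `e^{+,i}(z)`, `z = exp s`. -/
def ePlus (N : ℕ) (l k : ℂ) (i : ℕ) (s : ℂ) : Fock N →ₗ[ℂ] FockHat N :=
  (-1 / ((qpow l 1 - qpow l (-1)) * Complex.exp s)) •
    ∑ j ∈ Finset.Icc 1 i,
      (normExp N l k
          (bc N l j i (s + (j - 1) * l)
            + (bP N l j (i + 1) (s + (j - 1) * l) - bc N l j (i + 1) (s + j * l))
            + ∑ m ∈ Finset.Icc 1 (j - 1),
              (bP N l m (i + 1) (s + (m - 1) * l) - bP N l m i (s + m * l)))
        - normExp N l k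
          (bc N l j i (s + (j - 1) * l)
            + (bM N l j (i + 1) (s + (j - 1) * l) - bc N l j (i + 1) (s + (j - 2) * l))
            + ∑ m ∈ Finset.Icc 1 (j - 1),
              (bP N l m (i + 1) (s + (m - 1) * l) - bP N l m i (s + m * l))))

/-- The common exponent
`a^i_-(q^{-(k+N)/2} z) + ∑_{m=i+1}^N (b^{i,m}_-(q^{-(k+m)} z) - b^{i+1,m}_-(q^{-(k+m-1)} z))`
in `e^{-,i}(z)`. -/
def tailMinus (N : ℕ) (l k : ℂ) (i : ℕ) (s : ℂ) : LinComb N :=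
  aM N l i (s - (k + N) / 2 * l)
    + ∑ m ∈ Finset.Icc (i + 1) N,
      (bM N l i m (s - (k + m) * l) - bM N l (i + 1) m (s - (k + m - 1) * l))

/-- The common exponent
`a^i_+(q^{(k+N)/2} z) + ∑_{m=j}^N (b^{i,m}_+(q^{k+m} z) - b^{i+1,m}_+(q^{k+m-1} z))`
in `e^{-,i}(z)`. -/
def tailPlus (N : ℕ) (l k : ℂ) (i j : ℕ) (s : ℂ) : LinComb N :=
  aP N l i (s + (k + N) / 2 * l)
    + ∑ m ∈ Finset.Icc j N,
      (bP N l i m (s + (k + m) * l) - bP N l (i + 1) m (s + (k + m - 1) * l))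

/-- The current `e^{-,i}(z)`, `z = exp s`. -/
def eMinus (N : ℕ) (l k : ℂ) (i : ℕ) (s : ℂ) : Fock N →ₗ[ℂ] FockHat N :=
  (-1 / ((qpow l 1 - qpow l (-1)) * Complex.exp s)) •
    (∑ j ∈ Finset.Icc 1 (i - 1),
        (normExp N l k
            (bc N l j (i + 1) (s - (k + j) * l)
              + (-bM N l j i (s - (k + j) * l) - bc N l j i (s - (k + j - 1) * l))
              + (∑ m ∈ Finset.Icc (j + 1) i,
                  (bM N l m (i + 1) (s - (k + m - 1) * l) - bM N l m i (s - (k + m) * l))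
                + tailMinus N l k i s))
          - normExp N l k
            (bc N l j (i + 1) (s - (k + j) * l)
              + (-bP N l j i (s - (k + j) * l) - bc N l j i (s - (k + j + 1) * l))
              + (∑ m ∈ Finset.Icc (j + 1) i,
                  (bM N l m (i + 1) (s - (k + m - 1) * l) - bM N l m i (s - (k + m) * l))
                + tailMinus N l k i s)))
      + normExp N l k (bc N l i (i + 1) (s - (k + i) * l) + tailMinus N l k i s)
      - normExp N l k (bc N l i (i + 1) (s + (k + i) * l) + tailPlus N l k i (i + 1) s)
      - ∑ j ∈ Finset.Icc (i + 2) N,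
        (normExp N l k
            (bc N l i j (s + (k + j - 1) * l)
              + (bP N l (i + 1) j (s + (k + j - 1) * l) - bc N l (i + 1) j (s + (k + j) * l))
              + tailPlus N l k i j s)
          - normExp N l k
            (bc N l i j (s + (k + j - 1) * l)
              + (bM N l (i + 1) j (s + (k + j - 1) * l) - bc N l (i + 1) j (s + (k + j - 2) * l))
              + tailPlus N l k i j s)))

/-! ## The dual bosons and the field `ψ_Λ(z)` -/

/-- The dual boson `ǎ^i_n = ∑_j n [min(i,j) n] [(N - max(i,j)) n] / ([(k+N) n] [N n] [n]^2) a^j_n`,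
`n ≠ 0`, as a vector of coefficients. -/
def dualOsc (N : ℕ) (l k : ℂ) (i : ℕ) (n : ℤ) : Boson N → ℂ :=
  ∑ j ∈ Finset.Icc 1 (N - 1),
    (n * (qnum l ((min i j : ℕ) * n) * qnum l ((N - (max i j : ℕ)) * n))
      / (qnum l ((k + N) * n) * qnum l (N * n) * qnum l n ^ 2)) • vecA N j

/-- The zero modes of the dual boson:
`p̌_a^i = ∑_j min(i,j) (N - max(i,j)) / ((k+N) N) p_a^j`, and likewise for `q̌_a^i`. -/
def dualZero (N : ℕ) (k : ℂ) (i : ℕ) : Boson N → ℂ :=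
  ∑ j ∈ Finset.Icc 1 (N - 1),
    (((min i j : ℕ) * (N - (max i j : ℕ)) : ℂ) / ((k + N) * N)) • vecA N j

/-- The exponent of the component `ψ_{λ^i}(z)`, `z = exp s`. -/
def voExponent (N : ℕ) (l k : ℂ) (lam : ℕ → ℂ) (i : ℕ) (s : ℂ) : LinComb N :=
  (fun x n =>
      if 0 < n then
        -(qnum l (lam (N - i) * n) / n * dualOsc N l k i n x * qpow l (-((k + N) / 2 * n))
            * Complex.exp (-n * s))
          - ∑ j ∈ Finset.Icc (i + 1) N,
            qnum l (lam (j - i) * n) / qnum l n ^ 2 * (vecB N i j + vecC N i j) x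
              * Complex.exp (-n * s)
      else
        -- here `n` is the index of a creation operator, `-n > 0`
        -(qnum l (lam (N - i) * (-n)) / (-n) * dualOsc N l k i n x
            * qpow l (-((k + N) / 2 * (-n))) * Complex.exp (-n * s))
          + ∑ j ∈ Finset.Icc (i + 1) N,
            qnum l (lam (j - i) * (-n)) / qnum l n ^ 2 * (vecB N i j + vecC N i j) x
              * Complex.exp (-n * s),
    s • (lam (N - i) • dualZero N k i
      + ∑ j ∈ Finset.Icc (i + 1) N, lam (j - i) • (vecB N i j + vecC N i j)),
    lam (N - i) • dualZero N k i
      + ∑ j ∈ Finset.Icc (i + 1) N, lam (j - i) • (vecB N i j + vecC N i j))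

/-- The field `ψ_Λ(z) = :∏_i ψ_{λ^i}(z):`, `z = exp s`, for `Λ = (λ^1, …, λ^{N-1})`; only the values
`lam 1, …, lam (N - 1)` are used. -/
def typeIIVO (N : ℕ) (l k : ℂ) (lam : ℕ → ℂ) (s : ℂ) : Fock N →ₗ[ℂ] FockHat N :=
  normExp N l k (∑ i ∈ Finset.Icc 1 (N - 1), voExponent N l k lam i s)

/-! ## Exchange relations -/

/-- The basis states of the Fock space: a momentum and a monomial in the creation operators. -/
abbrev State (N : ℕ) : Type := (Boson N → ℂ) × (Mode N →₀ ℕ)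

/-- The matrix entry `⟨x| T |y⟩`. -/
def entry {N : ℕ} (T : Fock N →ₗ[ℂ] FockHat N) (x y : State N) : ℂ :=
  MvPowerSeries.coeff x.2 (T (Finsupp.single y.1 (MvPolynomial.monomial y.2 1)) x.1)

/-- The product `S T` has the matrix entry `⟨x| S T |y⟩ = c`: the sum over all intermediate basis
states converges (absolutely) to `c`. -/
def HasProdEntry {N : ℕ} (S T : Fock N →ₗ[ℂ] FockHat N) (x y : State N) (c : ℂ) : Prop :=
  HasSum (fun m => entry S x m * entry T m y) c

/-- The exchange relation `A(z) B(w) = ρ(z, w) B(w) A(z)` of two fields, `z = exp s`, `w = exp t`, in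
the sense of analytic continuation: the matrix entries of `A(z) B(w)` converge for `|z| ≫ |w|`, those
of `B(w) A(z)` converge for `|w| ≫ |z|`, and `A(z) B(w)` and `ρ(z, w) B(w) A(z)` are, each in its
region, the same meromorphic function of `(s, t)`, an entire function divided by a fixed nonzero
polynomial in `w / z`. -/
def Exchange {N : ℕ} (A B : ℂ → Fock N →ₗ[ℂ] FockHat N) (ρ : ℂ → ℂ → ℂ) : Prop :=
  ∃ (R : ℝ) (P : Polynomial ℂ), P ≠ 0 ∧ ∀ x y : State N,
    ∃ H : ℂ × ℂ → ℂ, Differentiable ℂ H ∧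
      (∀ s t : ℂ, R < (s - t).re → ∃ c : ℂ, HasProdEntry (A s) (B t) x y c ∧
        P.eval (Complex.exp (t - s)) * c = H (s, t)) ∧
      (∀ s t : ℂ, R < (t - s).re → ∃ c : ℂ, HasProdEntry (B t) (A s) x y c ∧
        P.eval (Complex.exp (t - s)) * (ρ (Complex.exp s) (Complex.exp t) * c) = H (s, t))

end

end QWakimoto

namespace QWakimoto

noncomputable section

/-! ## Exponential series in infinitely many variables -/

section WickTheorem

/-! Every current is a finite combination of normal ordered exponentials, so everything rests on
Wick's theorem: `:e^S: :e^T:` is the exponential of a scalar contraction times the normal ordered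
product, and the latter does not depend on the order. For matrix entries this is `hasSum_wick` and
`hasProdEntry_normExp`: the sum over intermediate states converges absolutely as soon as the
contraction series does. The entries of the normal ordered product are entire in `(ln z, ln w)`
(`differentiable_normalEntry`). By homogeneity the contractions are power series in `w/z` or in
`z/w`, up to zero modes, so an exchange relation holds once the exponentials of the two contractions
are expansions, at `0` and at `∞`, of rational functions whose ratio is the factor. This is recorded
in `SymbolExchange` and turned into `Exchange` by `SymbolExchange.exchange`. Contractions are
bilinear, hence factors multiply under addition of exponents.

It remains to contract each elementary boson with `ψ_Λ`. The dual bosons invert the q-Cartan matrix,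
so the commutators collapse (`sum_gram_mul_voSum`): `a^i_n` gives `[λ^{N-i}n]/n` times
`q^{-(k+N)n/2}`, `b^{ij}_n` gives `-[λ^{j-i}n]/n`, and `c^{ij}_n` the opposite of `b^{ij}_n`.
Therefore `(b+c)^{ij}` has trivial factor; `b^{ij}_±` contributes a logarithmic series that sums to
the Möbius factor `exchangeFactor` with parameter `λ^{j-i}`; and `a^i_±` contributes the reciprocal
of the factor of a fictitious `b^{iN}_±` at a shifted point.

The arguments of the `b` fields are such that consecutive factors cancel
(`SymbolExchange.sum_sub_telescope`). In `ψ_±^i` and in every summand of `e^{+,i}` only the factor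
with parameter `λ^i` survives; in every summand of `e^{-,i}` nothing survives. As all summands of a
current share one factor, the relation passes to their sum. -/

theorem hasSum_of_forall_eq {ι α : Type*} [AddCommMonoid α] [TopologicalSpace α] {f g : ι → α} {a b : α}
    (h : HasSum f a) (hfg : ∀ i, g i = f i) (hab : b = a) : HasSum g b := by
  rw [hab, funext hfg]
  exact h

variable {σ : Type*}

theorem hasSum_mul_of_summable_norm {ι κ R : Type*} [NormedRing R] [CompleteSpace R] {f : ι → R}
    {g : κ → R} {a b : R} (hf : Summable fun i => ‖f i‖) (hg : Summable fun i => ‖g i‖)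
    (hfa : HasSum f a) (hgb : HasSum g b) : HasSum (fun p : ι × κ => f p.1 * g p.2) (a * b) :=
  hfa.mul hgb (summable_mul_of_summable_norm hf hg)

/-- One variable is split off at a time and the exponential series are multiplied. Both scalar
fields are needed below: `ℝ` for the dominating series of norms, `ℂ` for the value. -/
theorem hasSum_prod_pow_div_factorial_finset {𝕜 : Type*} [RCLike 𝕜] (a : σ → 𝕜) (S : Finset σ) :
    Summable (fun e : {e : σ →₀ ℕ // e.support ⊆ S} => ‖e.1.prod fun m n => a m ^ n / (n ! : 𝕜)‖) ∧
    HasSum (fun e : {e : σ →₀ ℕ // e.support ⊆ S} => e.1.prod fun m n => a m ^ n / (n ! : 𝕜))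
      (∏ m ∈ S, NormedSpace.exp (a m)) := by
  classical
  induction S using Finset.induction_on with
  | empty =>
    have hU : ∀ e : {e : σ →₀ ℕ // e.support ⊆ ∅}, e = ⟨0, by simp⟩ := by
      rintro ⟨e, he⟩
      simpa [Subtype.ext_iff, Finset.subset_empty] using he
    have : Unique {e : σ →₀ ℕ // e.support ⊆ ∅} := ⟨⟨⟨0, by simp⟩⟩, hU⟩
    refine ⟨(hasSum_unique _).summable, ?_⟩
    convert hasSum_unique _
    rw [hU default]
    simp
  | insert m S hm ih =>
    obtain ⟨ihs, ih⟩ := ih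
    have hs := NormedSpace.norm_expSeries_div_summable (a m)
    have hdis : ∀ (n : ℕ) (e : {e : σ →₀ ℕ // e.support ⊆ S}),
        Disjoint (Finsupp.single m n).support e.1.support := by
      intro n e
      rw [Finset.disjoint_left]
      intro y hy hy'
      have := Finsupp.support_single_subset hy
      simp only [Finset.mem_singleton] at this
      subst this
      exact hm (e.2 hy')
    have hem : ∀ e : {e : σ →₀ ℕ // e.support ⊆ S}, e.1 m = 0 := fun e =>
      Finsupp.notMem_support_iff.mp fun h => hm (e.2 h)
    -- An exponent supported on `insert m S` is its value at `m` together with its restriction to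
    -- `S`.
    let ε : ℕ × {e : σ →₀ ℕ // e.support ⊆ S} ≃ {e : σ →₀ ℕ // e.support ⊆ insert m S} :=
      { toFun := fun p => ⟨Finsupp.single m p.1 + p.2.1, by
          refine Finsupp.support_add.trans (Finset.union_subset ?_ ?_)
          · exact Finsupp.support_single_subset.trans (by simp)
          · exact p.2.2.trans (Finset.subset_insert _ _)⟩
        invFun := fun e => (e.1 m, ⟨e.1.erase m, by
          rw [Finsupp.support_erase]
          intro y hy
          have h1 := Finset.mem_erase.mp hy
          exact (Finset.mem_insert.mp (e.2 h1.2)).resolve_left h1.1⟩)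
        left_inv := by
          rintro ⟨n, e⟩
          ext y
          · simp [hem e]
          · by_cases hy : y = m
            · subst hy; simp [hem e]
            · simp [hy, Finsupp.erase_ne]
        right_inv := by
          rintro ⟨e, he⟩
          simp [Finsupp.single_add_erase] }
    have hF : ∀ p : ℕ × {e : σ →₀ ℕ // e.support ⊆ S},
        ((ε p).1.prod fun m n => a m ^ n / (n ! : 𝕜))
          = (a m ^ p.1 / (p.1 ! : 𝕜)) * (p.2.1.prod fun m n => a m ^ n / (n ! : 𝕜)) := by
      rintro ⟨n, e⟩
      change ((Finsupp.single m n + e.1).prod fun m n => a m ^ n / (n ! : 𝕜)) = _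
      rw [Finsupp.prod_add_index_of_disjoint (hdis n e), Finsupp.prod_single_index (by simp)]
    constructor
    · rw [← ε.summable_iff]
      refine (Summable.mul_norm hs ihs).congr fun p => ?_
      simp only [Function.comp, hF]
    · rw [← ε.hasSum_iff, Finset.prod_insert hm]
      have h := hasSum_mul_of_summable_norm hs ihs (NormedSpace.expSeries_div_hasSum_exp (a m)) ih
      refine hasSum_of_forall_eq h (fun p => ?_) ?_
      · exact hF p
      · rfl

/-- The finite case for the norms bounds all partial sums by `exp (∑ ‖a m‖)`. Dominated convergence
along the finite sets of variables then identifies the sum. -/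
theorem hasSum_prod_pow_div_factorial {a : σ → ℂ} (ha : Summable fun m => ‖a m‖) :
    HasSum (fun e : σ →₀ ℕ => e.prod fun m n => a m ^ n / (n ! : ℂ)) (Complex.exp (∑' m, a m)) := by
  classical
  set F : (σ →₀ ℕ) → ℂ := fun e => e.prod fun m n => a m ^ n / (n ! : ℂ) with hF
  set G : (σ →₀ ℕ) → ℝ := fun e => e.prod fun m n => ‖a m‖ ^ n / (n ! : ℝ) with hG
  have hFG : ∀ e, ‖F e‖ = G e := by
    intro e
    simp [hF, hG, Finsupp.prod, norm_prod]
  have hsum : Summable G := by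
    refine summable_of_sum_le (c := Real.exp (∑' m, ‖a m‖)) (fun e => by
      rw [← hFG]; exact norm_nonneg _) fun T => ?_
    set S : Finset σ := T.biUnion fun e => e.support with hS
    have h := (hasSum_prod_pow_div_factorial_finset (fun m => ‖a m‖) S).2
    have hT : ∀ e ∈ T, e.support ⊆ S := fun e he => Finset.subset_biUnion_of_mem (fun e => e.support) he
    calc ∑ e ∈ T, G e = ∑ e ∈ T.subtype (fun e => e.support ⊆ S), G e.1 := by
          rw [← Finset.sum_subtype_of_mem G hT]
      _ ≤ ∏ m ∈ S, NormedSpace.exp ‖a m‖ :=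
          sum_le_hasSum _ (fun e _ => by rw [← hFG]; exact norm_nonneg _) h
      _ = Real.exp (∑ m ∈ S, ‖a m‖) := by rw [Real.exp_sum, Real.exp_eq_exp_ℝ]
      _ ≤ _ := Real.exp_le_exp.mpr (ha.sum_le_tsum _ fun _ _ => norm_nonneg _)
  have hsumF : Summable F := Summable.of_norm (by simpa only [hFG] using hsum)
  have hlim : Filter.Tendsto (fun S : Finset σ => ∑' e, Set.indicator {e : σ →₀ ℕ | e.support ⊆ S} F e)
      Filter.atTop (nhds (∑' e, F e)) := by
    refine tendsto_tsum_of_dominated_convergence hsum (fun e => ?_) (Filter.Eventually.of_forall fun S e => ?_)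
    · refine tendsto_const_nhds.congr' ?_
      filter_upwards [Filter.eventually_ge_atTop e.support] with S hS
      rw [Set.indicator_of_mem]
      exact hS
    · exact (norm_indicator_le_norm_self _ _).trans (hFG e).le
  have heq : ∀ S : Finset σ, ∑' e, Set.indicator {e : σ →₀ ℕ | e.support ⊆ S} F e
      = Complex.exp (∑ m ∈ S, a m) := by
    intro S
    rw [← tsum_subtype, Complex.exp_sum, Complex.exp_eq_exp_ℂ]
    exact (hasSum_prod_pow_div_factorial_finset a S).2.tsum_eq
  simp only [heq] at hlim
  have h2 : Filter.Tendsto (fun S : Finset σ => Complex.exp (∑ m ∈ S, a m)) Filter.atTop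
      (nhds (Complex.exp (∑' m, a m))) :=
    (Complex.continuous_exp.tendsto _).comp ha.of_norm.hasSum
  rw [tendsto_nhds_unique h2 hlim]
  exact hsumF.hasSum

/-- The exponential series `exp (∑ c m • X m)`. -/
def expSeries (c : σ → ℂ) : MvPowerSeries σ ℂ := fun d => d.prod fun m e => c m ^ e / (e ! : ℂ)

theorem coeff_expSeries (c : σ → ℂ) (d : σ →₀ ℕ) :
    MvPowerSeries.coeff d (expSeries c) = d.prod fun m e => c m ^ e / (e ! : ℂ) := rfl

/-- The coefficient form of the differential equation `∂_m exp = c_m exp`. -/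
theorem coeff_expSeries_add_single (c : σ → ℂ) (d : σ →₀ ℕ) (m : σ) :
    MvPowerSeries.coeff (d + Finsupp.single m 1) (expSeries c) * (d m + 1)
      = c m * MvPowerSeries.coeff d (expSeries c) := by
  classical
  have key : ∀ n : ℕ, c m ^ (n + 1) / ((n + 1)! : ℂ) * (n + 1) = c m * (c m ^ n / (n ! : ℂ)) := by
    intro n
    have h1 : ((n : ℂ) + 1) ≠ 0 := by exact_mod_cast n.succ_ne_zero
    rw [Nat.factorial_succ]
    push_cast
    field_simp
    ring
  simp only [coeff_expSeries]
  have e1 : d + Finsupp.single m 1 = Finsupp.single m (d m + 1) + d.erase m := by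
    conv_lhs => rw [← Finsupp.single_add_erase m d]
    rw [Finsupp.single_add]; abel
  have hdis : ∀ n : ℕ, Disjoint (Finsupp.single m n).support (d.erase m).support := by
    intro n
    rw [Finsupp.support_erase, Finset.disjoint_left]
    intro y hy hy'
    have := Finsupp.support_single_subset hy
    simp only [Finset.mem_singleton] at this
    subst this
    simp at hy'
  rw [e1, Finsupp.prod_add_index_of_disjoint (hdis _), Finsupp.prod_single_index (by simp)]
  conv_rhs => rw [← Finsupp.single_add_erase m d]
  rw [Finsupp.prod_add_index_of_disjoint (hdis _), Finsupp.prod_single_index (by simp)]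
  have := key (d m)
  linear_combination (d.erase m).prod (fun m e => c m ^ e / (e ! : ℂ)) * this

/-- The translation `X m ↦ X m + C m` of the variables. -/
def shiftHom (C : σ → ℂ) : MvPolynomial σ ℂ →ₐ[ℂ] MvPolynomial σ ℂ :=
  MvPolynomial.aeval fun m => MvPolynomial.X m + MvPolynomial.C (C m)

theorem pderiv_shiftHom (C : σ → ℂ) (m : σ) (f : MvPolynomial σ ℂ) :
    MvPolynomial.pderiv m (shiftHom C f) = shiftHom C (MvPolynomial.pderiv m f) := by
  classical
  induction f using MvPolynomial.induction_on with
  | C a => simp [shiftHom]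
  | add p q hp hq => simp [hp, hq]
  | mul_X p n hp =>
    simp only [map_mul, Derivation.leibniz, hp, smul_eq_mul, map_add]
    congr 1
    by_cases h : n = m
    · subst h; simp [shiftHom]
    · simp [shiftHom, MvPolynomial.pderiv_X_of_ne h]

variable {C c : σ → ℂ}

/-- Wick's theorem on the vacuum, by induction on the degree of `r`. In degree `0` it is the
exponential series of `∑ C m * c m`. The step differentiates in a variable occurring in `r`:
translation commutes with the derivative, and the exponential is an eigenvector of it. -/
theorem hasSum_coeff_expSeries_mul_coeff_shiftHom (hs : Summable fun m => ‖C m * c m‖) (r : σ →₀ ℕ) :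
    HasSum (fun e : σ →₀ ℕ => MvPowerSeries.coeff e (expSeries c)
        * MvPolynomial.coeff r (shiftHom C (MvPolynomial.monomial e 1)))
      (Complex.exp (∑' m, C m * c m) * MvPowerSeries.coeff r (expSeries c)) := by
  classical
  have hind : ∀ n, ∀ r : σ →₀ ℕ, r.degree = n →
      HasSum (fun e : σ →₀ ℕ => MvPowerSeries.coeff e (expSeries c)
        * MvPolynomial.coeff r (shiftHom C (MvPolynomial.monomial e 1)))
      (Complex.exp (∑' m, C m * c m) * MvPowerSeries.coeff r (expSeries c)) := by
    intro n
    induction n with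
    | zero =>
      intro r hr
      rw [Finsupp.degree_eq_zero_iff] at hr
      subst hr
      convert hasSum_prod_pow_div_factorial hs using 1
      · funext e
        rw [← MvPolynomial.constantCoeff_eq, shiftHom, MvPolynomial.aeval_monomial, coeff_expSeries]
        simp only [map_one, one_mul, Finsupp.prod, map_prod, map_pow, map_add,
          MvPolynomial.constantCoeff_X, MvPolynomial.constantCoeff_C, zero_add, ← Finset.prod_mul_distrib]
        refine Finset.prod_congr rfl fun m _ => ?_
        rw [mul_pow]; ring
      · simp [coeff_expSeries]
    | succ n ih =>
      intro r hr
      obtain ⟨m, hm⟩ : ∃ m, r m ≠ 0 := by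
        by_contra! h
        have : r = 0 := by ext; simp [h]
        simp [this] at hr
      obtain ⟨r, rfl⟩ : ∃ r', r = r' + Finsupp.single m 1 :=
        ⟨r - Finsupp.single m 1, by
          rw [tsub_add_cancel_of_le]
          exact Finsupp.single_le_iff.mpr (Nat.one_le_iff_ne_zero.mpr hm)⟩
      have hr' : r.degree = n := by simpa using hr
      have h0 : ((r m : ℂ) + 1) ≠ 0 := by exact_mod_cast (r m).succ_ne_zero
      -- The coefficient at `r + single m 1` is recovered from the coefficient at `r` of the `m`-th
      -- derivative.
      have hT : ∀ e : σ →₀ ℕ, MvPolynomial.coeff (r + Finsupp.single m 1) (shiftHom C (MvPolynomial.monomial e 1))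
          = ((r m : ℂ) + 1)⁻¹ * (e m * MvPolynomial.coeff r (shiftHom C (MvPolynomial.monomial (e - Finsupp.single m 1) 1))) := by
        intro e
        have h1 := MvPolynomial.coeff_pderiv (i := m) (shiftHom C (MvPolynomial.monomial e 1)) r
        rw [pderiv_shiftHom, MvPolynomial.pderiv_monomial, one_mul] at h1
        have h2 : (MvPolynomial.monomial (e - Finsupp.single m 1) ((e m : ℕ) : ℂ))
            = (e m : ℂ) • MvPolynomial.monomial (e - Finsupp.single m 1) (1 : ℂ) := by
          rw [MvPolynomial.smul_monomial]; simp
        rw [h2, map_smul, MvPolynomial.coeff_smul, smul_eq_mul] at h1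
        rw [h1]
        field_simp
      have hval : Complex.exp (∑' m, C m * c m) * MvPowerSeries.coeff (r + Finsupp.single m 1) (expSeries c)
          = (((r m : ℂ) + 1)⁻¹ * c m) * (Complex.exp (∑' m, C m * c m) * MvPowerSeries.coeff r (expSeries c)) := by
        have := coeff_expSeries_add_single c r m
        rw [eq_div_iff h0 |>.mpr this]
        field_simp
      rw [hval]
      have hinj : Function.Injective fun e : σ →₀ ℕ => e + Finsupp.single m 1 := add_left_injective _
      rw [← hinj.hasSum_iff]
      · refine hasSum_of_forall_eq ((ih r hr').mul_left (((r m : ℂ) + 1)⁻¹ * c m)) (fun e => ?_) rfl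
        simp only [Function.comp, hT, add_tsub_cancel_right, Finsupp.add_apply, Finsupp.single_eq_same]
        have := coeff_expSeries_add_single c e m
        push_cast
        linear_combination (((r m : ℂ) + 1)⁻¹ * MvPolynomial.coeff r (shiftHom C (MvPolynomial.monomial e 1))) * this
      · intro e he
        have : e m = 0 := by
          by_contra h
          exact he ⟨e - Finsupp.single m 1, tsub_add_cancel_of_le
            (Finsupp.single_le_iff.mpr (Nat.one_le_iff_ne_zero.mpr h))⟩
        rw [hT, this]
        simp
  exact hind _ r rfl

/-- Wick's theorem for matrix entries: the annihilation exponential passes through the creation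
exponential. -/
theorem hasSum_wick (hs : Summable fun m => ‖C m * c m‖) (x : σ →₀ ℕ) (f : MvPolynomial σ ℂ)
    (h : MvPowerSeries σ ℂ) :
    HasSum (fun e : σ →₀ ℕ =>
        MvPowerSeries.coeff x (h * ((shiftHom C (MvPolynomial.monomial e 1) : MvPolynomial σ ℂ) : MvPowerSeries σ ℂ))
          * MvPowerSeries.coeff e (expSeries c * (f : MvPowerSeries σ ℂ)))
      (Complex.exp (∑' m, C m * c m)
        * MvPowerSeries.coeff x (h * expSeries c * ((shiftHom C f : MvPolynomial σ ℂ) : MvPowerSeries σ ℂ))) := by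
  classical
  induction f using MvPolynomial.induction_on generalizing h with
  | C a =>
    have h1 := fun d : (σ →₀ ℕ) × (σ →₀ ℕ) =>
      ((hasSum_coeff_expSeries_mul_coeff_shiftHom hs d.2).mul_left (MvPowerSeries.coeff d.1 h)).mul_left a
    refine hasSum_of_forall_eq (hasSum_sum fun d (_ : d ∈ Finset.HasAntidiagonal.antidiagonal x) => h1 d)
      (fun e => ?_) ?_
    · rw [MvPolynomial.coe_C, MvPowerSeries.coeff_mul_C, MvPowerSeries.coeff_mul, Finset.sum_mul]
      refine Finset.sum_congr rfl fun d _ => ?_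
      rw [MvPolynomial.coeff_coe]; ring
    · rw [show shiftHom C (MvPolynomial.C a) = MvPolynomial.C a by simp [shiftHom], MvPolynomial.coe_C,
        MvPowerSeries.coeff_mul_C, MvPowerSeries.coeff_mul, Finset.sum_mul, Finset.mul_sum]
      refine Finset.sum_congr rfl fun d _ => ?_
      ring
  | add p q hp hq =>
    refine hasSum_of_forall_eq ((hp h).add (hq h)) (fun e => ?_) ?_
    · rw [MvPolynomial.coe_add, mul_add, map_add, mul_add]
    · rw [map_add, MvPolynomial.coe_add, mul_add, map_add, mul_add]
  | mul_X p m hp =>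
    have hinj : Function.Injective fun e : σ →₀ ℕ => e + Finsupp.single m 1 := add_left_injective _
    rw [← hinj.hasSum_iff]
    · refine hasSum_of_forall_eq
        (hp (h * ((shiftHom C (MvPolynomial.X m) : MvPolynomial σ ℂ) : MvPowerSeries σ ℂ)))
        (fun e => ?_) ?_
      · simp only [Function.comp]
        rw [MvPolynomial.coe_mul, MvPolynomial.coe_X, ← mul_assoc, MvPowerSeries.X,
          MvPowerSeries.coeff_add_mul_monomial, mul_one, MvPolynomial.monomial_add_single,
          map_mul (shiftHom C), pow_one, MvPolynomial.coe_mul, mul_assoc h,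
          mul_comm (shiftHom C (MvPolynomial.X m) : MvPowerSeries σ ℂ)]
      · rw [map_mul (shiftHom C), MvPolynomial.coe_mul]
        congr 2
        ring
    · intro e he
      have : ¬ Finsupp.single m 1 ≤ e := fun hle => he ⟨e - Finsupp.single m 1, tsub_add_cancel_of_le hle⟩
      rw [MvPolynomial.coe_mul, MvPolynomial.coe_X, ← mul_assoc, MvPowerSeries.X,
          MvPowerSeries.coeff_mul_monomial, if_neg this, mul_zero]

end WickTheorem

end

noncomputable section

/-! ## Products of normal ordered exponentials -/

/-! ### Composition of translations and coefficientwise holomorphy. -/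

section ShiftHom

variable {σ : Type*}

theorem shiftHom_shiftHom (C C' : σ → ℂ) (f : MvPolynomial σ ℂ) :
    shiftHom C (shiftHom C' f) = shiftHom (C + C') f := by
  have : (shiftHom C).comp (shiftHom C') = shiftHom (C + C') := by
    ext m : 1
    simp [shiftHom, add_assoc]
  exact DFunLike.congr_fun this f

/-- All coefficients of the family of power series are holomorphic in the parameters. -/
def CoeffDifferentiable (F : ℂ × ℂ → MvPowerSeries σ ℂ) : Prop :=
  ∀ d, Differentiable ℂ fun p => MvPowerSeries.coeff d (F p)

theorem CoeffDifferentiable.mul {F G : ℂ × ℂ → MvPowerSeries σ ℂ} (hF : CoeffDifferentiable F)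
    (hG : CoeffDifferentiable G) : CoeffDifferentiable fun p => F p * G p := by
  classical
  intro d
  simp only [MvPowerSeries.coeff_mul]
  exact Differentiable.fun_sum fun e _ => (hF e.1).mul (hG e.2)

theorem CoeffDifferentiable.add {F G : ℂ × ℂ → MvPowerSeries σ ℂ} (hF : CoeffDifferentiable F)
    (hG : CoeffDifferentiable G) : CoeffDifferentiable fun p => F p + G p := by
  intro d
  simp only [map_add]
  exact (hF d).add (hG d)

theorem CoeffDifferentiable.exp_mul_coeff {F : ℂ × ℂ → MvPowerSeries σ ℂ} (hF : CoeffDifferentiable F)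
    {g : ℂ × ℂ → ℂ} (hg : Differentiable ℂ g) (d : σ →₀ ℕ) :
    Differentiable ℂ fun p => Complex.exp (g p) * MvPowerSeries.coeff d (F p) :=
  hg.cexp.mul (hF d)

theorem coeffDifferentiable_const (F : MvPowerSeries σ ℂ) :
    CoeffDifferentiable fun _ => F := fun _ => differentiable_const _

theorem coeffDifferentiable_expSeries {c : ℂ × ℂ → σ → ℂ}
    (hc : ∀ m, Differentiable ℂ fun p => c p m) : CoeffDifferentiable fun p => expSeries (c p) := by
  intro d
  simp only [coeff_expSeries, Finsupp.prod]
  classical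
  induction d.support using Finset.induction_on with
  | empty => simp
  | insert m S hm ih =>
    simp only [Finset.prod_insert hm]
    simp only [div_eq_mul_inv]
    exact (((hc m).pow _).mul_const _).mul (by simpa only [div_eq_mul_inv] using ih)

theorem coeffDifferentiable_shiftHom {C : ℂ × ℂ → σ → ℂ}
    (hC : ∀ m, Differentiable ℂ fun p => C p m) (f : MvPolynomial σ ℂ) :
    CoeffDifferentiable fun p => ((shiftHom (C p) f : MvPolynomial σ ℂ) : MvPowerSeries σ ℂ) := by
  classical
  induction f using MvPolynomial.induction_on with
  | C a =>
    simp only [shiftHom, MvPolynomial.algHom_C]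
    exact coeffDifferentiable_const _
  | add p q hp hq =>
    simp only [map_add, MvPolynomial.coe_add]
    exact hp.add hq
  | mul_X p m hp =>
    simp only [map_mul, MvPolynomial.coe_mul]
    refine hp.mul ?_
    simp only [shiftHom, MvPolynomial.aeval_X, MvPolynomial.coe_add]
    refine (coeffDifferentiable_const _).add fun d => ?_
    simp only [MvPolynomial.coe_C, MvPowerSeries.coeff_C]
    by_cases hd : d = 0
    · simpa [hd] using hC m
    · simp [hd]

end ShiftHom

variable {N : ℕ} {l k : ℂ}

theorem entry_normExp (L : LinComb N) (x y : State N) [Decidable (x.1 = y.1 + momentumShift N k L.2.2)] :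
    entry (normExp N l k L) x y = if x.1 = y.1 + momentumShift N k L.2.2 then
      Complex.exp (∑ b, L.2.1 b * y.1 b) * MvPowerSeries.coeff x.2
        (expSeries (fun m : Mode N => L.1 m.1 (-(m.2 : ℕ)))
          * ((shiftHom (contraction N l k L.1) (MvPolynomial.monomial y.2 1) : MvPolynomial (Mode N) ℂ) :
            MvPowerSeries (Mode N) ℂ))
      else 0 := by
  classical
  unfold entry normExp
  rw [Finsupp.lsum_single]
  simp only [LinearMap.smul_apply, LinearMap.comp_apply, LinearMap.coe_single, Pi.smul_apply,
    Pi.single_apply]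
  split_ifs with h
  · rw [MvPowerSeries.coeff_smul]; rfl
  · simp

/-- The matrix entry of the normal ordered product `:exp S exp T:`. -/
def normalEntry (N : ℕ) (l k : ℂ) (S T : LinComb N) (x y : State N) : ℂ :=
  open Classical in
  if x.1 = y.1 + (momentumShift N k S.2.2 + momentumShift N k T.2.2) then
    Complex.exp (∑ b, (S.2.1 b + T.2.1 b) * y.1 b) * MvPowerSeries.coeff x.2
      (expSeries (fun m : Mode N => S.1 m.1 (-(m.2 : ℕ)))
        * expSeries (fun m : Mode N => T.1 m.1 (-(m.2 : ℕ)))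
        * ((shiftHom (contraction N l k S.1 + contraction N l k T.1)
            (MvPolynomial.monomial y.2 1) : MvPolynomial (Mode N) ℂ) : MvPowerSeries (Mode N) ℂ))
  else 0

/-- This symmetry leaves the scalar contractions as the only difference between the two orders of
multiplication. -/
theorem normalEntry_comm (S T : LinComb N) (x y : State N) :
    normalEntry N l k S T x y = normalEntry N l k T S x y := by
  unfold normalEntry
  rw [add_comm (momentumShift N k S.2.2), add_comm (contraction N l k S.1),
    mul_comm (expSeries fun m : Mode N => S.1 m.1 (-(m.2 : ℕ)))]
  simp only [add_comm]

/-- Momentum conservation leaves a single intermediate momentum `ν`, and the sum over the oscillator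
states is Wick's theorem. The extra zero-mode term arises because the `p` part of `S` is evaluated
at `ν`, that is, at the momentum of `y` shifted by `T`. -/
theorem hasProdEntry_normExp (S T : LinComb N)
    (hs : Summable fun m : Mode N => ‖contraction N l k S.1 m * T.1 m.1 (-(m.2 : ℕ))‖)
    (x y : State N) :
    HasProdEntry (normExp N l k S) (normExp N l k T) x y
      (Complex.exp ((∑' m : Mode N, contraction N l k S.1 m * T.1 m.1 (-(m.2 : ℕ)))
          + ∑ b, S.2.1 b * momentumShift N k T.2.2 b) * normalEntry N l k S T x y) := by
  classical
  unfold HasProdEntry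
  set ν := y.1 + momentumShift N k T.2.2 with hν
  have hinj : Function.Injective fun e : Mode N →₀ ℕ => ((ν, e) : State N) :=
    fun a b h => (Prod.mk.inj h).2
  rw [← hinj.hasSum_iff]
  · by_cases hx : x.1 = ν + momentumShift N k S.2.2
    · have hx' : x.1 = y.1 + (momentumShift N k S.2.2 + momentumShift N k T.2.2) := by
        rw [hx, hν]; abel
      refine hasSum_of_forall_eq ((hasSum_wick hs x.2
        (shiftHom (contraction N l k T.1) (MvPolynomial.monomial y.2 1))
        (expSeries (fun m : Mode N => S.1 m.1 (-(m.2 : ℕ))))).mul_left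
          (Complex.exp (∑ b, S.2.1 b * ν b) * Complex.exp (∑ b, T.2.1 b * y.1 b))) (fun e => ?_) ?_
      · simp only [Function.comp, entry_normExp]
        rw [if_pos hx, if_pos hν]
        ring
      · rw [shiftHom_shiftHom, normalEntry, if_pos hx', Complex.exp_add]
        have : Complex.exp (∑ b, S.2.1 b * momentumShift N k T.2.2 b)
            * Complex.exp (∑ b, (S.2.1 b + T.2.1 b) * y.1 b)
            = Complex.exp (∑ b, S.2.1 b * ν b) * Complex.exp (∑ b, T.2.1 b * y.1 b) := by
          rw [← Complex.exp_add, ← Complex.exp_add, ← Finset.sum_add_distrib, ← Finset.sum_add_distrib]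
          congr 1
          refine Finset.sum_congr rfl fun b _ => ?_
          rw [hν, Pi.add_apply]; ring
        rw [← this]
        ring
    · have hx' : ¬ x.1 = y.1 + (momentumShift N k S.2.2 + momentumShift N k T.2.2) := by
        rw [add_comm (momentumShift N k S.2.2), ← add_assoc]; exact hx
      refine hasSum_of_forall_eq hasSum_zero (fun e => ?_) ?_
      · simp only [Function.comp, entry_normExp]
        rw [if_neg hx, zero_mul]
      · rw [normalEntry, if_neg hx', mul_zero]
  · rintro ⟨ν', e⟩ he
    have : ¬ ν' = y.1 + momentumShift N k T.2.2 := by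
      rintro rfl
      exact he ⟨e, rfl⟩
    simp only [entry_normExp]
    rw [if_neg this, mul_zero]

/-! ## Homogeneous families of exponents -/

/-- The exponent at the point with logarithm `s` of the homogeneous family with the exponent `D` at
the point with logarithm `0`. -/
def translate (N : ℕ) (s : ℂ) : LinComb N →ₗ[ℂ] LinComb N where
  toFun D := (fun x n => D.1 x n * Complex.exp (-n * s), fun x => D.2.1 x + s * D.2.2 x, D.2.2)
  map_add' D D' := by
    ext <;> simp <;> ring
  map_smul' c D := by
    ext <;> simp <;> ring

theorem translate_osc (s : ℂ) (D : LinComb N) (x : Boson N) (n : ℤ) :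
    (translate N s D).1 x n = D.1 x n * Complex.exp (-n * s) := rfl

theorem translate_mom (s : ℂ) (D : LinComb N) (x : Boson N) :
    (translate N s D).2.1 x = D.2.1 x + s * D.2.2 x := rfl

theorem translate_pos (s : ℂ) (D : LinComb N) : (translate N s D).2.2 = D.2.2 := rfl

theorem contraction_translate (s : ℂ) (D : LinComb N) (m : Mode N) :
    contraction N l k (translate N s D).1 m
      = contraction N l k D.1 m * Complex.exp (-(m.2 : ℕ) * s) := by
  simp only [contraction, translate_osc, Finset.sum_mul]
  refine Finset.sum_congr rfl fun x _ => ?_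
  push_cast
  ring

/-- The annihilation mode carries `z^{-n}` and the creation mode `w^n`, so the contraction depends
on `w/z` alone. -/
theorem contraction_translate_mul (s t : ℂ) (D E : LinComb N) (m : Mode N) :
    contraction N l k (translate N s D).1 m * (translate N t E).1 m.1 (-(m.2 : ℕ))
      = contraction N l k D.1 m * E.1 m.1 (-(m.2 : ℕ)) * Complex.exp (t - s) ^ (m.2 : ℕ) := by
  rw [contraction_translate, translate_osc, ← Complex.exp_nat_mul,
    show ((m.2 : ℕ) : ℂ) * (t - s) = -(m.2 : ℕ) * s + -((-(m.2 : ℕ) : ℤ) : ℂ) * t by push_cast; ring,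
    Complex.exp_add]
  ring

theorem differentiable_mul_exp_fst (a c : ℂ) :
    Differentiable ℂ fun p : ℂ × ℂ => a * Complex.exp (c * p.1) :=
  (differentiable_const _).mul (differentiable_fst.const_mul c).cexp

theorem differentiable_mul_exp_snd (a c : ℂ) :
    Differentiable ℂ fun p : ℂ × ℂ => a * Complex.exp (c * p.2) :=
  (differentiable_const _).mul (differentiable_snd.const_mul c).cexp

/-- A fixed entry involves finitely many modes, each depending on the logarithms through an
exponential, and zero modes that are affine in them. -/
theorem differentiable_normalEntry (D E : LinComb N) (x y : State N) :
    Differentiable ℂ fun p : ℂ × ℂ =>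
      normalEntry N l k (translate N p.1 D) (translate N p.2 E) x y := by
  classical
  have hlin : ∀ a b c d e : ℂ, Differentiable ℂ fun p : ℂ × ℂ => (a + p.1 * b + (c + p.2 * d)) * e := by
    intro a b c d e
    fun_prop
  by_cases h : x.1 = y.1 + (momentumShift N k D.2.2 + momentumShift N k E.2.2)
  · have h1 : Differentiable ℂ fun p : ℂ × ℂ =>
        ∑ b, ((translate N p.1 D).2.1 b + (translate N p.2 E).2.1 b) * y.1 b :=
      Differentiable.fun_sum fun b _ => hlin _ _ _ _ _
    have h2 : ∀ m : Mode N, Differentiable ℂ fun p : ℂ × ℂ => (translate N p.1 D).1 m.1 (-(m.2 : ℕ)) :=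
      fun m => by
        simp only [translate_osc]
        exact differentiable_mul_exp_fst _ _
    have h3 : ∀ m : Mode N, Differentiable ℂ fun p : ℂ × ℂ => (translate N p.2 E).1 m.1 (-(m.2 : ℕ)) :=
      fun m => by
        simp only [translate_osc]
        exact differentiable_mul_exp_snd _ _
    have h4 : ∀ m : Mode N, Differentiable ℂ fun p : ℂ × ℂ =>
        (contraction N l k (translate N p.1 D).1 + contraction N l k (translate N p.2 E).1) m :=
      fun m => by
        simp only [Pi.add_apply, contraction_translate]
        exact (differentiable_mul_exp_fst _ _).add (differentiable_mul_exp_snd _ _)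
    convert (((coeffDifferentiable_expSeries h2).mul (coeffDifferentiable_expSeries h3)).mul
      (coeffDifferentiable_shiftHom h4 (MvPolynomial.monomial y.2 1))).exp_mul_coeff h1 x.2 using 2
    exact if_pos h
  · convert differentiable_const (0 : ℂ) using 2
    exact if_neg h

theorem gramZero_symm (x y : Boson N) : gramZero N k x y = gramZero N k y x := by
  have hs : ∀ i j, CartanMatrix.A (N-1) i j = CartanMatrix.A (N-1) j i := fun i j =>
    ((CartanMatrix.A_isSymm (N-1)).apply i j).symm
  rcases x with i | r | r <;> rcases y with j | r' | r' <;> simp [gramZero, eq_comm]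
  rw [hs]; simp

theorem sum_mul_momentumShift_comm (v w : Boson N → ℂ) :
    ∑ b, v b * momentumShift N k w b = ∑ b, w b * momentumShift N k v b := by
  simp only [momentumShift, Finset.mul_sum]
  rw [Finset.sum_comm]
  refine Finset.sum_congr rfl fun b _ => Finset.sum_congr rfl fun c _ => ?_
  rw [gramZero_symm]; ring

end

noncomputable section

/-! ## Exponentially bounded sequences -/

/-- The sequence grows at most exponentially. -/
def ExpBdd (u : ℕ+ → ℂ) : Prop :=
  ∃ M K : ℝ, 0 ≤ M ∧ 0 ≤ K ∧ ∀ n : ℕ+, ‖u n‖ ≤ M * K ^ (n : ℕ)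

theorem ExpBdd.of_norm_le {u v : ℕ+ → ℂ} (hu : ExpBdd u) (h : ∀ n, ‖v n‖ ≤ ‖u n‖) : ExpBdd v := by
  obtain ⟨M, K, hM, hK, h'⟩ := hu
  exact ⟨M, K, hM, hK, fun n => (h n).trans (h' n)⟩

theorem ExpBdd.add {u v : ℕ+ → ℂ} (hu : ExpBdd u) (hv : ExpBdd v) : ExpBdd fun n => u n + v n := by
  obtain ⟨M, K, hM, hK, h⟩ := hu
  obtain ⟨M', K', hM', hK', h'⟩ := hv
  refine ⟨M + M', max K K', by positivity, hK.trans (le_max_left _ _), fun n => ?_⟩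
  rw [add_mul]
  refine (norm_add_le _ _).trans (add_le_add ((h n).trans ?_) ((h' n).trans ?_))
  · gcongr; exact le_max_left _ _
  · gcongr; exact le_max_right _ _

theorem ExpBdd.mul {u v : ℕ+ → ℂ} (hu : ExpBdd u) (hv : ExpBdd v) : ExpBdd fun n => u n * v n := by
  obtain ⟨M, K, hM, hK, h⟩ := hu
  obtain ⟨M', K', hM', hK', h'⟩ := hv
  refine ⟨M * M', K * K', by positivity, by positivity, fun n => ?_⟩
  rw [norm_mul, mul_pow]
  calc ‖u n‖ * ‖v n‖ ≤ (M * K ^ (n : ℕ)) * (M' * K' ^ (n : ℕ)) :=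
        mul_le_mul (h n) (h' n) (norm_nonneg _) (by positivity)
    _ = _ := by ring

theorem expBdd_const (a : ℂ) : ExpBdd fun _ => a :=
  ⟨‖a‖, 1, norm_nonneg _, zero_le_one, fun n => by simp⟩

theorem expBdd_exp (a : ℂ) : ExpBdd fun n => Complex.exp (a * (n : ℕ)) :=
  ⟨1, ‖Complex.exp a‖, zero_le_one, norm_nonneg _, fun n => by
    rw [one_mul, ← norm_pow, ← Complex.exp_nat_mul, mul_comm]⟩

theorem ExpBdd.neg {u : ℕ+ → ℂ} (hu : ExpBdd u) : ExpBdd fun n => -u n :=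
  hu.of_norm_le fun n => by simp

theorem ExpBdd.sub {u v : ℕ+ → ℂ} (hu : ExpBdd u) (hv : ExpBdd v) : ExpBdd fun n => u n - v n := by
  simpa only [sub_eq_add_neg] using hu.add hv.neg

theorem ExpBdd.sum {ι : Type*} {s : Finset ι} {u : ι → ℕ+ → ℂ} (hu : ∀ i ∈ s, ExpBdd (u i)) :
    ExpBdd fun n => ∑ i ∈ s, u i n := by
  classical
  induction s using Finset.induction_on with
  | empty => simpa using expBdd_const 0
  | insert a s ha ih =>
    simp only [Finset.sum_insert ha]
    exact (hu a (Finset.mem_insert_self _ _)).add (ih fun i hi => hu i (Finset.mem_insert_of_mem hi))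

theorem ExpBdd.eventually_summable {u : ℕ+ → ℂ} (hu : ExpBdd u) :
    ∀ᶠ x : ℂ in nhds 0, Summable fun n : ℕ+ => ‖u n * x ^ (n : ℕ)‖ := by
  obtain ⟨M, K, hM, hK, h⟩ := hu
  have hlim : Filter.Tendsto (fun x : ℂ => K * ‖x‖) (nhds 0) (nhds 0) := by
    have : Continuous fun x : ℂ => K * ‖x‖ := by fun_prop
    simpa using this.tendsto 0
  filter_upwards [hlim.eventually (gt_mem_nhds zero_lt_one)] with x hx
  have hg : Summable fun n : ℕ => M * (K * ‖x‖) ^ n :=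
    (summable_geometric_of_lt_one (by positivity) hx).mul_left M
  refine Summable.of_nonneg_of_le (fun n => norm_nonneg _) (fun n => ?_)
    (hg.comp_injective PNat.coe_injective)
  rw [norm_mul, norm_pow, Function.comp, mul_pow, ← mul_assoc]
  exact mul_le_mul_of_nonneg_right (h n) (by positivity)

theorem eventually_summable_modes {N : ℕ} {u : Mode N → ℂ} (hu : ∀ y, ExpBdd fun n => u (y, n)) :
    ∀ᶠ x : ℂ in nhds 0, Summable fun m : Mode N => ‖u m * x ^ (m.2 : ℕ)‖ := by
  filter_upwards [Filter.eventually_all.mpr fun y => (hu y).eventually_summable] with x hx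
  rw [summable_prod_of_nonneg fun _ => norm_nonneg _]
  exact ⟨hx, Summable.of_finite⟩

/-- Regrouping by mode number puts the sum over the bosons inside, so that cancellations between
different bosons can be used. -/
theorem tsum_modes {N : ℕ} {f : Mode N → ℂ} (hf : Summable fun m => ‖f m‖) {S : ℂ}
    (hS : HasSum (fun n : ℕ+ => ∑ y, f (y, n)) S) : ∑' m, f m = S := by
  have h1 := (Equiv.prodComm ℕ+ (Boson N)).hasSum_iff.mpr hf.of_norm.hasSum
  have h2 := h1.prod_fiberwise (g := fun n => ∑ y, f (y, n)) fun n => hasSum_fintype _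
  exact h2.unique hS

/-! ## Exchange of homogeneous families -/

theorem exists_forall_re_of_eventually_nhds {P : ℂ → Prop} (h : ∀ᶠ x in nhds 0, P x) :
    ∃ R : ℝ, ∀ s t : ℂ, R < (s - t).re → P (Complex.exp (t - s)) := by
  obtain ⟨ε, hε, h⟩ := Metric.eventually_nhds_iff.mp h
  -- The norm of `exp (t - s)` is `exp (-(s - t).re)`, which is below `ε` exactly when `(s - t).re`
  -- exceeds `-log ε`.
  refine ⟨-Real.log ε, fun s t hst => h ?_⟩
  rw [dist_zero_right, Complex.norm_exp, ← Real.exp_log hε]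
  apply Real.exp_lt_exp.mpr
  simp only [Complex.sub_re] at *
  linarith

theorem exists_forall_re_of_eventually_cobounded {P : ℂ → Prop}
    (h : ∀ᶠ x in Bornology.cobounded ℂ, P x) :
    ∃ R : ℝ, ∀ s t : ℂ, R < (t - s).re → P (Complex.exp (t - s)) := by
  rw [← Filter.inv_nhdsNE_zero] at h
  have h' : ∀ᶠ x in nhdsWithin (0 : ℂ) {0}ᶜ, P x⁻¹ := h
  rw [eventually_nhdsWithin_iff] at h'
  obtain ⟨R, hR⟩ := exists_forall_re_of_eventually_nhds h'
  refine ⟨R, fun s t hst => ?_⟩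
  have := hR t s hst (Complex.exp_ne_zero _)
  rwa [← Complex.exp_neg, neg_sub] at this

variable {N : ℕ} {l k : ℂ}

/-- The coefficient of `(w/z)^n` in the contraction of the oscillator parts of the families with
exponents `D` and `E`. -/
def symbol (N : ℕ) (l k : ℂ) (D E : LinComb N) (n : ℕ+) : ℂ :=
  ∑ y, contraction N l k D.1 (y, n) * E.1 y (-(n : ℕ))

theorem summable_contraction_translate {s t : ℂ} {D E : LinComb N}
    (h : Summable fun m : Mode N =>
      ‖contraction N l k D.1 m * E.1 m.1 (-(m.2 : ℕ)) * Complex.exp (t - s) ^ (m.2 : ℕ)‖) :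
    Summable fun m : Mode N =>
      ‖contraction N l k (translate N s D).1 m * (translate N t E).1 m.1 (-(m.2 : ℕ))‖ :=
  h.congr fun m => by rw [contraction_translate_mul]

theorem tsum_contraction_translate {s t S : ℂ} {D E : LinComb N}
    (h : Summable fun m : Mode N =>
      ‖contraction N l k (translate N s D).1 m * (translate N t E).1 m.1 (-(m.2 : ℕ))‖)
    (hS : HasSum (fun n : ℕ+ => symbol N l k D E n * Complex.exp (t - s) ^ (n : ℕ)) S) :
    ∑' m : Mode N, contraction N l k (translate N s D).1 m * (translate N t E).1 m.1 (-(m.2 : ℕ)) = S := by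
  refine tsum_modes h (hasSum_of_forall_eq hS (fun n => ?_) rfl)
  rw [symbol, Finset.sum_mul]
  exact Finset.sum_congr rfl fun y _ => contraction_translate_mul s t D E (y, n)

/-- The contraction of the zero modes. -/
def zeroSymbol (N : ℕ) (k : ℂ) (D E : LinComb N) : ℂ :=
  ∑ x, D.2.1 x * momentumShift N k E.2.2 x

/-- The homogeneous families with the exponents `D` and `E` are exchanged with the factor `ρ (w/z)`:
the contractions in both orders are the expansions of rational functions with the ratio `ρ`. -/
structure SymbolExchange (N : ℕ) (l k : ℂ) (E D : LinComb N) (ρ : ℂ → ℂ) : Prop where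
  expBdd_left : ∀ y, ExpBdd fun n => contraction N l k D.1 (y, n) * E.1 y (-(n : ℕ))
  expBdd_right : ∀ y, ExpBdd fun n => contraction N l k E.1 (y, n) * D.1 y (-(n : ℕ))
  pos_eq_zero : ∑ x, D.2.2 x * momentumShift N k E.2.2 x = 0
  rational : ∃ p q : Polynomial ℂ, p ≠ 0 ∧ q ≠ 0 ∧
    (∀ᶠ x in nhds 0, ∃ S, HasSum (fun n : ℕ+ => symbol N l k D E n * x ^ (n : ℕ)) S ∧
      q.eval x * Complex.exp (S + zeroSymbol N k D E) = p.eval x) ∧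
    (∀ᶠ x in Bornology.cobounded ℂ, ∃ S,
      HasSum (fun n : ℕ+ => symbol N l k E D n * x⁻¹ ^ (n : ℕ)) S ∧
      q.eval x * (ρ x * Complex.exp S) = p.eval x)

/-! ### Bilinearity of the contractions. -/

theorem contraction_add (c c' : Boson N → ℤ → ℂ) (m : Mode N) :
    contraction N l k (c + c') m = contraction N l k c m + contraction N l k c' m := by
  simp [contraction, add_mul, Finset.sum_add_distrib]

theorem contraction_neg (c : Boson N → ℤ → ℂ) (m : Mode N) :
    contraction N l k (-c) m = -contraction N l k c m := by
  simp [contraction]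

theorem symbol_add_left (D D' E : LinComb N) (n : ℕ+) :
    symbol N l k (D + D') E n = symbol N l k D E n + symbol N l k D' E n := by
  simp [symbol, contraction_add, add_mul, Finset.sum_add_distrib]

theorem symbol_add_right (D E E' : LinComb N) (n : ℕ+) :
    symbol N l k D (E + E') n = symbol N l k D E n + symbol N l k D E' n := by
  simp [symbol, mul_add, Finset.sum_add_distrib]

theorem symbol_neg_left (D E : LinComb N) (n : ℕ+) :
    symbol N l k (-D) E n = -symbol N l k D E n := by
  simp [symbol, contraction_neg]

theorem symbol_neg_right (D E : LinComb N) (n : ℕ+) :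
    symbol N l k D (-E) n = -symbol N l k D E n := by
  simp [symbol]

theorem zeroSymbol_add (D D' E : LinComb N) :
    zeroSymbol N k (D + D') E = zeroSymbol N k D E + zeroSymbol N k D' E := by
  simp [zeroSymbol, add_mul, Finset.sum_add_distrib]

theorem zeroSymbol_neg (D E : LinComb N) : zeroSymbol N k (-D) E = -zeroSymbol N k D E := by
  simp [zeroSymbol]

theorem eventually_cobounded_eval_ne_zero {p : Polynomial ℂ} (hp : p ≠ 0) :
    ∀ᶠ x in Bornology.cobounded ℂ, p.eval x ≠ 0 := by
  have hf : {x | p.eval x = 0}.Finite := by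
    refine p.roots.toFinset.finite_toSet.subset fun x hx => ?_
    simp only [Finset.mem_coe, Multiset.mem_toFinset]
    exact (Polynomial.mem_roots hp).mpr hx
  have := Bornology.le_cofinite ℂ hf.compl_mem_cofinite
  exact this

namespace SymbolExchange

variable {E D D' : LinComb N} {ρ ρ' : ℂ → ℂ}

theorem congr (h : SymbolExchange N l k E D ρ) (hρ : ∀ᶠ x in Bornology.cobounded ℂ, ρ' x = ρ x) :
    SymbolExchange N l k E D ρ' := by
  obtain ⟨h1, h2, h3, p, q, hp, hq, h4, h5⟩ := h
  refine ⟨h1, h2, h3, p, q, hp, hq, h4, ?_⟩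
  filter_upwards [h5, hρ] with x hx hx'
  rwa [hx']

theorem add (h : SymbolExchange N l k E D ρ) (h' : SymbolExchange N l k E D' ρ') :
    SymbolExchange N l k E (D + D') fun x => ρ x * ρ' x := by
  obtain ⟨h1, h2, h3, p, q, hp, hq, h4, h5⟩ := h
  obtain ⟨h1', h2', h3', p', q', hp', hq', h4', h5'⟩ := h'
  refine ⟨fun y => ?_, fun y => ?_, ?_, p * p', q * q', mul_ne_zero hp hp', mul_ne_zero hq hq', ?_, ?_⟩
  · simpa only [Prod.fst_add, contraction_add, add_mul] using (h1 y).add (h1' y)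
  · simpa only [Prod.fst_add, Pi.add_apply, mul_add] using (h2 y).add (h2' y)
  · simpa [add_mul, Finset.sum_add_distrib, h3] using h3'
  · filter_upwards [h4, h4'] with x hx hx'
    obtain ⟨S, hS, e⟩ := hx
    obtain ⟨S', hS', e'⟩ := hx'
    refine ⟨S + S', ?_, ?_⟩
    · simpa only [symbol_add_left, add_mul] using hS.add hS'
    · rw [zeroSymbol_add, Polynomial.eval_mul, Polynomial.eval_mul, ← e, ← e', add_add_add_comm,
        Complex.exp_add]
      ring
  · filter_upwards [h5, h5'] with x hx hx'
    obtain ⟨S, hS, e⟩ := hx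
    obtain ⟨S', hS', e'⟩ := hx'
    refine ⟨S + S', ?_, ?_⟩
    · simpa only [symbol_add_right, add_mul] using hS.add hS'
    · rw [Polynomial.eval_mul, Polynomial.eval_mul, ← e, ← e', Complex.exp_add]
      ring

/-- The contractions change sign, so their exponentials are inverted and `p` and `q` trade places.
-/
theorem neg (h : SymbolExchange N l k E D ρ) : SymbolExchange N l k E (-D) fun x => (ρ x)⁻¹ := by
  obtain ⟨h1, h2, h3, p, q, hp, hq, h4, h5⟩ := h
  refine ⟨fun y => ?_, fun y => ?_, ?_, q, p, hq, hp, ?_, ?_⟩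
  · simpa only [Prod.fst_neg, contraction_neg, neg_mul] using (h1 y).neg
  · simpa only [Prod.fst_neg, Pi.neg_apply, mul_neg] using (h2 y).neg
  · simpa only [Prod.snd_neg, Pi.neg_apply, neg_mul, Finset.sum_neg_distrib, neg_eq_zero] using h3
  · filter_upwards [h4] with x hx
    obtain ⟨S, hS, e⟩ := hx
    refine ⟨-S, ?_, ?_⟩
    · simpa only [symbol_neg_left, neg_mul] using hS.neg
    · rw [zeroSymbol_neg, ← neg_add, Complex.exp_neg, ← e, mul_assoc,
        mul_inv_cancel₀ (Complex.exp_ne_zero _), mul_one]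
  · filter_upwards [h5, eventually_cobounded_eval_ne_zero hp] with x hx hpx
    obtain ⟨S, hS, e⟩ := hx
    refine ⟨-S, ?_, ?_⟩
    · simpa only [symbol_neg_right, neg_mul] using hS.neg
    -- A zero of the factor would be a zero of `p`, and these are avoided near infinity.
    · have hρ : ρ x ≠ 0 := by
        rintro h0
        rw [h0] at e
        simp at e
        exact hpx e.symm
      rw [Complex.exp_neg, ← e, ← mul_inv, mul_assoc,
        mul_inv_cancel₀ (mul_ne_zero hρ (Complex.exp_ne_zero _)), mul_one]

theorem sub (h : SymbolExchange N l k E D ρ) (h' : SymbolExchange N l k E D' ρ') :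
    SymbolExchange N l k E (D - D') fun x => ρ x / ρ' x := by
  rw [sub_eq_add_neg]
  exact (h.add h'.neg).congr (Filter.Eventually.of_forall fun x => div_eq_mul_inv _ _)

theorem zero (E : LinComb N) : SymbolExchange N l k E 0 fun _ => 1 := by
  have hc : ∀ m, contraction N l k (0 : Boson N → ℤ → ℂ) m = 0 := fun m => by simp [contraction]
  refine ⟨fun y => ?_, fun y => ?_, ?_, 1, 1, one_ne_zero, one_ne_zero, ?_, ?_⟩
  · simpa [hc] using expBdd_const 0
  · simpa using expBdd_const 0
  · simp
  · refine Filter.Eventually.of_forall fun x => ⟨0, ?_, ?_⟩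
    · simp [symbol, hc]
    · simp [zeroSymbol]
  · refine Filter.Eventually.of_forall fun x => ⟨0, ?_, ?_⟩
    · simp [symbol]
    · simp

theorem sum {ι : Type*} {s : Finset ι} {D : ι → LinComb N} {ρ : ι → ℂ → ℂ}
    (h : ∀ i ∈ s, SymbolExchange N l k E (D i) (ρ i)) :
    SymbolExchange N l k E (∑ i ∈ s, D i) fun x => ∏ i ∈ s, ρ i x := by
  classical
  induction s using Finset.induction_on with
  | empty => simpa using zero E
  | insert a s ha ih =>
    simp only [Finset.sum_insert ha, Finset.prod_insert ha]
    exact (h a (Finset.mem_insert_self _ _)).add (ih fun i hi => h i (Finset.mem_insert_of_mem hi))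

/-- Both orders have the form `exp (contraction) * normalEntry` with the same `normalEntry`;
multiplying by `q` and, in the second order, by `ρ` turns both exponentials into `p (w/z)`. The
cut-off and the denominator `q` come from the contractions only, so they are uniform in the states.
-/
theorem exchange (h : SymbolExchange N l k E D ρ) (hE : E.2.1 = 0) {r : ℂ → ℂ → ℂ}
    (hr : ∀ s t, r (Complex.exp s) (Complex.exp t) = ρ (Complex.exp (t - s))) :
    Exchange (fun s => normExp N l k (translate N s D)) (fun t => normExp N l k (translate N t E)) r := by
  obtain ⟨h1, h2, h3, p, q, hp, hq, h4, h5⟩ := h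
  obtain ⟨R, hR⟩ := exists_forall_re_of_eventually_nhds (h4.and (eventually_summable_modes
    (u := fun m => contraction N l k D.1 m * E.1 m.1 (-(m.2 : ℕ))) h1))
  have h6 := Filter.tendsto_inv₀_cobounded.eventually (eventually_summable_modes
    (u := fun m => contraction N l k E.1 m * D.1 m.1 (-(m.2 : ℕ))) h2)
  obtain ⟨R', hR'⟩ := exists_forall_re_of_eventually_cobounded (h5.and h6)
  refine ⟨max R R', q, hq, fun x y => ⟨fun st => p.eval (Complex.exp (st.2 - st.1))
    * normalEntry N l k (translate N st.1 D) (translate N st.2 E) x y, ?_, ?_, ?_⟩⟩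
  · exact (p.differentiable.comp (differentiable_snd.sub differentiable_fst).cexp).mul
      (differentiable_normalEntry D E x y)
  · intro s t hst
    obtain ⟨⟨S, hS, e⟩, hsum⟩ := hR s t ((le_max_left _ _).trans_lt hst)
    have hsum' := summable_contraction_translate hsum
    have hc := hasProdEntry_normExp _ _ hsum' x y
    have hS' := tsum_contraction_translate hsum' hS
    -- The part proportional to `ln z` vanishes by `h3`; otherwise a power of `z` would remain.
    have hZ : ∑ b, (translate N s D).2.1 b * momentumShift N k (translate N t E).2.2 b
        = zeroSymbol N k D E := by
      simp only [translate_mom, translate_pos, add_mul, Finset.sum_add_distrib, zeroSymbol, mul_assoc,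
        ← Finset.mul_sum, h3, mul_zero, add_zero]
    rw [hS', hZ] at hc
    refine ⟨_, hc, ?_⟩
    dsimp only
    rw [← mul_assoc, e]
  · intro s t hst
    obtain ⟨⟨S, hS, e⟩, hsum⟩ := hR' s t ((le_max_right _ _).trans_lt hst)
    rw [← Complex.exp_neg, neg_sub] at hS hsum
    have hsum' := summable_contraction_translate hsum
    have hc := hasProdEntry_normExp _ _ hsum' x y
    have hS' := tsum_contraction_translate hsum' hS
    -- With `hE` only the term proportional to `ln w` is left, and by symmetry of the zero-mode form
    -- it vanishes by the same `h3`.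
    have hZ : ∑ b, (translate N t E).2.1 b * momentumShift N k (translate N s D).2.2 b = 0 := by
      simp only [translate_mom, translate_pos, hE, Pi.zero_apply, zero_add, mul_assoc,
        ← Finset.mul_sum]
      rw [sum_mul_momentumShift_comm, h3, mul_zero]
    rw [hS', hZ, add_zero, normalEntry_comm] at hc
    refine ⟨_, hc, ?_⟩
    dsimp only
    rw [hr, ← e]
    ring

end SymbolExchange

/-! ## Linear combinations of exchanged fields -/

namespace Exchange

variable {A A' B : ℂ → Fock N →ₗ[ℂ] FockHat N} {r : ℂ → ℂ → ℂ}

theorem entry_add (S T : Fock N →ₗ[ℂ] FockHat N) (x y : State N) :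
    entry (S + T) x y = entry S x y + entry T x y := by
  simp [entry]

theorem entry_smul (a : ℂ) (T : Fock N →ₗ[ℂ] FockHat N) (x y : State N) :
    entry (a • T) x y = a * entry T x y := by
  simp [entry]

theorem zero (B : ℂ → Fock N →ₗ[ℂ] FockHat N) (r : ℂ → ℂ → ℂ) : Exchange (fun _ => 0) B r := by
  have h0 : ∀ x y : State N, entry (0 : Fock N →ₗ[ℂ] FockHat N) x y = 0 := fun x y => by simp [entry]
  refine ⟨0, 1, one_ne_zero, fun x y => ⟨0, differentiable_const _, fun s t _ => ⟨0, ?_, by simp⟩,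
    fun s t _ => ⟨0, ?_, by simp⟩⟩⟩
  · simp [HasProdEntry, h0]
  · simp [HasProdEntry, h0]

theorem add (h : Exchange A B r) (h' : Exchange A' B r) : Exchange (fun s => A s + A' s) B r := by
  obtain ⟨R, P, hP, h⟩ := h
  obtain ⟨R', P', hP', h'⟩ := h'
  refine ⟨max R R', P * P', mul_ne_zero hP hP', fun x y => ?_⟩
  obtain ⟨H, hH, h1, h2⟩ := h x y
  obtain ⟨H', hH', h1', h2'⟩ := h' x y
  have hd : ∀ Q : Polynomial ℂ, Differentiable ℂ fun p : ℂ × ℂ => Q.eval (Complex.exp (p.2 - p.1)) :=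
    fun Q => Q.differentiable.comp (differentiable_snd.sub differentiable_fst).cexp
  -- The numerator of a sum of two fractions over the common denominator `P * P'`.
  refine ⟨fun p => P'.eval (Complex.exp (p.2 - p.1)) * H p + P.eval (Complex.exp (p.2 - p.1)) * H' p,
    ((hd P').mul hH).add ((hd P).mul hH'), fun s t hst => ?_, fun s t hst => ?_⟩
  · obtain ⟨c, hc, e⟩ := h1 s t ((le_max_left _ _).trans_lt hst)
    obtain ⟨c', hc', e'⟩ := h1' s t ((le_max_right _ _).trans_lt hst)
    refine ⟨c + c', ?_, ?_⟩
    · simpa only [HasProdEntry, entry_add, add_mul] using HasSum.add hc hc'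
    · dsimp only
      rw [← e, ← e', Polynomial.eval_mul]; ring
  · obtain ⟨c, hc, e⟩ := h2 s t ((le_max_left _ _).trans_lt hst)
    obtain ⟨c', hc', e'⟩ := h2' s t ((le_max_right _ _).trans_lt hst)
    refine ⟨c + c', ?_, ?_⟩
    · simpa only [HasProdEntry, entry_add, mul_add] using HasSum.add hc hc'
    · dsimp only
      rw [← e, ← e', Polynomial.eval_mul]; ring

/-- Needed for the prefactor of `e^{±,i}(z)`: the function `1/z` is entire in `ln z`. -/
theorem smul (h : Exchange A B r) {a : ℂ → ℂ} (ha : Differentiable ℂ a) :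
    Exchange (fun s => a s • A s) B r := by
  obtain ⟨R, P, hP, h⟩ := h
  refine ⟨R, P, hP, fun x y => ?_⟩
  obtain ⟨H, hH, h1, h2⟩ := h x y
  refine ⟨fun p => a p.1 * H p, (ha.comp differentiable_fst).mul hH, fun s t hst => ?_, fun s t hst => ?_⟩
  · obtain ⟨c, hc, e⟩ := h1 s t hst
    refine ⟨a s * c, ?_, ?_⟩
    · simpa only [HasProdEntry, entry_smul, mul_assoc] using HasSum.mul_left (a s) hc
    · dsimp only
      rw [← e]; ring
  · obtain ⟨c, hc, e⟩ := h2 s t hst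
    refine ⟨a s * c, ?_, ?_⟩
    · simpa only [HasProdEntry, entry_smul, mul_left_comm] using HasSum.mul_left (a s) hc
    · dsimp only
      rw [← e]; ring

theorem sub (h : Exchange A B r) (h' : Exchange A' B r) : Exchange (fun s => A s - A' s) B r := by
  have e : (fun s => A s - A' s) = fun s => A s + (fun _ => (-1 : ℂ)) s • A' s := by
    funext s
    refine LinearMap.ext fun f => ?_
    simp only [LinearMap.sub_apply, LinearMap.add_apply, LinearMap.smul_apply]
    rw [neg_one_smul, sub_eq_add_neg]
  rw [e]
  exact h.add (h'.smul (differentiable_const _))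

theorem sum {ι : Type*} {S : Finset ι} {A : ι → ℂ → Fock N →ₗ[ℂ] FockHat N}
    (h : ∀ i ∈ S, Exchange (A i) B r) : Exchange (fun s => ∑ i ∈ S, A i s) B r := by
  classical
  induction S using Finset.induction_on with
  | empty => simpa using zero B r
  | insert a S ha ih =>
    simp only [Finset.sum_insert ha]
    exact (h a (Finset.mem_insert_self _ _)).add (ih fun i hi => h i (Finset.mem_insert_of_mem hi))

end Exchange

end

noncomputable section

/-! ## q-numbers -/

section QNumbers

variable {l : ℂ}

theorem qpow_add (l x y : ℂ) : qpow l (x + y) = qpow l x * qpow l y := by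
  rw [qpow, mul_add, Complex.exp_add]; rfl

theorem qpow_neg (l x : ℂ) : qpow l (-x) = (qpow l x)⁻¹ := by
  rw [qpow, mul_neg, Complex.exp_neg]; rfl

theorem qpow_ne_zero (l x : ℂ) : qpow l x ≠ 0 := Complex.exp_ne_zero _

theorem qnum_neg (l x : ℂ) : qnum l (-x) = -qnum l x := by
  unfold qnum; rw [neg_neg]; ring

theorem qnum_zero (l : ℂ) : qnum l 0 = 0 := by simp [qnum]

/-- As `|q| < 1`, the term `q^{-m}` dominates `q^m`, and the gap between their norms is smallest at
`m = 1`. The bound being uniform in `m`, it gives both the nonvanishing of `[m]` and the boundedness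
of `1/[m]`. -/
theorem le_norm_qpow_sub (hq : ‖Complex.exp l‖ < 1) {m : ℕ} (hm : 0 < m) :
    ‖Complex.exp l‖⁻¹ - ‖Complex.exp l‖ ≤ ‖qpow l m - qpow l (-m)‖ := by
  have h0 : 0 < ‖Complex.exp l‖ := norm_pos_iff.mpr (Complex.exp_ne_zero _)
  have e1 : ‖qpow l m‖ = ‖Complex.exp l‖ ^ m := by
    rw [qpow, mul_comm, Complex.exp_nat_mul, norm_pow]
  have e2 : ‖qpow l (-m)‖ = ‖Complex.exp l‖⁻¹ ^ m := by
    rw [qpow_neg, norm_inv, e1, inv_pow]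
  have h1 : ‖Complex.exp l‖ ^ m ≤ ‖Complex.exp l‖ := pow_le_of_le_one h0.le hq.le hm.ne'
  have h2 : ‖Complex.exp l‖⁻¹ ≤ ‖Complex.exp l‖⁻¹ ^ m :=
    le_self_pow₀ ((one_le_inv₀ h0).mpr hq.le) hm.ne'
  have h3 := norm_sub_norm_le (qpow l (-m)) (qpow l m)
  rw [norm_sub_rev, e1, e2] at h3
  linarith

theorem inv_sub_pos (hq : ‖Complex.exp l‖ < 1) : 0 < ‖Complex.exp l‖⁻¹ - ‖Complex.exp l‖ := by
  have h0 : 0 < ‖Complex.exp l‖ := norm_pos_iff.mpr (Complex.exp_ne_zero _)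
  have := (one_lt_inv₀ h0).mpr hq
  linarith

theorem qpow_sub_ne_zero (hq : ‖Complex.exp l‖ < 1) : qpow l 1 - qpow l (-1) ≠ 0 := by
  have := (inv_sub_pos hq).trans_le (le_norm_qpow_sub hq one_pos)
  rw [Nat.cast_one] at this
  exact norm_pos_iff.mp this

theorem qnum_natCast_ne_zero (hq : ‖Complex.exp l‖ < 1) {m : ℕ} (hm : 0 < m) : qnum l m ≠ 0 :=
  div_ne_zero (norm_pos_iff.mp ((inv_sub_pos hq).trans_le (le_norm_qpow_sub hq hm)))
    (qpow_sub_ne_zero hq)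

theorem expBdd_inv_qnum (hq : ‖Complex.exp l‖ < 1) {j : ℕ} (hj : 0 < j) :
    ExpBdd fun n => (qnum l (j * (n : ℕ)))⁻¹ := by
  refine ⟨‖qpow l 1 - qpow l (-1)‖ / (‖Complex.exp l‖⁻¹ - ‖Complex.exp l‖), 1,
    div_nonneg (norm_nonneg _) (inv_sub_pos hq).le, zero_le_one, fun n => ?_⟩
  dsimp only
  rw [one_pow, mul_one, ← Nat.cast_mul, norm_inv, ← norm_inv, qnum.eq_1, inv_div, norm_div]
  exact div_le_div_of_nonneg_left (norm_nonneg _) (inv_sub_pos hq)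
    (le_norm_qpow_sub hq (Nat.mul_pos hj n.pos))

theorem expBdd_inv_qnum_natCast (hq : ‖Complex.exp l‖ < 1) : ExpBdd fun n => (qnum l (n : ℕ))⁻¹ := by
  simpa using expBdd_inv_qnum hq one_pos

theorem expBdd_qpow (l a : ℂ) : ExpBdd fun n => qpow l (a * (n : ℕ)) := by
  simpa only [qpow, mul_assoc] using expBdd_exp (l * a)

theorem expBdd_qnum (l a : ℂ) : ExpBdd fun n => qnum l (a * (n : ℕ)) := by
  simp only [qnum, div_eq_mul_inv, ← neg_mul]
  exact ((expBdd_qpow l a).sub (expBdd_qpow l (-a))).mul (expBdd_const _)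

theorem expBdd_inv_natCast : ExpBdd fun n => ((n : ℕ) : ℂ)⁻¹ := by
  refine ⟨1, 1, zero_le_one, zero_le_one, fun n => ?_⟩
  rw [one_pow, mul_one, norm_inv, Complex.norm_natCast]
  exact inv_le_one_of_one_le₀ (by exact_mod_cast n.pos)

theorem qnum_eq (l x : ℂ) :
    qnum l x = (qpow l x - (qpow l x)⁻¹) / (qpow l 1 - qpow l (-1)) := by
  rw [qnum, qpow_neg]

theorem qpow_sub (l x y : ℂ) : qpow l (x - y) = qpow l x * (qpow l y)⁻¹ := by
  rw [sub_eq_add_neg, qpow_add, qpow_neg]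

/-- The recursion for q-numbers, by which the q-Cartan matrix annihilates its inverse away from the
diagonal. -/
theorem qnum_two_mul (l a n : ℂ) :
    qnum l (2 * n) * qnum l (a * n) = qnum l n * (qnum l ((a - 1) * n) + qnum l ((a + 1) * n)) := by
  have hn := qpow_ne_zero l n
  have ha := qpow_ne_zero l (a * n)
  rw [two_mul, sub_mul, add_mul, one_mul]
  simp only [qnum_eq, qpow_add, qpow_sub]
  -- The identity is homogeneous in `1/(q - q⁻¹)`, so this factor can be a free variable and need
  -- not be invertible.
  generalize (qpow l 1 - qpow l (-1)) = Q
  simp only [div_eq_mul_inv]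
  generalize Q⁻¹ = Q'
  field_simp
  ring

/-- The diagonal entries of the product of the q-Cartan matrix and its inverse. -/
theorem qnum_add_mul (l a b n : ℂ) :
    qnum l (2 * n) * (qnum l (a * n) * qnum l (b * n))
        - qnum l n * (qnum l ((a - 1) * n) * qnum l (b * n) + qnum l (a * n) * qnum l ((b - 1) * n))
      = qnum l ((a + b) * n) * qnum l n ^ 2 := by
  have hn := qpow_ne_zero l n
  have ha := qpow_ne_zero l (a * n)
  have hb := qpow_ne_zero l (b * n)
  rw [two_mul, sub_mul, sub_mul, add_mul, one_mul]
  simp only [qnum_eq, qpow_add, qpow_sub]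
  generalize (qpow l 1 - qpow l (-1)) = Q
  simp only [div_eq_mul_inv]
  generalize Q⁻¹ = Q'
  field_simp
  ring

end QNumbers

/-! ## The Cartan matrix and its inverse -/

/-- A row of the Cartan matrix is tridiagonal. The conditions `g 0 = 0` and `g (n + 1) = 0` supply
the neighbours missing in the first and last rows, so one formula covers all rows. The function `c`
allows both the q-deformed and the ordinary entries. -/
theorem sum_cartanMatrix_mul {n : ℕ} (a : Fin n) (c : ℤ → ℂ) (g : ℕ → ℂ) (hc : c 0 = 0) (h0 : g 0 = 0)
    (hn : g (n + 1) = 0) :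
    ∑ b : Fin n, c (CartanMatrix.A n a b) * g (b + 1) = c 2 * g (a + 1) + c (-1) * (g a + g (a + 2)) := by
  have hterm : ∀ b : Fin n, c (CartanMatrix.A n a b) * g (b + 1)
      = (if (b : ℕ) = a then c 2 * g (a + 1) else 0) + (if (b : ℕ) + 1 = a then c (-1) * g a else 0)
        + (if (b : ℕ) = a + 1 then c (-1) * g (a + 2) else 0) := by
    intro b
    simp only [CartanMatrix.A, Matrix.of_apply, Fin.ext_iff]
    by_cases h1 : (b : ℕ) = a
    · simp [h1]
    by_cases h2 : (b : ℕ) + 1 = a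
    · simp only [← h2, Nat.left_eq_add, add_assoc, Nat.reduceAdd]
      simp
    by_cases h3 : (b : ℕ) = a + 1
    · simp [h3, add_assoc]
    · rw [if_neg (Ne.symm h1), if_neg (by omega), hc, if_neg h1, if_neg h2, if_neg h3]
      ring
  rw [Finset.sum_congr rfl fun b _ => hterm b,
    Fin.sum_univ_eq_sum_range (fun b : ℕ => (if b = a then c 2 * g (a + 1) else 0)
      + (if b + 1 = a then c (-1) * g a else 0) + (if b = a + 1 then c (-1) * g (a + 2) else 0)),
    Finset.sum_add_distrib, Finset.sum_add_distrib, Finset.sum_ite_eq', Finset.sum_ite_eq',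
    if_pos (Finset.mem_range.mpr a.2)]
  have e1 : ∑ b ∈ Finset.range n, (if b + 1 = (a : ℕ) then c (-1) * g a else 0) = c (-1) * g a := by
    rcases Nat.eq_zero_or_pos (a : ℕ) with h | h
    · simp [h, h0]
    · rw [Finset.sum_eq_single ((a : ℕ) - 1)]
      · rw [if_pos (by omega)]
      · intro b _ hb
        rw [if_neg (by omega)]
      · intro hb
        have := a.2
        simp only [Finset.mem_range] at hb
        omega
  have e2 : (if (a : ℕ) + 1 ∈ Finset.range n then c (-1) * g (a + 2) else 0) = c (-1) * g (a + 2) := by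
    split_ifs with h
    · rfl
    · have : (a : ℕ) + 2 = n + 1 := by
        have := a.2
        simp only [Finset.mem_range] at h
        omega
      rw [this, hn, mul_zero]
  rw [e1, e2]
  ring

/-- Inversion of the q-Cartan matrix. As a function of the column index, `[min(i,b)n][(N -
max(i,b))n]` vanishes at `b = 0` and `b = N` and, on each side of `i`, solves the recursion
`qnum_two_mul`. At `b = i` the two branches meet, and `qnum_add_mul` computes the jump. -/
theorem sum_qnum_cartanMatrix_mul {N : ℕ} (l n : ℂ) (a : Fin (N - 1)) {i : ℕ} (hi : 1 ≤ i) (hi' : i ≤ N - 1) :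
    ∑ b : Fin (N - 1), qnum l ((CartanMatrix.A (N - 1) a b : ℂ) * n)
        * (qnum l ((min i (b + 1) : ℕ) * n) * qnum l ((N - (max i (b + 1) : ℕ)) * n))
      = if (a : ℕ) + 1 = i then qnum l (N * n) * qnum l n ^ 2 else 0 := by
  have ha := a.2
  have hN : ((N - 1 + 1 : ℕ) : ℂ) = N := by congr 1; omega
  rw [sum_cartanMatrix_mul a (fun c => qnum l ((c : ℂ) * n))
    (fun b => qnum l ((min i b : ℕ) * n) * qnum l ((N - (max i b : ℕ)) * n)) (by simp [qnum_zero])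
    (by simp [qnum_zero]) (by
      rw [max_eq_right (by omega), hN, sub_self, zero_mul, qnum_zero, mul_zero])]
  rw [show ((2 : ℤ) : ℂ) = 2 by norm_num, show ((-1 : ℤ) : ℂ) = -1 by norm_num, neg_one_mul, qnum_neg]
  rcases lt_trichotomy ((a : ℕ) + 1) i with h | h | h
  · rw [if_neg h.ne, min_eq_right (by omega), min_eq_right (by omega), min_eq_right (by omega),
      max_eq_left (by omega), max_eq_left (by omega), max_eq_left (by omega)]
    have := qnum_two_mul l (a + 1) n
    rw [add_sub_cancel_right, add_assoc, one_add_one_eq_two] at this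
    push_cast
    linear_combination qnum l ((N - i) * n) * this
  · subst h
    rw [if_pos rfl, min_eq_right le_rfl, min_eq_right (by omega), min_eq_left (by omega),
      max_eq_left le_rfl, max_eq_left (by omega), max_eq_right (by omega)]
    have := qnum_add_mul l (a + 1) (N - (a + 1)) n
    rw [add_sub_cancel_right, add_sub_cancel, show (N : ℂ) - (a + 1) - 1 = N - (a + 2) by ring] at this
    push_cast
    linear_combination this
  · rw [if_neg h.ne', min_eq_left (by omega), min_eq_left (by omega), min_eq_left (by omega),
      max_eq_right (by omega), max_eq_right (by omega), max_eq_right (by omega)]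
    have := qnum_two_mul l (N - (a + 1)) n
    rw [show (N : ℂ) - (a + 1) - 1 = N - (a + 2) by ring, show (N : ℂ) - (a + 1) + 1 = N - a by ring] at this
    push_cast
    linear_combination qnum l (i * n) * this

/-- The undeformed analogue, for the zero modes: a piecewise linear function with its only kink at
`i`. -/
theorem sum_cartanMatrix_mul_min_mul {N : ℕ} (a : Fin (N - 1)) {i : ℕ} (hi : 1 ≤ i) (hi' : i ≤ N - 1) :
    ∑ b : Fin (N - 1), (CartanMatrix.A (N - 1) a b : ℂ)
        * ((min i (b + 1) : ℕ) * (N - (max i (b + 1) : ℕ)))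
      = if (a : ℕ) + 1 = i then (N : ℂ) else 0 := by
  have ha := a.2
  have hN : ((N - 1 + 1 : ℕ) : ℂ) = N := by congr 1; omega
  rw [sum_cartanMatrix_mul a (fun c => (c : ℂ))
    (fun b => ((min i b : ℕ) * (N - (max i b : ℕ)) : ℂ)) (by simp)
    (by simp) (by rw [max_eq_right (by omega), hN, sub_self, mul_zero])]
  rw [show ((2 : ℤ) : ℂ) = 2 by norm_num, show ((-1 : ℤ) : ℂ) = -1 by norm_num]
  rcases lt_trichotomy ((a : ℕ) + 1) i with h | h | h
  · rw [if_neg h.ne, min_eq_right (by omega), min_eq_right (by omega), min_eq_right (by omega),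
      max_eq_left (by omega), max_eq_left (by omega), max_eq_left (by omega)]
    push_cast
    ring
  · subst h
    rw [if_pos rfl, min_eq_right le_rfl, min_eq_right (by omega), min_eq_left (by omega),
      max_eq_left le_rfl, max_eq_left (by omega), max_eq_right (by omega)]
    push_cast
    ring
  · rw [if_neg h.ne', min_eq_left (by omega), min_eq_left (by omega), min_eq_left (by omega),
      max_eq_right (by omega), max_eq_right (by omega), max_eq_right (by omega)]
    push_cast
    ring

end

noncomputable section

/-! ## The contractions with `ψ_Λ` -/

variable {N : ℕ} {l k : ℂ} {lam : ℕ → ℂ}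

theorem gram_comm (n : ℤ) (x y : Boson N) : gram N l k n x y = gram N l k n y x := by
  have hs : ∀ i j, CartanMatrix.A (N-1) i j = CartanMatrix.A (N-1) j i := fun i j =>
    ((CartanMatrix.A_isSymm (N-1)).apply i j).symm
  rcases x with i | r | r <;> rcases y with j | r' | r' <;> simp [gram, eq_comm]
  rw [hs]

theorem dualOsc_inl (i : ℕ) (n : ℤ) (b : Fin (N - 1)) :
    dualOsc N l k i n (.inl b) = n * (qnum l ((min i (b + 1) : ℕ) * n)
      * qnum l ((N - (max i (b + 1) : ℕ)) * n))
      / (qnum l ((k + N) * n) * qnum l (N * n) * qnum l n ^ 2) := by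
  have hb := b.2
  rw [dualOsc, Finset.sum_apply, Finset.sum_eq_single ((b : ℕ) + 1)]
  · simp [vecA]
  · intro j _ hj
    simp [vecA, Ne.symm hj]
  · intro h
    simp only [Finset.mem_Icc] at h
    omega

theorem dualOsc_inr (i : ℕ) (n : ℤ) (r : Root N ⊕ Root N) : dualOsc N l k i n (.inr r) = 0 := by
  simp [dualOsc, vecA]

theorem dualOsc_neg (i : ℕ) (n : ℤ) (x : Boson N) : dualOsc N l k i (-n) x = -dualOsc N l k i n x := by
  rcases x with b | r
  · simp only [dualOsc_inl, Int.cast_neg, mul_neg, qnum_neg]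
    ring
  · simp [dualOsc_inr]

theorem dualZero_inl (i : ℕ) (b : Fin (N - 1)) :
    dualZero N k i (.inl b) = ((min i (b + 1) : ℕ) * (N - (max i (b + 1) : ℕ)) : ℂ) / ((k + N) * N) := by
  have hb := b.2
  rw [dualZero, Finset.sum_apply, Finset.sum_eq_single ((b : ℕ) + 1)]
  · simp [vecA]
  · intro j _ hj
    simp [vecA, Ne.symm hj]
  · intro h
    simp only [Finset.mem_Icc] at h
    omega

theorem dualZero_inr (i : ℕ) (r : Root N ⊕ Root N) : dualZero N k i (.inr r) = 0 := by
  simp [dualZero, vecA]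

theorem sum_roots_mul (h : ℕ → ℕ → ℂ) (r : Root N) :
    ∑ i ∈ Finset.Icc 1 (N - 1), ∑ j ∈ Finset.Icc (i + 1) N,
      h i j * (if (r.1.1 : ℕ) + 1 = i ∧ (r.1.2 : ℕ) + 1 = j then 1 else 0)
      = h (r.1.1 + 1) (r.1.2 + 1) := by
  have h1 : (r.1.1 : ℕ) < r.1.2 := r.2
  have h2 := r.1.2.2
  rw [Finset.sum_eq_single ((r.1.1 : ℕ) + 1), Finset.sum_eq_single ((r.1.2 : ℕ) + 1)]
  · simp
  · intro j _ hj
    simp [Ne.symm hj]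
  · intro h
    simp only [Finset.mem_Icc] at h
    omega
  · intro i _ hi
    simp [Ne.symm hi]
  · intro h
    simp only [Finset.mem_Icc] at h
    omega

/-- The exponent of `ψ_Λ(w)` at the point `w = 1` with the logarithm `0`. -/
def voSum (N : ℕ) (l k : ℂ) (lam : ℕ → ℂ) : LinComb N :=
  ∑ i ∈ Finset.Icc 1 (N - 1), voExponent N l k lam i 0

theorem voExponent_eq_translate (i : ℕ) (s : ℂ) :
    voExponent N l k lam i s = translate N s (voExponent N l k lam i 0) := by
  ext x n
  · rw [translate_osc]
    simp only [voExponent, mul_zero, Complex.exp_zero, mul_one]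
    split_ifs
    · rw [sub_mul, Finset.sum_mul]; ring
    · rw [add_mul, Finset.sum_mul]; ring
  · rw [translate_mom]
    simp [voExponent]
    ring
  · rfl

theorem typeIIVO_eq (s : ℂ) :
    typeIIVO N l k lam s = normExp N l k (translate N s (voSum N l k lam)) := by
  rw [typeIIVO, voSum, map_sum]
  simp only [← voExponent_eq_translate]

theorem voSum_mom : (voSum N l k lam).2.1 = 0 := by
  simp [voSum, Prod.snd_sum, Prod.fst_sum, voExponent]

theorem voExponent_osc_neg (i : ℕ) (x : Boson N) (n : ℕ+) :
    (voExponent N l k lam i 0).1 x (-(n : ℕ))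
      = qnum l (lam (N - i) * (n : ℕ)) / (n : ℕ) * dualOsc N l k i (n : ℕ) x
          * qpow l (-((k + N) / 2 * (n : ℕ)))
        + ∑ j ∈ Finset.Icc (i + 1) N,
          qnum l (lam (j - i) * (n : ℕ)) / qnum l (n : ℕ) ^ 2 * (vecB N i j + vecC N i j) x := by
  have hn : ¬ (0 : ℤ) < -((n : ℕ) : ℤ) := by omega
  simp only [voExponent, if_neg hn, dualOsc_neg, mul_zero, Complex.exp_zero, mul_one, Int.cast_neg,
    Int.cast_natCast, neg_neg, qnum_neg, neg_sq]
  ring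

/-- Because of this antisymmetry the contractions with `ψ_Λ` on the left and on the right are
governed by the same numbers, `response`, up to sign. -/
theorem voExponent_osc_pos (i : ℕ) (x : Boson N) (n : ℕ+) :
    (voExponent N l k lam i 0).1 x (n : ℕ) = -(voExponent N l k lam i 0).1 x (-(n : ℕ)) := by
  have hn : (0 : ℤ) < ((n : ℕ) : ℤ) := by exact_mod_cast n.pos
  rw [voExponent_osc_neg]
  simp only [voExponent, if_pos hn, mul_zero, Complex.exp_zero, mul_one, Int.cast_natCast]
  ring

theorem voSum_osc_pos (x : Boson N) (n : ℕ+) :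
    (voSum N l k lam).1 x (n : ℕ) = -(voSum N l k lam).1 x (-(n : ℕ)) := by
  simp only [voSum, Prod.fst_sum, Finset.sum_apply, voExponent_osc_pos, Finset.sum_neg_distrib]

theorem voSum_osc_inl (b : Fin (N - 1)) (n : ℕ+) :
    (voSum N l k lam).1 (.inl b) (-(n : ℕ)) = ∑ i ∈ Finset.Icc 1 (N - 1),
      qnum l (lam (N - i) * (n : ℕ)) / (n : ℕ) * dualOsc N l k i (n : ℕ) (.inl b)
          * qpow l (-((k + N) / 2 * (n : ℕ))) := by
  simp [voSum, Prod.fst_sum, Finset.sum_apply, voExponent_osc_neg, vecB, vecC]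

theorem voSum_osc_inr_inl (r : Root N) (n : ℕ+) :
    (voSum N l k lam).1 (.inr (.inl r)) (-(n : ℕ))
      = qnum l (lam (r.1.2 - r.1.1) * (n : ℕ)) / qnum l (n : ℕ) ^ 2 := by
  simp only [voSum, Prod.fst_sum, Finset.sum_apply, voExponent_osc_neg, dualOsc_inr, mul_zero, zero_mul,
    zero_add, Pi.add_apply, vecB, vecC, add_zero]
  rw [sum_roots_mul (fun i j => qnum l (lam (j - i) * (n : ℕ)) / qnum l (n : ℕ) ^ 2), Nat.add_sub_add_right]

theorem voSum_osc_inr_inr (r : Root N) (n : ℕ+) :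
    (voSum N l k lam).1 (.inr (.inr r)) (-(n : ℕ))
      = qnum l (lam (r.1.2 - r.1.1) * (n : ℕ)) / qnum l (n : ℕ) ^ 2 := by
  simp only [voSum, Prod.fst_sum, Finset.sum_apply, voExponent_osc_neg, dualOsc_inr, mul_zero, zero_mul,
    zero_add, Pi.add_apply, vecB, vecC]
  rw [sum_roots_mul (fun i j => qnum l (lam (j - i) * (n : ℕ)) / qnum l (n : ℕ) ^ 2), Nat.add_sub_add_right]

theorem voSum_pos_inl (b : Fin (N - 1)) :
    (voSum N l k lam).2.2 (.inl b) = ∑ i ∈ Finset.Icc 1 (N - 1), lam (N - i) * dualZero N k i (.inl b) := by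
  simp [voSum, Prod.snd_sum, Finset.sum_apply, voExponent, vecB, vecC]

theorem voSum_pos_inr_inl (r : Root N) :
    (voSum N l k lam).2.2 (.inr (.inl r)) = lam (r.1.2 - r.1.1) := by
  simp only [voSum, Prod.snd_sum, Finset.sum_apply, voExponent, dualZero_inr, Pi.add_apply, Pi.smul_apply,
    smul_eq_mul, mul_zero, zero_add, vecB, vecC, add_zero]
  rw [sum_roots_mul (fun i j => lam (j - i)), Nat.add_sub_add_right]

theorem voSum_pos_inr_inr (r : Root N) :
    (voSum N l k lam).2.2 (.inr (.inr r)) = lam (r.1.2 - r.1.1) := by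
  simp only [voSum, Prod.snd_sum, Finset.sum_apply, voExponent, dualZero_inr, Pi.add_apply, Pi.smul_apply,
    smul_eq_mul, mul_zero, zero_add, vecB, vecC]
  rw [sum_roots_mul (fun i j => lam (j - i)), Nat.add_sub_add_right]

/-- The commutator of `x_n` with the exponent of `ψ_Λ(1)`. -/
def response (N : ℕ) (l k : ℂ) (lam : ℕ → ℂ) (n : ℕ+) : Boson N → ℂ
  | .inl a => qnum l (lam (N - (a + 1)) * (n : ℕ)) / (n : ℕ) * qpow l (-((k + N) / 2 * (n : ℕ)))
  | .inr (.inl r) => -(qnum l (lam (r.1.2 - r.1.1) * (n : ℕ)) / (n : ℕ))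
  | .inr (.inr r) => qnum l (lam (r.1.2 - r.1.1) * (n : ℕ)) / (n : ℕ)

/-- For `a` the q-Cartan matrix meets its inverse and only `i = a + 1` survives, with `[(k+N)n]`
cancelling against the dual boson. For `b` and `c` the factor `[n]^2` of the commutator cancels the
one in the exponent. -/
theorem sum_gram_mul_voSum (hN : 2 ≤ N) (hq : ‖Complex.exp l‖ < 1)
    (hk : ∀ n : ℕ, 0 < n → qnum l ((k + N) * n) ≠ 0) (n : ℕ+) (x : Boson N) :
    ∑ y, gram N l k (n : ℕ) x y * (voSum N l k lam).1 y (-(n : ℕ)) = response N l k lam n x := by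
  have hn : ((n : ℕ) : ℂ) ≠ 0 := by exact_mod_cast n.ne_zero
  have h1 : qnum l (n : ℕ) ≠ 0 := qnum_natCast_ne_zero hq n.pos
  rcases x with a | r | r
  · have ha := a.2
    simp only [Fintype.sum_sum_type, gram, zero_mul, Finset.sum_const_zero, add_zero, voSum_osc_inl,
      dualOsc_inl, response, Int.cast_natCast]
    have h2 := hk n n.pos
    have h3 : qnum l (N * (n : ℕ)) ≠ 0 := by
      rw [← Nat.cast_mul]
      exact qnum_natCast_ne_zero hq (Nat.mul_pos (by omega) n.pos)
    have hterm : ∀ b : Fin (N - 1), ∀ i : ℕ,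
        qnum l ((k + N) * (n : ℕ)) * qnum l ((CartanMatrix.A (N - 1) a b : ℂ) * (n : ℕ)) / (n : ℕ)
          * (qnum l (lam (N - i) * (n : ℕ)) / (n : ℕ)
            * ((n : ℕ) * (qnum l ((min i (b + 1) : ℕ) * (n : ℕ)) * qnum l ((N - (max i (b + 1) : ℕ)) * (n : ℕ)))
              / (qnum l ((k + N) * (n : ℕ)) * qnum l (N * (n : ℕ)) * qnum l (n : ℕ) ^ 2))
            * qpow l (-((k + N) / 2 * (n : ℕ))))
        = qnum l (lam (N - i) * (n : ℕ)) / (n : ℕ) * qpow l (-((k + N) / 2 * (n : ℕ)))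
            / (qnum l (N * (n : ℕ)) * qnum l (n : ℕ) ^ 2)
          * (qnum l ((CartanMatrix.A (N - 1) a b : ℂ) * (n : ℕ))
            * (qnum l ((min i (b + 1) : ℕ) * (n : ℕ)) * qnum l ((N - (max i (b + 1) : ℕ)) * (n : ℕ)))) := by
      intro b i
      field_simp
    simp only [Finset.mul_sum, hterm]
    rw [Finset.sum_comm]
    simp only [← Finset.mul_sum]
    rw [Finset.sum_eq_single ((a : ℕ) + 1)]
    · rw [sum_qnum_cartanMatrix_mul l _ a (by omega) (by omega), if_pos rfl,
        div_mul_cancel₀ _ (mul_ne_zero h3 (pow_ne_zero 2 h1))]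
    · intro i hi hia
      simp only [Finset.mem_Icc] at hi
      rw [sum_qnum_cartanMatrix_mul l _ a hi.1 hi.2, if_neg (Ne.symm hia), mul_zero]
    · intro h
      simp only [Finset.mem_Icc] at h
      omega
  · simp only [Fintype.sum_sum_type, gram, zero_mul, Finset.sum_const_zero, add_zero, zero_add, ite_mul,
      Finset.sum_ite_eq, Finset.mem_univ, if_true, voSum_osc_inr_inl, response, Int.cast_natCast]
    field_simp
  · simp only [Fintype.sum_sum_type, gram, zero_mul, Finset.sum_const_zero, zero_add, ite_mul,
      Finset.sum_ite_eq, Finset.mem_univ, if_true, voSum_osc_inr_inr, response, Int.cast_natCast]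
    field_simp

theorem contraction_voSum (hN : 2 ≤ N) (hq : ‖Complex.exp l‖ < 1)
    (hk : ∀ n : ℕ, 0 < n → qnum l ((k + N) * n) ≠ 0) (n : ℕ+) (x : Boson N) :
    contraction N l k (voSum N l k lam).1 (x, n) = -response N l k lam n x := by
  rw [← sum_gram_mul_voSum hN hq hk, contraction, ← Finset.sum_neg_distrib]
  refine Finset.sum_congr rfl fun y _ => ?_
  rw [voSum_osc_pos, gram_comm]
  ring

/-- The commutator of `p_x` with the exponent of `ψ_Λ(1)`. -/
def zeroResponse (N : ℕ) (lam : ℕ → ℂ) : Boson N → ℂ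
  | .inl a => lam (N - (a + 1))
  | .inr (.inl r) => -lam (r.1.2 - r.1.1)
  | .inr (.inr r) => lam (r.1.2 - r.1.1)

theorem momentumShift_voSum (hN : 2 ≤ N) (hk : k + N ≠ 0) (x : Boson N) :
    momentumShift N k (voSum N l k lam).2.2 x = zeroResponse N lam x := by
  have hN0 : (N : ℂ) ≠ 0 := by
    have : N ≠ 0 := by omega
    exact_mod_cast this
  rw [momentumShift]
  rcases x with a | r | r
  · have ha := a.2
    simp only [Fintype.sum_sum_type, gramZero, mul_zero, Finset.sum_const_zero, add_zero, voSum_pos_inl,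
      dualZero_inl, zeroResponse]
    have hterm : ∀ b : Fin (N - 1), ∀ i : ℕ,
        lam (N - i) * (((min i (b + 1) : ℕ) * (N - (max i (b + 1) : ℕ)) : ℂ) / ((k + N) * N))
          * ((CartanMatrix.A (N - 1) a b : ℂ) * (k + N))
        = lam (N - i) / N * ((CartanMatrix.A (N - 1) a b : ℂ)
            * ((min i (b + 1) : ℕ) * (N - (max i (b + 1) : ℕ)))) := by
      intro b i
      field_simp
    simp only [Finset.sum_mul, hterm]
    rw [Finset.sum_comm]
    simp only [← Finset.mul_sum]
    rw [Finset.sum_eq_single ((a : ℕ) + 1)]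
    · rw [sum_cartanMatrix_mul_min_mul a (by omega) (by omega), if_pos rfl]
      field_simp
    · intro i hi hia
      simp only [Finset.mem_Icc] at hi
      rw [sum_cartanMatrix_mul_min_mul a hi.1 hi.2, if_neg (Ne.symm hia), mul_zero]
    · intro h
      simp only [Finset.mem_Icc] at h
      omega
  · simp only [Fintype.sum_sum_type, gramZero, mul_zero, Finset.sum_const_zero, add_zero, zero_add, mul_ite,
      Finset.sum_ite_eq, Finset.mem_univ, if_true, voSum_pos_inr_inl, zeroResponse, mul_neg, mul_one]
  · simp only [Fintype.sum_sum_type, gramZero, mul_zero, Finset.sum_const_zero, zero_add, mul_ite,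
      Finset.sum_ite_eq, Finset.mem_univ, if_true, voSum_pos_inr_inr, zeroResponse, mul_one]

theorem expBdd_response (n : Boson N) : ExpBdd fun m => response N l k lam m n := by
  have h : ∀ a, ExpBdd fun n => qnum l (a * (n : ℕ)) / (n : ℕ) := fun a => by
    simpa only [div_eq_mul_inv] using (expBdd_qnum l a).mul expBdd_inv_natCast
  rcases n with a | r | r
  · simpa only [response, ← neg_mul] using (h _).mul (expBdd_qpow l _)
  · exact (h _).neg
  · exact h _

/-- Absolute convergence of the contraction is needed boson by boson, before the cancellations of
`sum_gram_mul_voSum`. -/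
theorem expBdd_gram_mul_voSum (hN : 2 ≤ N) (hq : ‖Complex.exp l‖ < 1)
    (hk : ∀ n : ℕ, 0 < n → qnum l ((k + N) * n) ≠ 0) (x y : Boson N) :
    ExpBdd fun n => gram N l k (n : ℕ) x y * (voSum N l k lam).1 y (-(n : ℕ)) := by
  have hq1 := expBdd_inv_qnum_natCast hq
  have hqn : ExpBdd fun n => qnum l (n : ℕ) := by simpa using expBdd_qnum l 1
  have hroot : ∀ a, ExpBdd fun n => qnum l (a * (n : ℕ)) / qnum l (n : ℕ) ^ 2 := fun a => by
    simpa only [div_eq_mul_inv, sq, mul_inv] using (expBdd_qnum l a).mul (hq1.mul hq1)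
  have hsq : ExpBdd fun n => qnum l (n : ℕ) ^ 2 / (n : ℕ) := by
    simpa only [div_eq_mul_inv, sq] using (hqn.mul hqn).mul expBdd_inv_natCast
  have h0 : ExpBdd fun _ => 0 := expBdd_const 0
  rcases x with a | r | r <;> rcases y with b | r' | r' <;> try simpa only [gram, zero_mul] using h0
  · simp only [gram, voSum_osc_inl, dualOsc_inl, Int.cast_natCast, Finset.mul_sum]
    refine ExpBdd.sum fun i _ => ?_
    have h1 := ((((((((expBdd_qnum l (CartanMatrix.A (N - 1) a b : ℂ)).mul
      (expBdd_qnum l (lam (N - i)))).mul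
      (expBdd_qnum l (min i (b + 1) : ℕ))).mul (expBdd_qnum l (N - (max i (b + 1) : ℕ)))).mul
      (expBdd_inv_qnum hq (show 0 < N by omega))).mul hq1).mul hq1).mul
      (expBdd_qpow l (-((k + N) / 2)))).mul expBdd_inv_natCast
    -- The factor `[(k+N)n]` of the commutator has to be cancelled first: `hk` makes it nonzero but
    -- gives no bound on its reciprocal.
    refine h1.of_norm_le fun n => le_of_eq (congrArg _ ?_)
    have hn : ((n : ℕ) : ℂ) ≠ 0 := by exact_mod_cast n.ne_zero
    have h2 := hk n n.pos
    rw [neg_mul]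
    field_simp
  · simp only [gram, Int.cast_natCast, ite_mul, zero_mul, voSum_osc_inr_inl]
    split_ifs
    · exact hsq.neg.mul (hroot _)
    · exact h0
  · simp only [gram, Int.cast_natCast, ite_mul, zero_mul, voSum_osc_inr_inr]
    split_ifs
    · exact hsq.mul (hroot _)
    · exact h0

end

noncomputable section

/-! ## The exchange factors of the elementary fields -/

/-- The factor `q^μ (x - q^(-μ)) / (x - q^μ)`. -/
def exchangeFactor (l μ x : ℂ) : ℂ := qpow l μ * ((x - qpow l (-μ)) / (x - qpow l μ))

theorem hasSum_pow_div_pnat {z : ℂ} (hz : ‖z‖ < 1) :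
    HasSum (fun n : ℕ+ => z ^ (n : ℕ) / (n : ℕ)) (-Complex.log (1 - z)) := by
  have h := Complex.hasSum_taylorSeries_neg_log hz
  refine (PNat.coe_injective.hasSum_iff (f := fun n : ℕ => z ^ n / (n : ℂ)) fun n hn => ?_).mpr h
  have : n = 0 := by
    by_contra h0
    exact hn ⟨⟨n, Nat.pos_of_ne_zero h0⟩, rfl⟩
  simp [this]

/-- Since `(q - q⁻¹)[μn] = q^{μn} - q^{-μn}`, the series is a difference of two logarithmic series,
namely `log (1 - q^μ a x) - log (1 - q^{-μ} a x)`. -/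
theorem eventually_exists_hasSum_qnum {l : ℂ} (hq : ‖Complex.exp l‖ < 1) (μ a : ℂ) :
    ∀ᶠ x in nhds (0 : ℂ), ∃ S, HasSum (fun n : ℕ+ =>
        -((qpow l 1 - qpow l (-1)) * (qnum l (μ * (n : ℕ)) / (n : ℕ))) * (a * x) ^ (n : ℕ)) S ∧
      Complex.exp S * (1 - qpow l (-μ) * (a * x)) = 1 - qpow l μ * (a * x) := by
  have hlim : ∀ c : ℂ, ∀ᶠ x in nhds (0 : ℂ), ‖c * (a * x)‖ < 1 := fun c => by
    have : Continuous fun x : ℂ => ‖c * (a * x)‖ := by fun_prop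
    exact (this.tendsto 0).eventually (gt_mem_nhds (by simp))
  filter_upwards [hlim (qpow l μ), hlim (qpow l (-μ))] with x h1 h2
  have hne : ∀ z : ℂ, ‖z‖ < 1 → 1 - z ≠ 0 := fun z hz h => by
    rw [← sub_eq_zero.mp h] at hz
    simp at hz
  refine ⟨Complex.log (1 - qpow l μ * (a * x)) - Complex.log (1 - qpow l (-μ) * (a * x)), ?_, ?_⟩
  · have h3 := (hasSum_pow_div_pnat h2).sub (hasSum_pow_div_pnat h1)
    refine hasSum_of_forall_eq h3 (fun n => ?_) (by ring)
    have e : ∀ b, qpow l b ^ (n : ℕ) = qpow l (b * (n : ℕ)) := fun b => by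
      rw [qpow, ← Complex.exp_nat_mul, qpow]
      congr 1
      ring
    rw [mul_pow (qpow l μ), mul_pow (qpow l (-μ)), e, e, qnum]
    have := qpow_sub_ne_zero hq
    rw [neg_mul μ]
    field_simp
    ring
  · rw [Complex.exp_sub, Complex.exp_log (hne _ h1), Complex.exp_log (hne _ h2),
      div_mul_cancel₀ _ (hne _ h2)]

variable {N : ℕ} {l k : ℂ} {lam : ℕ → ℂ}

theorem symbol_voSum_right (hN : 2 ≤ N) (hq : ‖Complex.exp l‖ < 1)
    (hk : ∀ n : ℕ, 0 < n → qnum l ((k + N) * n) ≠ 0) (D : LinComb N) (n : ℕ+) :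
    symbol N l k D (voSum N l k lam) n = ∑ x, D.1 x (n : ℕ) * response N l k lam n x := by
  simp only [symbol, contraction, ← sum_gram_mul_voSum hN hq hk, Finset.sum_mul, Finset.mul_sum]
  rw [Finset.sum_comm]
  simp only [mul_assoc]

theorem symbol_voSum_left (hN : 2 ≤ N) (hq : ‖Complex.exp l‖ < 1)
    (hk : ∀ n : ℕ, 0 < n → qnum l ((k + N) * n) ≠ 0) (D : LinComb N) (n : ℕ+) :
    symbol N l k (voSum N l k lam) D n = -∑ x, D.1 x (-(n : ℕ)) * response N l k lam n x := by
  simp only [symbol, contraction_voSum hN hq hk, ← Finset.sum_neg_distrib]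
  exact Finset.sum_congr rfl fun x _ => by ring

theorem zeroSymbol_voSum (hN : 2 ≤ N) (hk : k + N ≠ 0) (D : LinComb N) :
    zeroSymbol N k D (voSum N l k lam) = ∑ x, D.2.1 x * zeroResponse N lam x := by
  simp only [zeroSymbol, momentumShift_voSum hN hk]

theorem SymbolExchange.of_expBdd (hN : 2 ≤ N) (hq : ‖Complex.exp l‖ < 1)
    (hk : ∀ n : ℕ, 0 < n → qnum l ((k + N) * n) ≠ 0) {D : LinComb N} {ρ : ℂ → ℂ}
    (hD : ∀ x, ExpBdd fun n => D.1 x (n : ℕ)) (hD' : ∀ x, ExpBdd fun n => D.1 x (-(n : ℕ)))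
    (hpos : ∑ x, D.2.2 x * zeroResponse N lam x = 0)
    (h : ∃ p q : Polynomial ℂ, p ≠ 0 ∧ q ≠ 0 ∧
      (∀ᶠ x in nhds 0, ∃ S,
        HasSum (fun n : ℕ+ => (∑ y, D.1 y (n : ℕ) * response N l k lam n y) * x ^ (n : ℕ)) S ∧
        q.eval x * Complex.exp (S + ∑ y, D.2.1 y * zeroResponse N lam y) = p.eval x) ∧
      (∀ᶠ x in Bornology.cobounded ℂ, ∃ S,
        HasSum (fun n : ℕ+ => (-∑ y, D.1 y (-(n : ℕ)) * response N l k lam n y) * x⁻¹ ^ (n : ℕ)) S ∧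
        q.eval x * (ρ x * Complex.exp S) = p.eval x)) :
    SymbolExchange N l k (voSum N l k lam) D ρ := by
  have hk0 : k + N ≠ 0 := by
    intro h0
    apply hk 1 one_pos
    rw [h0, zero_mul, qnum_zero]
  refine ⟨fun y => ?_, fun y => ?_, ?_, ?_⟩
  · simp only [contraction, Finset.sum_mul, mul_assoc]
    exact ExpBdd.sum fun x _ => (hD x).mul (expBdd_gram_mul_voSum hN hq hk x y)
  · simp only [contraction_voSum hN hq hk]
    exact (expBdd_response y).neg.mul (hD' y)
  · simpa only [momentumShift_voSum hN hk0] using hpos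
  · simpa only [symbol_voSum_right hN hq hk, symbol_voSum_left hN hq hk, zeroSymbol_voSum hN hk0] using h

theorem eventually_cobounded_mul_ne {a : ℂ} (ha : a ≠ 0) (b : ℂ) :
    ∀ᶠ x in Bornology.cobounded ℂ, a * x - b ≠ 0 := by
  have hp : (Polynomial.C a * Polynomial.X - Polynomial.C b : Polynomial ℂ) ≠ 0 := by
    intro h
    have := congrArg (fun p => Polynomial.coeff p 1) h
    simp [Polynomial.coeff_C] at this
    exact ha this
  filter_upwards [eventually_cobounded_eval_ne_zero hp] with x hx
  simpa using hx

theorem eventually_exchangeFactor_ne_zero {a : ℂ} (ha : a ≠ 0) (μ : ℂ) :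
    ∀ᶠ x in Bornology.cobounded ℂ, exchangeFactor l μ (a * x) ≠ 0 := by
  filter_upwards [eventually_cobounded_mul_ne ha (qpow l (-μ)), eventually_cobounded_mul_ne ha (qpow l μ)]
    with x h1 h2
  exact mul_ne_zero (qpow_ne_zero _ _) (div_ne_zero h1 h2)

/-- Such a field has only annihilation modes and `p`, so it contracts only when it stands to the
left of `ψ_Λ`. The parameter `κ` accommodates the shift in the response of `a^i`; for `b` it is
zero. -/
theorem symbolExchange_fieldPlus (hN : 2 ≤ N) (hq : ‖Complex.exp l‖ < 1)
    (hk : ∀ n : ℕ, 0 < n → qnum l ((k + N) * n) ≠ 0) {v : Boson N → ℂ} {μ κ : ℂ} (u : ℂ)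
    (hv : ∀ n : ℕ+, ∑ x, v x * response N l k lam n x
      = -(qnum l (μ * (n : ℕ)) / (n : ℕ) * Complex.exp (-κ * (n : ℕ))))
    (hv0 : ∑ x, v x * zeroResponse N lam x = -μ) :
    SymbolExchange N l k (voSum N l k lam) (fieldPlus N l v u)
      fun x => exchangeFactor l μ (Complex.exp (-(u + κ)) * x) := by
  set a := Complex.exp (-(u + κ)) with ha
  have hn : ∀ n : ℕ+, (0 : ℤ) < ((n : ℕ) : ℤ) := fun n => by exact_mod_cast n.pos
  have hn' : ∀ n : ℕ+, ¬ (0 : ℤ) < -((n : ℕ) : ℤ) := fun n => by have := hn n; omega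
  have ha0 : a ≠ 0 := Complex.exp_ne_zero _
  -- The rational function is `q^{-μ} (1 - q^μ a x) / (1 - q^{-μ} a x)`, with `q^{-μ}` from the zero
  -- mode. The reverse order contributes `1`, so this is already the exchange factor.
  refine SymbolExchange.of_expBdd hN hq hk (fun x => ?_) (fun x => ?_) (by simp [fieldPlus])
    ⟨Polynomial.C (qpow l (-μ)) - Polynomial.C a * Polynomial.X,
      1 - Polynomial.C (qpow l (-μ) * a) * Polynomial.X, ?_, ?_, ?_, ?_⟩
  · simp only [fieldPlus, if_pos (hn _), Int.cast_natCast]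
    have h := (expBdd_const ((qpow l 1 - qpow l (-1)) * v x)).mul (expBdd_exp (-u))
    refine h.of_norm_le fun n => le_of_eq (congrArg _ ?_)
    rw [neg_mul, neg_mul, mul_comm u]
  · simp only [fieldPlus, if_neg (hn' _)]
    exact expBdd_const 0
  · intro h
    have := congrArg (fun p => Polynomial.coeff p 0) h
    simp [qpow_ne_zero] at this
  · intro h
    have := congrArg (fun p => Polynomial.coeff p 0) h
    simp at this
  · filter_upwards [eventually_exists_hasSum_qnum hq μ a] with x hx
    obtain ⟨S, hS, e⟩ := hx
    refine ⟨S, hasSum_of_forall_eq hS (fun n => ?_) rfl, ?_⟩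
    · have h1 : ∑ y, (fieldPlus N l v u).1 y (n : ℕ) * response N l k lam n y
          = (qpow l 1 - qpow l (-1)) * Complex.exp (-(n : ℕ) * u) * ∑ y, v y * response N l k lam n y := by
        rw [Finset.mul_sum]
        refine Finset.sum_congr rfl fun y _ => ?_
        simp only [fieldPlus, if_pos (hn _), Int.cast_natCast]
        ring
      have h2 : a ^ (n : ℕ) = Complex.exp (-(n : ℕ) * u) * Complex.exp (-κ * (n : ℕ)) := by
        rw [ha, ← Complex.exp_nat_mul, ← Complex.exp_add]
        congr 1
        ring
      rw [h1, hv, mul_pow, h2]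
      ring
    · have h1 : ∑ y, (fieldPlus N l v u).2.1 y * zeroResponse N lam y = l * -μ := by
        rw [← hv0, Finset.mul_sum]
        refine Finset.sum_congr rfl fun y _ => ?_
        simp only [fieldPlus]
        ring
      have h2 : Complex.exp (l * -μ) = qpow l (-μ) := rfl
      have h3 : qpow l (-μ) * qpow l μ = 1 := by
        rw [qpow_neg, inv_mul_cancel₀ (qpow_ne_zero _ _)]
      rw [h1, Complex.exp_add, h2]
      simp only [Polynomial.eval_sub, Polynomial.eval_mul, Polynomial.eval_C, Polynomial.eval_X,
        Polynomial.eval_one]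
      linear_combination qpow l (-μ) * e - a * x * h3
  · filter_upwards [eventually_cobounded_mul_ne ha0 (qpow l μ)] with x hx
    refine ⟨0, ?_, ?_⟩
    · simp only [fieldPlus, if_neg (hn' _), zero_mul, Finset.sum_const_zero, neg_zero]
      exact hasSum_zero
    · have h3 : qpow l (-μ) * qpow l μ = 1 := by
        rw [qpow_neg, inv_mul_cancel₀ (qpow_ne_zero _ _)]
      simp only [Polynomial.eval_sub, Polynomial.eval_mul, Polynomial.eval_C, Polynomial.eval_X,
        Polynomial.eval_one, exchangeFactor, Complex.exp_zero, mul_one]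
      field_simp
      linear_combination (-(a * x) * (a * x - qpow l (-μ))) * h3

/-- Here the oscillators contract only with `ψ_Λ` on the left, while the zero mode still acts when
it stands on the right. The resulting quotient nevertheless has the same form as for the plus field.
-/
theorem symbolExchange_fieldMinus (hN : 2 ≤ N) (hq : ‖Complex.exp l‖ < 1)
    (hk : ∀ n : ℕ, 0 < n → qnum l ((k + N) * n) ≠ 0) {v : Boson N → ℂ} {μ κ : ℂ} (u : ℂ)
    (hv : ∀ n : ℕ+, ∑ x, v x * response N l k lam n x
      = -(qnum l (μ * (n : ℕ)) / (n : ℕ) * Complex.exp (-κ * (n : ℕ))))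
    (hv0 : ∑ x, v x * zeroResponse N lam x = -μ) :
    SymbolExchange N l k (voSum N l k lam) (fieldMinus N l v u)
      fun x => exchangeFactor l μ (Complex.exp (-(u - κ)) * x) := by
  set a := Complex.exp (u - κ) with ha
  have hn : ∀ n : ℕ+, (0 : ℤ) < ((n : ℕ) : ℤ) := fun n => by exact_mod_cast n.pos
  have hn0 : ∀ n : ℕ+, -((n : ℕ) : ℤ) < 0 := fun n => by have := hn n; omega
  have hn' : ∀ n : ℕ+, ¬ ((n : ℕ) : ℤ) < 0 := fun n => by have := hn n; omega
  have ha0 : a ≠ 0 := Complex.exp_ne_zero _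
  -- With `ψ_Λ` on the right only the zero mode contributes, so the rational function is the
  -- constant `q^μ`.
  refine SymbolExchange.of_expBdd hN hq hk (fun x => ?_) (fun x => ?_) (by simp [fieldMinus])
    ⟨Polynomial.C (qpow l μ), 1, ?_, one_ne_zero, ?_, ?_⟩
  · simp only [fieldMinus, if_neg (hn' _)]
    exact expBdd_const 0
  · simp only [fieldMinus, if_pos (hn0 _), Int.cast_natCast, Int.cast_neg, neg_neg]
    have h := ((expBdd_const ((qpow l 1 - qpow l (-1)) * v x)).mul (expBdd_exp u)).neg
    refine h.of_norm_le fun n => le_of_eq (congrArg _ ?_)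
    rw [mul_comm u]
  · simp [qpow_ne_zero]
  · refine Filter.Eventually.of_forall fun x => ⟨0, ?_, ?_⟩
    · simp only [fieldMinus, if_neg (hn' _), zero_mul, Finset.sum_const_zero]
      exact hasSum_zero
    · have h1 : ∑ y, (fieldMinus N l v u).2.1 y * zeroResponse N lam y = l * μ := by
        rw [← neg_neg μ, ← hv0, mul_neg, Finset.mul_sum, ← Finset.sum_neg_distrib]
        refine Finset.sum_congr rfl fun y _ => ?_
        simp only [fieldMinus]
        ring
      rw [h1, zero_add]
      simp [qpow]
  · have h0 := Filter.tendsto_inv₀_cobounded.eventually (eventually_exists_hasSum_qnum hq μ a)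
    have ha1 : Complex.exp (-(u - κ)) = a⁻¹ := by rw [Complex.exp_neg]
    have hx0 : ∀ᶠ x : ℂ in Bornology.cobounded ℂ, x ≠ 0 := by
      simpa using eventually_cobounded_mul_ne (one_ne_zero (α := ℂ)) 0
    filter_upwards [h0, hx0, eventually_cobounded_mul_ne (inv_ne_zero ha0) (qpow l (-μ)),
      eventually_cobounded_mul_ne (inv_ne_zero ha0) (qpow l μ)] with x hx hx0 h4 h5
    obtain ⟨S, hS, e⟩ := hx
    refine ⟨S, hasSum_of_forall_eq hS (fun n => ?_) rfl, ?_⟩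
    · have h1 : ∑ y, (fieldMinus N l v u).1 y (-(n : ℕ)) * response N l k lam n y
          = -((qpow l 1 - qpow l (-1)) * Complex.exp ((n : ℕ) * u) * ∑ y, v y * response N l k lam n y) := by
        rw [Finset.mul_sum, ← Finset.sum_neg_distrib]
        refine Finset.sum_congr rfl fun y _ => ?_
        simp only [fieldMinus, if_pos (hn0 _), Int.cast_natCast, Int.cast_neg, neg_neg]
        ring
      have h2 : a ^ (n : ℕ) = Complex.exp ((n : ℕ) * u) * Complex.exp (-κ * (n : ℕ)) := by
        rw [ha, ← Complex.exp_nat_mul, ← Complex.exp_add]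
        congr 1
        ring
      rw [h1, hv, mul_pow, h2]
      ring
    · have h3 : qpow l (-μ) * qpow l μ = 1 := by
        rw [qpow_neg, inv_mul_cancel₀ (qpow_ne_zero _ _)]
      simp only [Polynomial.eval_C, Polynomial.eval_one, exchangeFactor, one_mul, ha1]
      have e' : Complex.exp S * (a⁻¹ * x - qpow l (-μ)) = a⁻¹ * x - qpow l μ := by
        have := congrArg (fun y => y * (a⁻¹ * x)) e
        field_simp at this ⊢
        linear_combination this
      rw [mul_assoc, div_mul_eq_mul_div, mul_comm (a⁻¹ * x - _), e', div_self h5, mul_one]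

theorem symbolExchange_field (hN : 2 ≤ N) (hq : ‖Complex.exp l‖ < 1)
    (hk : ∀ n : ℕ, 0 < n → qnum l ((k + N) * n) ≠ 0) {v : Boson N → ℂ} (u : ℂ)
    (hv : ∀ n : ℕ+, ∑ x, v x * response N l k lam n x = 0)
    (hv0 : ∑ x, v x * zeroResponse N lam x = 0) :
    SymbolExchange N l k (voSum N l k lam) (field N l v u) fun _ => 1 := by
  have hq1 := expBdd_inv_qnum_natCast hq
  refine SymbolExchange.of_expBdd hN hq hk (fun x => ?_) (fun x => ?_) hv0
    ⟨1, 1, one_ne_zero, one_ne_zero, ?_, ?_⟩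
  · have h := ((expBdd_const (v x)).mul hq1).neg.mul (expBdd_exp (-u))
    refine h.of_norm_le fun n => le_of_eq (congrArg _ ?_)
    simp only [field, Int.cast_natCast, div_eq_mul_inv]
    rw [neg_mul u, neg_mul ((n : ℕ) : ℂ), mul_comm u]
  · have h := ((expBdd_const (v x)).mul hq1).mul (expBdd_exp u)
    refine h.of_norm_le fun n => le_of_eq (congrArg _ ?_)
    simp only [field, Int.cast_natCast, Int.cast_neg, neg_neg, div_eq_mul_inv, qnum_neg, inv_neg, mul_neg]
    rw [mul_comm u]
  · refine Filter.Eventually.of_forall fun x => ⟨0, hasSum_of_forall_eq hasSum_zero (fun n => ?_) rfl, ?_⟩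
    · have : ∑ y, (field N l v u).1 y (n : ℕ) * response N l k lam n y
          = -(qnum l (n : ℕ))⁻¹ * Complex.exp (-(n : ℕ) * u) * ∑ y, v y * response N l k lam n y := by
        rw [Finset.mul_sum]
        refine Finset.sum_congr rfl fun y _ => ?_
        simp only [field, Int.cast_natCast]
        ring
      rw [this, hv, mul_zero, zero_mul]
    · have : ∑ y, (field N l v u).2.1 y * zeroResponse N lam y = u * ∑ y, v y * zeroResponse N lam y := by
        rw [Finset.mul_sum]
        refine Finset.sum_congr rfl fun y _ => ?_
        simp only [field]
        ring
      rw [this, hv0]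
      simp
  · refine Filter.Eventually.of_forall fun x => ⟨0, hasSum_of_forall_eq hasSum_zero (fun n => ?_) rfl, ?_⟩
    · have : ∑ y, (field N l v u).1 y (-(n : ℕ)) * response N l k lam n y
          = (qnum l (n : ℕ))⁻¹ * Complex.exp ((n : ℕ) * u) * ∑ y, v y * response N l k lam n y := by
        rw [Finset.mul_sum]
        refine Finset.sum_congr rfl fun y _ => ?_
        simp only [field, Int.cast_natCast, Int.cast_neg, neg_neg, qnum_neg]
        ring
      rw [this, hv, mul_zero, neg_zero, zero_mul]
    · simp

end

noncomputable section

/-! ## The exchange factors of the bosonic fields -/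

variable {N : ℕ} {l k : ℂ} {lam : ℕ → ℂ}

/-- The factor in the exchange of `b^{ij}_±(q^u z)` and `ψ_Λ(w)` for `d = j - i` and
`q^u = exp v`. -/
def rootFactor (l : ℂ) (lam : ℕ → ℂ) (d : ℕ) (v x : ℂ) : ℂ :=
  if d = 0 then 1 else exchangeFactor l (lam d) (Complex.exp (-v) * x)

theorem rootFactor_zero (v x : ℂ) : rootFactor l lam 0 v x = 1 := if_pos rfl

theorem rootFactor_of_pos {d : ℕ} (hd : 0 < d) (v x : ℂ) :
    rootFactor l lam d v x = exchangeFactor l (lam d) (Complex.exp (-v) * x) := if_neg hd.ne'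

theorem eventually_rootFactor_ne_zero (d : ℕ) (v : ℂ) :
    ∀ᶠ x in Bornology.cobounded ℂ, rootFactor l lam d v x ≠ 0 := by
  unfold rootFactor
  split_ifs
  · simp
  · exact eventually_exchangeFactor_ne_zero (Complex.exp_ne_zero _) _

theorem exists_root {i j : ℕ} (hi : 1 ≤ i) (hij : i < j) (hj : j ≤ N) :
    ∃ r : Root N, (r.1.2 : ℕ) - r.1.1 = j - i ∧
      (∀ f : Boson N → ℂ, ∑ x, vecB N i j x * f x = f (.inr (.inl r))) ∧
      (∀ f : Boson N → ℂ, ∑ x, vecC N i j x * f x = f (.inr (.inr r))) := by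
  refine ⟨⟨(⟨i - 1, by omega⟩, ⟨j - 1, by omega⟩), by simp only [Fin.lt_def]; omega⟩, ?_, fun f => ?_, fun f => ?_⟩
  · simp only
    omega
  · rw [Finset.sum_eq_single (.inr (.inl ⟨(⟨i - 1, by omega⟩, ⟨j - 1, by omega⟩), by
      simp only [Fin.lt_def]; omega⟩))]
    · have h1 : i - 1 + 1 = i := by omega
      have h2 : j - 1 + 1 = j := by omega
      simp [vecB, h1, h2]
    · rintro (a | r | r) _ hr
      · simp [vecB]
      · have : ¬ ((r.1.1 : ℕ) + 1 = i ∧ (r.1.2 : ℕ) + 1 = j) := by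
          rintro ⟨h1, h2⟩
          apply hr
          congr 2
          ext <;> simp <;> omega
        simp [vecB, this]
      · simp [vecB]
    · simp
  · rw [Finset.sum_eq_single (.inr (.inr ⟨(⟨i - 1, by omega⟩, ⟨j - 1, by omega⟩), by
      simp only [Fin.lt_def]; omega⟩))]
    · have h1 : i - 1 + 1 = i := by omega
      have h2 : j - 1 + 1 = j := by omega
      simp [vecC, h1, h2]
    · rintro (a | r | r) _ hr
      · simp [vecC]
      · simp [vecC]
      · have : ¬ ((r.1.1 : ℕ) + 1 = i ∧ (r.1.2 : ℕ) + 1 = j) := by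
          rintro ⟨h1, h2⟩
          apply hr
          congr 2
          ext <;> simp <;> omega
        simp [vecC, this]
    · simp

theorem vecB_self (i : ℕ) : vecB N i i = 0 := by
  ext x
  rcases x with a | r | r
  · rfl
  · have : (r.1.1 : ℕ) < r.1.2 := r.2
    exact if_neg (by omega)
  · rfl

theorem vecC_self (i : ℕ) : vecC N i i = 0 := by
  ext x
  rcases x with a | r | r
  · rfl
  · rfl
  · have : (r.1.1 : ℕ) < r.1.2 := r.2
    exact if_neg (by omega)

theorem sum_vecA_mul {i : ℕ} (hi : 1 ≤ i) (hi' : i ≤ N - 1) (f : Boson N → ℂ) :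
    ∑ x, vecA N i x * f x = f (.inl ⟨i - 1, by omega⟩) := by
  rw [Finset.sum_eq_single (.inl ⟨i - 1, by omega⟩)]
  · have h1 : i - 1 + 1 = i := by omega
    simp [vecA, h1]
  · rintro (a | r) _ hr
    · have : ¬ ((a : ℕ) + 1 = i) := by
        rintro h1
        apply hr
        congr 1
        ext
        simp only
        omega
      simp [vecA, this]
    · simp [vecA]
  · simp

theorem symbolExchange_bP (hN : 2 ≤ N) (hq : ‖Complex.exp l‖ < 1)
    (hk : ∀ n : ℕ, 0 < n → qnum l ((k + N) * n) ≠ 0) {i j d : ℕ} {u v : ℂ} (hi : 1 ≤ i) (hij : i ≤ j)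
    (hj : j ≤ N) (hd : j - i = d) (huv : u = v) :
    SymbolExchange N l k (voSum N l k lam) (bP N l i j u) (rootFactor l lam d v) := by
  subst hd huv
  rcases hij.eq_or_lt with rfl | hij
  · have : bP N l i i u = 0 := by
      ext <;> simp [bP, fieldPlus, vecB_self]
    rw [this]
    exact (SymbolExchange.zero _).congr (Filter.Eventually.of_forall fun x => if_pos (Nat.sub_self i))
  · obtain ⟨r, hr, hB, -⟩ := exists_root hi hij hj
    refine (symbolExchange_fieldPlus hN hq hk (v := vecB N i j) (μ := lam (j - i)) (κ := 0) u
      (fun n => ?_) ?_).congr (Filter.Eventually.of_forall fun x => ?_)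
    · simp [hB, response, hr]
    · simp [hB, zeroResponse, hr]
    · rw [rootFactor_of_pos (by omega), add_zero]

theorem symbolExchange_bM (hN : 2 ≤ N) (hq : ‖Complex.exp l‖ < 1)
    (hk : ∀ n : ℕ, 0 < n → qnum l ((k + N) * n) ≠ 0) {i j d : ℕ} {u v : ℂ} (hi : 1 ≤ i) (hij : i ≤ j)
    (hj : j ≤ N) (hd : j - i = d) (huv : u = v) :
    SymbolExchange N l k (voSum N l k lam) (bM N l i j u) (rootFactor l lam d v) := by
  subst hd huv
  rcases hij.eq_or_lt with rfl | hij
  · have : bM N l i i u = 0 := by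
      ext <;> simp [bM, fieldMinus, vecB_self]
    rw [this]
    exact (SymbolExchange.zero _).congr (Filter.Eventually.of_forall fun x => if_pos (Nat.sub_self i))
  · obtain ⟨r, hr, hB, -⟩ := exists_root hi hij hj
    refine (symbolExchange_fieldMinus hN hq hk (v := vecB N i j) (μ := lam (j - i)) (κ := 0) u
      (fun n => ?_) ?_).congr (Filter.Eventually.of_forall fun x => ?_)
    · simp [hB, response, hr]
    · simp [hB, zeroResponse, hr]
    · rw [rootFactor_of_pos (by omega), sub_zero]

/-- The bosons `b` and `c` have commutators of opposite sign and enter `ψ_Λ` with equal coefficients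
in the creation modes and in `q_b`, `q_c`, so their contributions cancel. -/
theorem symbolExchange_bc (hN : 2 ≤ N) (hq : ‖Complex.exp l‖ < 1)
    (hk : ∀ n : ℕ, 0 < n → qnum l ((k + N) * n) ≠ 0) {i j : ℕ} (u : ℂ) (hi : 1 ≤ i) (hij : i ≤ j)
    (hj : j ≤ N) :
    SymbolExchange N l k (voSum N l k lam) (bc N l i j u) fun _ => 1 := by
  rcases hij.eq_or_lt with rfl | hij
  · exact symbolExchange_field hN hq hk u (by simp [vecB_self, vecC_self]) (by simp [vecB_self, vecC_self])
  · obtain ⟨r, -, hB, hC⟩ := exists_root hi hij hj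
    refine symbolExchange_field hN hq hk u (fun n => ?_) ?_
    · simp only [Pi.add_apply, add_mul, Finset.sum_add_distrib, hB, hC, response, neg_add_cancel]
    · simp only [Pi.add_apply, add_mul, Finset.sum_add_distrib, hB, hC, zeroResponse, neg_add_cancel]

theorem sum_neg_vecA_mul_response {i : ℕ} (hi : 1 ≤ i) (hi' : i ≤ N - 1) (n : ℕ+) :
    ∑ x, (-vecA N i) x * response N l k lam n x
      = -(qnum l (lam (N - i) * (n : ℕ)) / (n : ℕ) * Complex.exp (-((k + N) / 2 * l) * (n : ℕ))) := by
  have h1 : i - 1 + 1 = i := by omega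
  simp only [Pi.neg_apply, neg_mul, Finset.sum_neg_distrib, sum_vecA_mul hi hi', response, h1, qpow]
  congr 3
  ring

theorem sum_neg_vecA_mul_zeroResponse {i : ℕ} (hi : 1 ≤ i) (hi' : i ≤ N - 1) :
    ∑ x, (-vecA N i) x * zeroResponse N lam x = -lam (N - i) := by
  have h1 : i - 1 + 1 = i := by omega
  simp only [Pi.neg_apply, neg_mul, Finset.sum_neg_distrib, sum_vecA_mul hi hi', zeroResponse, h1]

/-- The response of `-a^i` is that of a boson `b` with parameter `λ^{N-i}`, up to `q^{-(k+N)n/2}`,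
which is absorbed by moving the point by `q^{(k+N)/2}`. -/
theorem symbolExchange_aP (hN : 2 ≤ N) (hq : ‖Complex.exp l‖ < 1)
    (hk : ∀ n : ℕ, 0 < n → qnum l ((k + N) * n) ≠ 0) {i : ℕ} {u v : ℂ} (hi : 1 ≤ i) (hi' : i ≤ N - 1)
    (huv : u + (k + N) / 2 * l = v) :
    SymbolExchange N l k (voSum N l k lam) (aP N l i u) fun x => (rootFactor l lam (N - i) v x)⁻¹ := by
  subst huv
  have h := (symbolExchange_fieldPlus hN hq hk u (sum_neg_vecA_mul_response (lam := lam) (k := k) hi hi')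
    (sum_neg_vecA_mul_zeroResponse hi hi')).neg
  have e : aP N l i u = -fieldPlus N l (-vecA N i) u := by
    ext <;> simp [aP, fieldPlus]
    split_ifs <;> simp
  rw [e]
  exact h.congr (Filter.Eventually.of_forall fun x => by rw [rootFactor_of_pos (by omega)])

theorem symbolExchange_aM (hN : 2 ≤ N) (hq : ‖Complex.exp l‖ < 1)
    (hk : ∀ n : ℕ, 0 < n → qnum l ((k + N) * n) ≠ 0) {i : ℕ} {u v : ℂ} (hi : 1 ≤ i) (hi' : i ≤ N - 1)
    (huv : u - (k + N) / 2 * l = v) :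
    SymbolExchange N l k (voSum N l k lam) (aM N l i u) fun x => (rootFactor l lam (N - i) v x)⁻¹ := by
  subst huv
  have h := (symbolExchange_fieldMinus hN hq hk u (sum_neg_vecA_mul_response (lam := lam) (k := k) hi hi')
    (sum_neg_vecA_mul_zeroResponse hi hi')).neg
  have e : aM N l i u = -fieldMinus N l (-vecA N i) u := by
    ext <;> simp [aM, fieldMinus]
    split_ifs <;> simp
  rw [e]
  exact h.congr (Filter.Eventually.of_forall fun x => by rw [rootFactor_of_pos (by omega)])

/-! ## Telescoping sums of fields -/

theorem prod_Icc_div_succ {g : ℕ → ℂ} {a n : ℕ} (han : a ≤ n) (hg : ∀ j ∈ Finset.Icc a n, g j ≠ 0) :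
    ∏ j ∈ Finset.Icc (a + 1) n, g (j - 1) / g j = g a / g n := by
  induction n, han using Nat.le_induction with
  | base =>
    have := hg a (by simp)
    simp [this]
  | succ n han ih =>
    rw [Finset.prod_Icc_succ_top (by omega), ih fun j hj => hg j (by
      simp only [Finset.mem_Icc] at hj ⊢; omega), Nat.add_sub_cancel]
    have h1 := hg n (by simp [han])
    exact div_mul_div_cancel₀ h1

namespace SymbolExchange

variable {E : LinComb N} {D D' : ℕ → LinComb N} {g : ℕ → ℂ → ℂ} {a n : ℕ}

/-- Each factor `g j` may vanish or degenerate at isolated points, so the cancellation is performed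
only near infinity, where `SymbolExchange.congr` needs it. -/
theorem sum_sub_telescope (han : a ≤ n) (hg : ∀ j, ∀ᶠ x in Bornology.cobounded ℂ, g j x ≠ 0)
    (h : ∀ j ∈ Finset.Icc (a + 1) n, SymbolExchange N l k E (D j) (g (j - 1)))
    (h' : ∀ j ∈ Finset.Icc (a + 1) n, SymbolExchange N l k E (D' j) (g j)) :
    SymbolExchange N l k E (∑ j ∈ Finset.Icc (a + 1) n, (D j - D' j)) fun x => g a x / g n x := by
  refine (sum fun j hj => (h j hj).sub (h' j hj)).congr ?_
  filter_upwards [(Filter.eventually_all_finset (Finset.Icc a n)).mpr fun j _ => hg j] with x hx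
  exact (prod_Icc_div_succ (g := fun j => g j x) han hx).symm

theorem sum_sub_telescope' (han : a ≤ n) (hg : ∀ j, ∀ᶠ x in Bornology.cobounded ℂ, g j x ≠ 0)
    (h : ∀ j ∈ Finset.Icc (a + 1) n, SymbolExchange N l k E (D j) (g j))
    (h' : ∀ j ∈ Finset.Icc (a + 1) n, SymbolExchange N l k E (D' j) (g (j - 1))) :
    SymbolExchange N l k E (∑ j ∈ Finset.Icc (a + 1) n, (D j - D' j)) fun x => g n x / g a x := by
  have := (sum_sub_telescope han hg h' h).neg
  simp only [← Finset.sum_neg_distrib, neg_sub, inv_div] at this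
  exact this

end SymbolExchange

/-! ## Translation of the fields -/

theorem translate_fieldPlus (v : Boson N → ℂ) (s u : ℂ) :
    translate N s (fieldPlus N l v u) = fieldPlus N l v (s + u) := by
  ext x n
  · rw [translate_osc]
    simp only [fieldPlus]
    split_ifs
    · rw [mul_assoc, ← Complex.exp_add]; ring_nf
    · rw [zero_mul]
  · rw [translate_mom]; simp [fieldPlus]
  · rfl

theorem translate_fieldMinus (v : Boson N → ℂ) (s u : ℂ) :
    translate N s (fieldMinus N l v u) = fieldMinus N l v (s + u) := by
  ext x n
  · rw [translate_osc]
    simp only [fieldMinus]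
    split_ifs
    · rw [neg_mul, mul_assoc, ← Complex.exp_add]; ring_nf
    · rw [zero_mul]
  · rw [translate_mom]; simp [fieldMinus]
  · rfl

theorem translate_field (v : Boson N → ℂ) (s u : ℂ) :
    translate N s (field N l v u) = field N l v (s + u) := by
  ext x n
  · rw [translate_osc]
    simp only [field]
    rw [mul_assoc, ← Complex.exp_add]; ring_nf
  · rw [translate_mom]
    simp only [field]
    ring
  · rfl

theorem translate_aP (i : ℕ) (s u : ℂ) : translate N s (aP N l i u) = aP N l i (s + u) :=
  translate_fieldPlus _ _ _

theorem translate_aM (i : ℕ) (s u : ℂ) : translate N s (aM N l i u) = aM N l i (s + u) :=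
  translate_fieldMinus _ _ _

theorem translate_bP (i j : ℕ) (s u : ℂ) : translate N s (bP N l i j u) = bP N l i j (s + u) :=
  translate_fieldPlus _ _ _

theorem translate_bM (i j : ℕ) (s u : ℂ) : translate N s (bM N l i j u) = bM N l i j (s + u) :=
  translate_fieldMinus _ _ _

theorem translate_bc (i j : ℕ) (s u : ℂ) : translate N s (bc N l i j u) = bc N l i j (s + u) :=
  translate_field _ _ _

/-- Homogeneity reduces the computation of contractions to the exponents at `z = w = 1`. -/
theorem exchange_typeIIVO {L : ℂ → LinComb N} {ρ : ℂ → ℂ} {r : ℂ → ℂ → ℂ}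
    (hL : ∀ s, L s = translate N s (L 0)) (h : SymbolExchange N l k (voSum N l k lam) (L 0) ρ)
    (hr : ∀ s t, r (Complex.exp s) (Complex.exp t) = ρ (Complex.exp (t - s))) :
    Exchange (fun s => normExp N l k (L s)) (typeIIVO N l k lam) r := by
  have h1 := h.exchange voSum_mom hr
  simp only [← hL] at h1
  have h2 : typeIIVO N l k lam = fun t => normExp N l k (translate N t (voSum N l k lam)) :=
    funext fun t => typeIIVO_eq t
  rwa [h2]

theorem mul_div_eq_exchangeFactor (μ c s t : ℂ) :
    qpow l μ * ((Complex.exp t - qpow l (-μ + c) * Complex.exp s)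
        / (Complex.exp t - qpow l (μ + c) * Complex.exp s))
      = exchangeFactor l μ (Complex.exp (-(c * l)) * Complex.exp (t - s)) := by
  have h1 : ∀ b, Complex.exp t - qpow l (b + c) * Complex.exp s
      = (qpow l c * Complex.exp s) * (Complex.exp (-(c * l)) * Complex.exp (t - s) - qpow l b) := by
    intro b
    have h2 : qpow l c * Complex.exp s * (Complex.exp (-(c * l)) * Complex.exp (t - s)) = Complex.exp t := by
      rw [qpow, ← Complex.exp_add, ← Complex.exp_add, ← Complex.exp_add]
      congr 1
      ring
    rw [mul_sub, h2, qpow_add]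
    ring
  rw [exchangeFactor, h1, h1, mul_div_mul_left _ _ (mul_ne_zero (qpow_ne_zero _ _) (Complex.exp_ne_zero _))]

end

noncomputable section

/-! ## The exchange relations of the Wakimoto currents -/

variable {N : ℕ} {l k : ℂ} {lam : ℕ → ℂ} {i : ℕ}

/-- The `b` fields with second index `i` or `i + 1` telescope to the factor with `λ^i` at `q^{k/2}
z`; those with first index `i` or `i + 1` telescope to a factor that cancels `a^i_+`. -/
theorem exchange_psiPlus (hN : 2 ≤ N) (hq : ‖Complex.exp l‖ < 1)
    (hk : ∀ n : ℕ, 0 < n → qnum l ((k + N) * n) ≠ 0) (hi : 1 ≤ i) (hi' : i ≤ N - 1) :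
    Exchange (psiPlus N l k i) (typeIIVO N l k lam)
      (fun z w => qpow l (lam i) * ((w - qpow l (-lam i + k / 2) * z) / (w - qpow l (lam i + k / 2) * z))) := by
  change Exchange (fun s => psiPlus N l k i s) _ _
  unfold psiPlus
  refine exchange_typeIIVO (ρ := rootFactor l lam i (k / 2 * l)) (fun s => ?_) ?_ fun s t => ?_
  · simp only [map_add, map_sub, map_sum, translate_aP, translate_bP, zero_add]
  -- The roots `(j, i+1)` and `(j-1, i)` have the same height and both fields sit at `q^{k/2+j-1}`.
  -- The end `j = i` is trivial because `b^{ii} = 0`, which is why `rootFactor` equals `1` for `d =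
  -- 0`.
  · have h1 := SymbolExchange.sum_sub_telescope (N := N) (l := l) (k := k) (E := voSum N l k lam)
      (D := fun j => bP N l j (i + 1) (0 + (k / 2 + j - 1) * l)) (D' := fun j => bP N l j i (0 + (k / 2 + j) * l))
      (g := fun j => rootFactor l lam (i - j) ((k / 2 + j) * l)) (Nat.zero_le i)
      (fun j => eventually_rootFactor_ne_zero _ _)
      (fun j hj => by
        have hj' := Finset.mem_Icc.mp hj
        exact symbolExchange_bP hN hq hk (by omega) (by omega) (by omega) (by omega)
          (by rw [Nat.cast_sub (by omega)]; push_cast; ring))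
      (fun j hj => by
        have hj' := Finset.mem_Icc.mp hj
        exact symbolExchange_bP hN hq hk (by omega) (by omega) (by omega) rfl (by ring))
    have h2 := SymbolExchange.sum_sub_telescope' (N := N) (l := l) (k := k) (E := voSum N l k lam)
      (D := fun j => bP N l i j (0 + (k / 2 + j) * l)) (D' := fun j => bP N l (i + 1) j (0 + (k / 2 + j - 1) * l))
      (g := fun j => rootFactor l lam (j - i) ((k / 2 + j) * l)) (show i ≤ N by omega)
      (fun j => eventually_rootFactor_ne_zero _ _)
      (fun j hj => by
        have hj' := Finset.mem_Icc.mp hj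
        exact symbolExchange_bP hN hq hk (by omega) (by omega) (by omega) rfl (by ring))
      (fun j hj => by
        have hj' := Finset.mem_Icc.mp hj
        exact symbolExchange_bP hN hq hk (by omega) (by omega) (by omega) (by omega)
          (by rw [Nat.cast_sub (by omega)]; push_cast; ring))
    have h3 := symbolExchange_aP (lam := lam) hN hq hk (u := 0 + N / 2 * l) (v := (k / 2 + N) * l) hi hi' (by ring)
    refine ((h1.add h3).add h2).congr ?_
    -- What is left of the second sum is the factor with parameter `λ^{N-i}` at `q^{k/2+N} z`, of
    -- which `a^i_+` contributes the reciprocal.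
    filter_upwards [eventually_rootFactor_ne_zero (l := l) (lam := lam) (N - i) ((k / 2 + N) * l)] with x hx
    simp only [Nat.sub_self, Nat.sub_zero, rootFactor_zero, Nat.cast_zero, add_zero, div_one]
    rw [mul_assoc, inv_mul_cancel₀ hx, mul_one]
  · rw [mul_div_eq_exchangeFactor, rootFactor_of_pos (by omega)]

theorem exchange_psiMinus (hN : 2 ≤ N) (hq : ‖Complex.exp l‖ < 1)
    (hk : ∀ n : ℕ, 0 < n → qnum l ((k + N) * n) ≠ 0) (hi : 1 ≤ i) (hi' : i ≤ N - 1) :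
    Exchange (psiMinus N l k i) (typeIIVO N l k lam)
      (fun z w => qpow l (lam i) * ((w - qpow l (-lam i - k / 2) * z) / (w - qpow l (lam i - k / 2) * z))) := by
  change Exchange (fun s => psiMinus N l k i s) _ _
  unfold psiMinus
  refine exchange_typeIIVO (ρ := rootFactor l lam i (-(k / 2) * l)) (fun s => ?_) ?_ fun s t => ?_
  · simp only [map_add, map_sub, map_sum, translate_aM, translate_bM, zero_sub, ← sub_eq_add_neg]
  · have h1 := SymbolExchange.sum_sub_telescope (N := N) (l := l) (k := k) (E := voSum N l k lam)
      (D := fun j => bM N l j (i + 1) (0 - (k / 2 + j - 1) * l)) (D' := fun j => bM N l j i (0 - (k / 2 + j) * l))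
      (g := fun j => rootFactor l lam (i - j) (-(k / 2 + j) * l)) (Nat.zero_le i)
      (fun j => eventually_rootFactor_ne_zero _ _)
      (fun j hj => by
        have hj' := Finset.mem_Icc.mp hj
        exact symbolExchange_bM hN hq hk (by omega) (by omega) (by omega) (by omega)
          (by rw [Nat.cast_sub (by omega)]; push_cast; ring))
      (fun j hj => by
        have hj' := Finset.mem_Icc.mp hj
        exact symbolExchange_bM hN hq hk (by omega) (by omega) (by omega) rfl (by ring))
    have h2 := SymbolExchange.sum_sub_telescope' (N := N) (l := l) (k := k) (E := voSum N l k lam)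
      (D := fun j => bM N l i j (0 - (k / 2 + j) * l)) (D' := fun j => bM N l (i + 1) j (0 - (k / 2 + j - 1) * l))
      (g := fun j => rootFactor l lam (j - i) (-(k / 2 + j) * l)) (show i ≤ N by omega)
      (fun j => eventually_rootFactor_ne_zero _ _)
      (fun j hj => by
        have hj' := Finset.mem_Icc.mp hj
        exact symbolExchange_bM hN hq hk (by omega) (by omega) (by omega) rfl (by ring))
      (fun j hj => by
        have hj' := Finset.mem_Icc.mp hj
        exact symbolExchange_bM hN hq hk (by omega) (by omega) (by omega) (by omega)
          (by rw [Nat.cast_sub (by omega)]; push_cast; ring))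
    have h3 := symbolExchange_aM (lam := lam) hN hq hk (u := 0 - N / 2 * l) (v := -(k / 2 + N) * l) hi hi' (by ring)
    refine ((h1.add h3).add h2).congr ?_
    filter_upwards [eventually_rootFactor_ne_zero (l := l) (lam := lam) (N - i) (-(k / 2 + N) * l)] with x hx
    simp only [Nat.sub_self, Nat.sub_zero, rootFactor_zero, Nat.cast_zero, add_zero, div_one]
    rw [mul_assoc, inv_mul_cancel₀ hx, mul_one]
  · rw [sub_eq_add_neg (-lam i), sub_eq_add_neg (lam i), mul_div_eq_exchangeFactor,
      rootFactor_of_pos (by omega)]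

theorem differentiable_prefactor (hq : ‖Complex.exp l‖ < 1) :
    Differentiable ℂ fun s => -1 / ((qpow l 1 - qpow l (-1)) * Complex.exp s) :=
  (differentiable_const _).div (Complex.differentiable_exp.const_mul _) fun _ =>
    mul_ne_zero (qpow_sub_ne_zero hq) (Complex.exp_ne_zero _)

/-- In the `j`-th summand the fields with `m < j` telescope to `g 0 / g (j - 1)`, and `b^{j,i+1}_±`
supplies `g (j - 1)` for either sign. Every summand thus has the factor `g 0`, independent of `j`.
-/
theorem exchange_ePlus (hN : 2 ≤ N) (hq : ‖Complex.exp l‖ < 1)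
    (hk : ∀ n : ℕ, 0 < n → qnum l ((k + N) * n) ≠ 0) (hi : 1 ≤ i) (hi' : i ≤ N - 1) :
    Exchange (ePlus N l k i) (typeIIVO N l k lam)
      (fun z w => qpow l (lam i) * ((w - qpow l (-lam i) * z) / (w - qpow l (lam i) * z))) := by
  change Exchange (fun s => ePlus N l k i s) _ _
  unfold ePlus
  refine Exchange.smul (Exchange.sum fun j hj => ?_) (differentiable_prefactor hq)
  obtain ⟨hj1, hji⟩ := Finset.mem_Icc.mp hj
  have hr : ∀ s t, qpow l (lam i) * ((Complex.exp t - qpow l (-lam i) * Complex.exp s)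
      / (Complex.exp t - qpow l (lam i) * Complex.exp s)) = rootFactor l lam i 0 (Complex.exp (t - s)) := by
    intro s t
    have := mul_div_eq_exchangeFactor (l := l) (lam i) 0 s t
    rwa [add_zero, add_zero, zero_mul, ← rootFactor_of_pos (by omega)] at this
  have h1 := SymbolExchange.sum_sub_telescope (N := N) (l := l) (k := k) (E := voSum N l k lam)
    (D := fun m => bP N l m (i + 1) (0 + (m - 1) * l)) (D' := fun m => bP N l m i (0 + m * l))
    (g := fun m => rootFactor l lam (i - m) (m * l)) (Nat.zero_le (j - 1))
    (fun j => eventually_rootFactor_ne_zero _ _)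
    (fun m hm => by
      have hm' := Finset.mem_Icc.mp hm
      exact symbolExchange_bP hN hq hk (by omega) (by omega) (by omega) (by omega)
        (by rw [Nat.cast_sub (by omega)]; push_cast; ring))
    (fun m hm => by
      have hm' := Finset.mem_Icc.mp hm
      exact symbolExchange_bP hN hq hk (by omega) (by omega) (by omega) rfl (by ring))
  have hbc := symbolExchange_bc (lam := lam) hN hq hk (i := j) (j := i) (0 + (j - 1) * l) hj1 hji (by omega)
  have hbc' := fun u => symbolExchange_bc (lam := lam) hN hq hk (i := j) (j := i + 1) u hj1 (by omega) (by omega)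
  have hne := eventually_rootFactor_ne_zero (l := l) (lam := lam) (i - (j - 1)) ((j - 1 : ℕ) * l)
  refine Exchange.sub (exchange_typeIIVO (ρ := rootFactor l lam i 0) (fun s => ?_) ?_ hr)
    (exchange_typeIIVO (ρ := rootFactor l lam i 0) (fun s => ?_) ?_ hr)
  · simp only [map_add, map_sub, map_sum, translate_bP, translate_bc, zero_add]
  · have hb := symbolExchange_bP (lam := lam) hN hq hk (i := j) (j := i + 1) (d := i - (j - 1))
      (u := 0 + (j - 1) * l) (v := (j - 1 : ℕ) * l) hj1 (by omega) (by omega) (by omega)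
      (by rw [Nat.cast_sub hj1]; push_cast; ring)
    refine ((hbc.add (hb.sub (hbc' _))).add h1).congr ?_
    filter_upwards [hne] with x hx
    simp only [Nat.sub_zero, Nat.cast_zero, zero_mul, div_one, one_mul]
    field_simp
  · simp only [map_add, map_sub, map_sum, translate_bP, translate_bM, translate_bc, zero_add]
  · have hb := symbolExchange_bM (lam := lam) hN hq hk (i := j) (j := i + 1) (d := i - (j - 1))
      (u := 0 + (j - 1) * l) (v := (j - 1 : ℕ) * l) hj1 (by omega) (by omega) (by omega)
      (by rw [Nat.cast_sub hj1]; push_cast; ring)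
    refine ((hbc.add (hb.sub (hbc' _))).add h1).congr ?_
    filter_upwards [hne] with x hx
    simp only [Nat.sub_zero, Nat.cast_zero, zero_mul, div_one, one_mul]
    field_simp

/-! ### The common tails of `e^{-,i}` and the exchange relation of this current. -/

theorem tailMinus_eq_translate (s : ℂ) : tailMinus N l k i s = translate N s (tailMinus N l k i 0) := by
  simp only [tailMinus, map_add, map_sub, map_sum, translate_aM, translate_bM, zero_sub, ← sub_eq_add_neg]

theorem tailPlus_eq_translate (j : ℕ) (s : ℂ) :
    tailPlus N l k i j s = translate N s (tailPlus N l k i j 0) := by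
  simp only [tailPlus, map_add, map_sub, map_sum, translate_aP, translate_bP, zero_add]

theorem symbolExchange_tailMinus (hN : 2 ≤ N) (hq : ‖Complex.exp l‖ < 1)
    (hk : ∀ n : ℕ, 0 < n → qnum l ((k + N) * n) ≠ 0) (hi : 1 ≤ i) (hi' : i ≤ N - 1) :
    SymbolExchange N l k (voSum N l k lam) (tailMinus N l k i 0) fun _ => 1 := by
  have h2 := SymbolExchange.sum_sub_telescope' (N := N) (l := l) (k := k) (E := voSum N l k lam)
    (D := fun j => bM N l i j (0 - (k + j) * l)) (D' := fun j => bM N l (i + 1) j (0 - (k + j - 1) * l))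
    (g := fun j => rootFactor l lam (j - i) (-(k + j) * l)) (show i ≤ N by omega)
    (fun j => eventually_rootFactor_ne_zero _ _)
    (fun j hj => by
      have hj' := Finset.mem_Icc.mp hj
      exact symbolExchange_bM hN hq hk (by omega) (by omega) (by omega) rfl (by ring))
    (fun j hj => by
      have hj' := Finset.mem_Icc.mp hj
      exact symbolExchange_bM hN hq hk (by omega) (by omega) (by omega) (by omega)
        (by rw [Nat.cast_sub (by omega)]; push_cast; ring))
  have h3 := symbolExchange_aM (lam := lam) hN hq hk (u := 0 - (k + N) / 2 * l) (v := -(k + N) * l) hi hi' (by ring)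
  refine (h3.add h2).congr ?_
  filter_upwards [eventually_rootFactor_ne_zero (l := l) (lam := lam) (N - i) (-(k + N) * l)] with x hx
  simp only [Nat.sub_self, rootFactor_zero, div_one]
  rw [inv_mul_cancel₀ hx]

/-- The upper end of the telescope cancels `a^i_+`, leaving the reciprocal of its lower end. At `j =
i` that end is `1`. -/
theorem symbolExchange_tailPlus (hN : 2 ≤ N) (hq : ‖Complex.exp l‖ < 1)
    (hk : ∀ n : ℕ, 0 < n → qnum l ((k + N) * n) ≠ 0) (hi : 1 ≤ i) (hi' : i ≤ N - 1) {j : ℕ}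
    (hij : i ≤ j) (hj : j + 1 ≤ N) :
    SymbolExchange N l k (voSum N l k lam) (tailPlus N l k i (j + 1) 0)
      fun x => (rootFactor l lam (j - i) ((k + j) * l) x)⁻¹ := by
  have h2 := SymbolExchange.sum_sub_telescope' (N := N) (l := l) (k := k) (E := voSum N l k lam)
    (D := fun j => bP N l i j (0 + (k + j) * l)) (D' := fun j => bP N l (i + 1) j (0 + (k + j - 1) * l))
    (g := fun j => rootFactor l lam (j - i) ((k + j) * l)) (show j ≤ N by omega)
    (fun j => eventually_rootFactor_ne_zero _ _)
    (fun j hj => by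
      have hj' := Finset.mem_Icc.mp hj
      exact symbolExchange_bP hN hq hk (by omega) (by omega) (by omega) rfl (by ring))
    (fun j hj => by
      have hj' := Finset.mem_Icc.mp hj
      exact symbolExchange_bP hN hq hk (by omega) (by omega) (by omega) (by omega)
        (by rw [Nat.cast_sub (by omega)]; push_cast; ring))
  have h3 := symbolExchange_aP (lam := lam) hN hq hk (u := 0 + (k + N) / 2 * l) (v := (k + N) * l) hi hi' (by ring)
  refine (h3.add h2).congr ?_
  filter_upwards [eventually_rootFactor_ne_zero (l := l) (lam := lam) (N - i) ((k + N) * l)] with x hx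
  rw [← mul_div_assoc, inv_mul_cancel₀ hx, one_div]

/-- Every summand has trivial factor. For `j < i` the reciprocal from `-b^{j,i}_±` cancels the
telescoped sum and the tail is trivial; for `j ≥ i + 2` the field `b^{i+1,j}_±` cancels the lower
end of the tail; for the two middle terms the tails themselves are trivial. -/
theorem exchange_eMinus (hN : 2 ≤ N) (hq : ‖Complex.exp l‖ < 1)
    (hk : ∀ n : ℕ, 0 < n → qnum l ((k + N) * n) ≠ 0) (hi : 1 ≤ i) (hi' : i ≤ N - 1) :
    Exchange (eMinus N l k i) (typeIIVO N l k lam) (fun _ _ => 1) := by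
  change Exchange (fun s => eMinus N l k i s) _ _
  unfold eMinus
  have htm := symbolExchange_tailMinus (lam := lam) hN hq hk hi hi'
  have hbc := fun (i' j' : ℕ) (u : ℂ) => symbolExchange_bc (lam := lam) hN hq hk (i := i') (j := j') u
  refine Exchange.smul (Exchange.sub (Exchange.sub (Exchange.add (Exchange.sum fun j hj => ?_)
    (exchange_typeIIVO (ρ := fun _ => 1) (fun s => ?_) ?_ fun _ _ => rfl))
    (exchange_typeIIVO (ρ := fun _ => 1) (fun s => ?_) ?_ fun _ _ => rfl)) (Exchange.sum fun j hj => ?_))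
    (differentiable_prefactor hq)
  · obtain ⟨hj1, hji⟩ := Finset.mem_Icc.mp hj
    have h1 := SymbolExchange.sum_sub_telescope (N := N) (l := l) (k := k) (E := voSum N l k lam)
      (D := fun m => bM N l m (i + 1) (0 - (k + m - 1) * l)) (D' := fun m => bM N l m i (0 - (k + m) * l))
      (g := fun m => rootFactor l lam (i - m) (-(k + m) * l)) (show j ≤ i by omega)
      (fun j => eventually_rootFactor_ne_zero _ _)
      (fun m hm => by
        have hm' := Finset.mem_Icc.mp hm
        exact symbolExchange_bM hN hq hk (by omega) (by omega) (by omega) (by omega)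
          (by rw [Nat.cast_sub (by omega)]; push_cast; ring))
      (fun m hm => by
        have hm' := Finset.mem_Icc.mp hm
        exact symbolExchange_bM hN hq hk (by omega) (by omega) (by omega) rfl (by ring))
    have hne := eventually_rootFactor_ne_zero (l := l) (lam := lam) (i - j) (-(k + j) * l)
    refine Exchange.sub (exchange_typeIIVO (ρ := fun _ => 1) (fun s => ?_) ?_ fun _ _ => rfl)
      (exchange_typeIIVO (ρ := fun _ => 1) (fun s => ?_) ?_ fun _ _ => rfl)
    · rw [tailMinus_eq_translate s]
      simp only [map_add, map_sub, map_sum, map_neg, translate_bM, translate_bc, zero_sub, ← sub_eq_add_neg]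
    · have hb := symbolExchange_bM (lam := lam) hN hq hk (i := j) (j := i) (d := i - j)
        (u := 0 - (k + j) * l) (v := -(k + j) * l) hj1 (by omega) (by omega) rfl (by ring)
      refine (((hbc j (i + 1) _ hj1 (by omega) (by omega)).add (hb.neg.sub
        (hbc j i _ hj1 (by omega) (by omega)))).add (h1.add htm)).congr ?_
      filter_upwards [hne] with x hx
      simp only [Nat.sub_self, rootFactor_zero, div_one, one_mul, mul_one]
      rw [inv_mul_cancel₀ hx]
    · rw [tailMinus_eq_translate s]
      simp only [map_add, map_sub, map_sum, map_neg, translate_bM, translate_bP, translate_bc, zero_sub,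
        ← sub_eq_add_neg]
    · have hb := symbolExchange_bP (lam := lam) hN hq hk (i := j) (j := i) (d := i - j)
        (u := 0 - (k + j) * l) (v := -(k + j) * l) hj1 (by omega) (by omega) rfl (by ring)
      refine (((hbc j (i + 1) _ hj1 (by omega) (by omega)).add (hb.neg.sub
        (hbc j i _ hj1 (by omega) (by omega)))).add (h1.add htm)).congr ?_
      filter_upwards [hne] with x hx
      simp only [Nat.sub_self, rootFactor_zero, div_one, one_mul, mul_one]
      rw [inv_mul_cancel₀ hx]
  · rw [tailMinus_eq_translate s]
    simp only [map_add, translate_bc, zero_sub, ← sub_eq_add_neg]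
  · refine ((hbc i (i + 1) _ hi (by omega) (by omega)).add htm).congr ?_
    simp
  · rw [tailPlus_eq_translate _ s]
    simp only [map_add, translate_bc, zero_add]
  · refine ((hbc i (i + 1) _ hi (by omega) (by omega)).add
      (symbolExchange_tailPlus (lam := lam) hN hq hk hi hi' le_rfl (by omega))).congr ?_
    simp [rootFactor_zero]
  · obtain ⟨hj1, hji⟩ := Finset.mem_Icc.mp hj
    -- The tail starting at `m = j` telescopes down to index `j - 1`, which matches the height of
    -- the root `(i+1, j)`.
    have htp := symbolExchange_tailPlus (lam := lam) hN hq hk hi hi' (j := j - 1) (by omega) (by omega)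
    rw [show j - 1 + 1 = j by omega] at htp
    have hne := eventually_rootFactor_ne_zero (l := l) (lam := lam) (j - 1 - i) ((k + (j - 1 : ℕ)) * l)
    have huv : 0 + (k + j - 1) * l = (k + (j - 1 : ℕ)) * l := by
      rw [Nat.cast_sub (by omega)]; push_cast; ring
    refine Exchange.sub (exchange_typeIIVO (ρ := fun _ => 1) (fun s => ?_) ?_ fun _ _ => rfl)
      (exchange_typeIIVO (ρ := fun _ => 1) (fun s => ?_) ?_ fun _ _ => rfl)
    · rw [tailPlus_eq_translate _ s]
      simp only [map_add, map_sub, translate_bP, translate_bc, zero_add]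
    · have hb := symbolExchange_bP (lam := lam) hN hq hk (i := i + 1) (j := j) (d := j - 1 - i)
        (by omega) (by omega) (by omega) (by omega) huv
      refine (((hbc i j _ hi (by omega) (by omega)).add (hb.sub
        (hbc (i + 1) j _ (by omega) (by omega) (by omega)))).add htp).congr ?_
      filter_upwards [hne] with x hx
      rw [div_one, one_mul, mul_inv_cancel₀ hx]
    · rw [tailPlus_eq_translate _ s]
      simp only [map_add, map_sub, translate_bM, translate_bc, zero_add]
    · have hb := symbolExchange_bM (lam := lam) hN hq hk (i := i + 1) (j := j) (d := j - 1 - i)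
        (by omega) (by omega) (by omega) (by omega) huv
      refine (((hbc i j _ hi (by omega) (by omega)).add (hb.sub
        (hbc (i + 1) j _ (by omega) (by omega) (by omega)))).add htp).congr ?_
      filter_upwards [hne] with x hx
      rw [div_one, one_mul, mul_inv_cancel₀ hx]

end

end QWakimoto

theorem theorem4 (N : ℕ) (hN : 2 ≤ N)
    (l : ℂ) (hq : ‖Complex.exp l‖ < 1)
    (k : ℂ) (hk : ∀ n : ℕ, 0 < n → QWakimoto.qnum l ((k + N) * n) ≠ 0)
    (lam : ℕ → ℂ) (i : ℕ) (hi : 1 ≤ i) (hi' : i ≤ N - 1) :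
    QWakimoto.Exchange (QWakimoto.psiPlus N l k i) (QWakimoto.typeIIVO N l k lam)
      (fun z w => QWakimoto.qpow l (lam i)
        * ((w - QWakimoto.qpow l (-lam i + k / 2) * z)
          / (w - QWakimoto.qpow l (lam i + k / 2) * z))) ∧
    QWakimoto.Exchange (QWakimoto.psiMinus N l k i) (QWakimoto.typeIIVO N l k lam)
      (fun z w => QWakimoto.qpow l (lam i)
        * ((w - QWakimoto.qpow l (-lam i - k / 2) * z)
          / (w - QWakimoto.qpow l (lam i - k / 2) * z))) ∧
    QWakimoto.Exchange (QWakimoto.ePlus N l k i) (QWakimoto.typeIIVO N l k lam)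
      (fun z w => QWakimoto.qpow l (lam i)
        * ((w - QWakimoto.qpow l (-lam i) * z)
          / (w - QWakimoto.qpow l (lam i) * z))) ∧
    QWakimoto.Exchange (QWakimoto.eMinus N l k i) (QWakimoto.typeIIVO N l k lam)
      (fun _ _ => 1) :=
  ⟨QWakimoto.exchange_psiPlus hN hq hk hi hi', QWakimoto.exchange_psiMinus hN hq hk hi hi',
    QWakimoto.exchange_ePlus hN hq hk hi hi', QWakimoto.exchange_eMinus hN hq hk hi hi'⟩
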